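/- Let $A$ be a finite alphabet, let $h\colon A^+\to S$ be a surjective morphism onto a (non-empty) finite semigroup, and write $[s]=h^{-1}(s)$ and $[R]=\bigcup_{(s,t)\in R}[s][t]^\omega\subseteq A^\omega$ for $R\subseteq S\times S$. A pair $(s,e)\in S\times S$ is linked if $e^2=e$ and $se=s$; linked pairs $(s,e),(t,f)$ are conjugate if $sx=t$, $xy=e$, $yx=f$ for some $x,y\in S$. Let $P$ be a set of linked pairs closed under conjugation and let $L=[P]$ (so $h$ strongly recognizes $L$). The syntactic congruence of $L$ is the relation on $A^+$ given by $u\equiv_L v$ iff $(xuy)z^\omega\in L\Leftrightarrow(xvy)z^\omega\in L$ and $z(xuy)^\omega\in L\Leftrightarrow z(xvy)^\omega\in L$ for all $x,y,z\in A^*$ (the first condition being void for $z=\varepsilon$); the syntactic morphism of $L$ is the quotient map $h_L\colon A^+\to A^+/{\equiv_L}$ onto the syntactic semigroup. Let $Q$ be the maximal subset of $S\times S$ with $[Q]=[P]$. Let $s\cong t$ mean that $(z,s)\in Q\Leftrightarrow(z,t)\in Q$ and $(s,z)\in Q\Leftrightarrow(t,z)\in Q$ for all $z\in S$, and let $\equiv$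 be the coarsest congruence on $S$ refining $\cong$, i.e. $s\equiv t$ iff $xsy\cong xty$ for all $x,y\in S^1$. Consider the following algorithm, which maintains a partition $\mathcal P$ of $S$ and a set $T$ of classes. The operation $\mathrm{Split}(X)$ does the following for every class $C\in\mathcal P$, with $C_1=C\cap X$ and $C_2=C\setminus X$: if both are non-empty, replace $C$ by $C_1,C_2$ in $\mathcal P$; moreover, if $C\in T$, replace $C$ by $C_1,C_2$ in $T$, and otherwise add $C_1$ to $T$ if $|C_1|\le|C_2|$ and $C_2$ to $T$ if not. The algorithm is: 1. Start with the single class $S$; for all $s\in S$, execute $\mathrm{Split}(\{t:(s,t)\in Q\})$ and $\mathrm{Split}(\{t:(t,s)\in Q\})$. 2. Let $T$ be the set of all classes of the partition other than $S$ itself. While $T\neq\emptyset$: remove some $C$ from $T$, and for all $a\in A$ execute $\mathrm{Split}(\{s: s\,h(a)\in C\})$ and $\mathrm{Split}(\{s: h(a)\,s\in C\})$. **Theorem.** (i) For every order in which the algorithm enumerates $S$, $A$ and the classes and picks sets from $T$: after step 1 the classes are those of $\cong$; the algorithm terminates, and upon termination the classes are those of $\equiv$; and $h(w)\mapsto h_L(w)$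 induces an isomorphism from $S/{\equiv}$ onto the syntactic semigroup $A^+/{\equiv_L}$. If every operation $\mathrm{Split}(X)$ is charged $|X|+1$ units of time, every iteration of the main loop one further unit, and the set-up $|S|$ units, then the total running time of every run is $O(|S|^2+|A|\cdot|S|\log|S|)$, with an absolute constant. (ii) The syntactic morphism can be computed in time $O(|S|^2+|A|\cdot|S|\log|S|)$: there is a single program for a random access machine with unit-cost operations and words of $O(\log(|A|+|S|))$ bits, zero-initialized memory, and unit-cost access to the multiplication of $S$, to the map $a\mapsto h(a)$ on $A$ and to membership in $P$ (for arbitrary numberings of $A$ and $S$), which on every input $(h,P)$ as above halts within this time, with an absolute constant, and outputs, for some numbering of the syntactic semigroup, its number of elements, its multiplication table, the images of the letters under $h_L$, and for every $s\in S$ the common image under $h_L$ of all words in $[s]$. -/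

import Mathlib

universe u v

namespace OmegaSyn

/-! ### Finite and infinite words

`FreeSemigroup A` is `A⁺`, `Stream' A` is the set of infinite words over `A`. -/

section Words

variable {A : Type u}

/-- The list of letters of a non-empty finite word. -/
def letters (w : FreeSemigroup A) : List A := w.head :: w.tail

/-- The infinite word `w α`. -/
def prepend (w : FreeSemigroup A) (α : Stream' A) : Stream' A := letters w ++ₛ α

/-- The infinite concatenation `v₀ v₁ v₂ ⋯`. Its `n`-th letter is the `n`-th letter of
`v₀ v₁ ⋯ vₙ`, which has at least `n + 1` letters, so the default value is never used. -/
def omegaProd (w : ℕ → FreeSemigroup A) : Stream' A := fun n =>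
  (((List.range (n + 1)).map fun i => letters (w i)).flatten).getD n (w 0).head

/-- The ultimately periodic word `w^ω`. -/
def omegaPow (w : FreeSemigroup A) : Stream' A := omegaProd fun _ => w

/-- `z w^ω` for a possibly empty word `z` (`none` is the empty word). -/
def prependPow (z : Option (FreeSemigroup A)) (w : FreeSemigroup A) : Stream' A :=
  match z with
  | none => omegaPow w
  | some z => prepend z (omegaPow w)

end Words

/-! ### Contexts and congruences -/

section Contexts

variable {S : Type u} [Semigroup S]

/-- `x s y` with `x, y ∈ S¹`; `none` is the adjoined neutral element (for `S = A⁺` this is the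
empty word, so that `S¹ = A*`). -/
def ctx (x : Option S) (s : S) (y : Option S) : S :=
  match x, y with
  | none, none => s
  | some x, none => x * s
  | none, some y => s * y
  | some x, some y => x * s * y

/-- The congruence `s ≡ t` iff `x s y ≈ x t y` for all `x, y ∈ S¹`, for an equivalence
relation `≈` on `S`. -/
def ctxCon (r : Setoid S) : Con S where
  r s t := ∀ x y : Option S, r (ctx x s y) (ctx x t y)
  iseqv :=
    ⟨fun _ _ _ => r.refl _, fun h x y => r.symm (h x y), fun h k x y => r.trans (h x y) (k x y)⟩
  mul' := by
    intro w x y z h k a b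
    have e1 : ∀ p q : S, ctx a (p * q) b =
        ctx a p (some (match b with | none => q | some b => q * b)) := by
      intro p q; cases a <;> cases b <;> simp [ctx, mul_assoc]
    have e2 : ∀ p q : S, ctx a (p * q) b =
        ctx (some (match a with | none => p | some a => a * p)) q b := by
      intro p q; cases a <;> cases b <;> simp [ctx, mul_assoc]
    have h1 : r (ctx a (w * y) b) (ctx a (x * y) b) := by
      rw [e1, e1]; exact h _ _
    have h2 : r (ctx a (x * y) b) (ctx a (x * z) b) := by
      rw [e2, e2]; exact k _ _
    exact r.trans h1 h2

/-- `ctxCon r` is the coarsest congruence that refines `r`. -/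
theorem ctxCon_isGreatest (r : Setoid S) :
    IsGreatest {c : Con S | ∀ s t, c s t → r s t} (ctxCon r) := by
  refine ⟨fun s t h => h none none, fun c hc s t h x y => hc _ _ ?_⟩
  cases x <;> cases y <;> simp only [ctx]
  · exact h
  · exact c.mul h (c.refl _)
  · exact c.mul (c.refl _) h
  · exact c.mul (c.mul (c.refl _) h) (c.refl _)

end Contexts

/-! ### The syntactic congruence -/

section Syntactic

variable {A : Type u}

/-- `u` and `v` are related if `u z^ω ∈ L ↔ v z^ω ∈ L` for all `z ∈ A⁺` and
`z u^ω ∈ L ↔ z v^ω ∈ L` for all `z ∈ A*`. -/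
def wordSetoid (L : Set (Stream' A)) : Setoid (FreeSemigroup A) where
  r s t := (∀ z : FreeSemigroup A, prepend s (omegaPow z) ∈ L ↔ prepend t (omegaPow z) ∈ L) ∧
    ∀ z : Option (FreeSemigroup A), prependPow z s ∈ L ↔ prependPow z t ∈ L
  iseqv :=
    ⟨fun _ => ⟨fun _ => Iff.rfl, fun _ => Iff.rfl⟩,
      fun h => ⟨fun z => (h.1 z).symm, fun z => (h.2 z).symm⟩,
      fun h k => ⟨fun z => (h.1 z).trans (k.1 z), fun z => (h.2 z).trans (k.2 z)⟩⟩

/-- The syntactic congruence: `u ≡_L v` iff for all `x, y, z ∈ A*` we have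
`(x u y) z^ω ∈ L ↔ (x v y) z^ω ∈ L` and `z (x u y)^ω ∈ L ↔ z (x v y)^ω ∈ L`.
(There is no infinite word `ε^ω`, so `z` is non-empty in the first equivalence.) -/
def syntacticCon (L : Set (Stream' A)) : Con (FreeSemigroup A) := ctxCon (wordSetoid L)

/-- The syntactic semigroup `A⁺ / ≡_L`. -/
abbrev SyntacticSemigroup (L : Set (Stream' A)) : Type u := (syntacticCon L).Quotient

/-- The syntactic morphism `A⁺ → A⁺ / ≡_L`. -/
def syntacticHom (L : Set (Stream' A)) : FreeSemigroup A →ₙ* SyntacticSemigroup L where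
  toFun w := (w : (syntacticCon L).Quotient)
  map_mul' _ _ := rfl

end Syntactic

/-! ### Linked pairs and recognition by morphisms -/

section Recognition

variable {A : Type u} {S : Type v} [Semigroup S]

def IsLinked (p : S × S) : Prop := p.2 * p.2 = p.2 ∧ p.1 * p.2 = p.1

/-- `(s, e) ∼ (t, f)` iff `s x = t`, `x y = e` and `y x = f` for some `x, y ∈ S`. -/
def Conjugate (p q : S × S) : Prop := ∃ x y : S, p.1 * x = q.1 ∧ x * y = p.2 ∧ y * x = q.2

/-- `P` is a set of linked pairs that is closed under conjugation. -/
def IsClosedLinked (P : Set (S × S)) : Prop :=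
  (∀ p ∈ P, IsLinked p) ∧ ∀ p ∈ P, ∀ q, IsLinked q → Conjugate p q → q ∈ P

/-- The language `[s][t]^ω`, where `[s] = h⁻¹(s)`. -/
def block (h : FreeSemigroup A →ₙ* S) (s t : S) : Set (Stream' A) :=
  {α | ∃ (x : FreeSemigroup A) (w : ℕ → FreeSemigroup A),
    h x = s ∧ (∀ i, h (w i) = t) ∧ α = prepend x (omegaProd w)}

/-- The language `[P] = ⋃_{(s, t) ∈ P} [s][t]^ω`. -/
def lang (h : FreeSemigroup A →ₙ* S) (P : Set (S × S)) : Set (Stream' A) :=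
  ⋃ p ∈ P, block h p.1 p.2

/-- The maximal `Q ⊆ S × S` with `[Q] = [P]`. -/
def maxPairs (h : FreeSemigroup A →ₙ* S) (P : Set (S × S)) : Set (S × S) :=
  {p | block h p.1 p.2 ⊆ lang h P}

theorem maxPairs_isGreatest (h : FreeSemigroup A →ₙ* S) (P : Set (S × S)) :
    IsGreatest {Q : Set (S × S) | lang h Q = lang h P} (maxPairs h P) := by
  have key : ∀ Q : Set (S × S), ∀ p ∈ Q, block h p.1 p.2 ⊆ lang h Q := fun Q p hp =>
    Set.subset_biUnion_of_mem (u := fun p : S × S => block h p.1 p.2) hp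
  refine ⟨Set.Subset.antisymm (Set.iUnion₂_subset fun p hp => hp)
    (Set.iUnion₂_subset fun p hp => key _ p (key P p hp)), fun Q hQ p hp => ?_⟩
  have hQ' : lang h Q = lang h P := hQ
  show block h p.1 p.2 ⊆ lang h P
  rw [← hQ']
  exact key Q p hp

/-- The relation `s ≅ t`: for all `z`, `(z, s) ∈ Q ↔ (z, t) ∈ Q` and `(s, z) ∈ Q ↔ (t, z) ∈ Q`. -/
def pairSetoid (Q : Set (S × S)) : Setoid S where
  r s t := ∀ z : S, ((z, s) ∈ Q ↔ (z, t) ∈ Q) ∧ ((s, z) ∈ Q ↔ (t, z) ∈ Q)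
  iseqv :=
    ⟨fun _ _ => ⟨Iff.rfl, Iff.rfl⟩, fun h z => ⟨(h z).1.symm, (h z).2.symm⟩,
      fun h k z => ⟨(h z).1.trans (k z).1, (h z).2.trans (k z).2⟩⟩

/-- The relation `≅` of the set `P`. -/
def cong (h : FreeSemigroup A →ₙ* S) (P : Set (S × S)) : Setoid S := pairSetoid (maxPairs h P)

/-- The relation `≡` of the set `P`: the coarsest congruence that refines `≅`. -/
def equivCon (h : FreeSemigroup A →ₙ* S) (P : Set (S × S)) : Con S := ctxCon (cong h P)

end Recognition

/-! ### The partition refinement algorithm -/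

section Refinement

variable {A : Type u} {S : Type v}

/-- `parts` is the set of equivalence classes of `r`. -/
def IsClasses (r : S → S → Prop) (parts : Finset (Finset S)) : Prop :=
  ∀ C : Finset S, C ∈ parts ↔ ∃ s, ∀ t, t ∈ C ↔ r s t

/-- A partition of `S` together with the set `T` of classes that still have to be processed. -/
structure RState (S : Type v) where
  parts : Finset (Finset S)
  work : Finset (Finset S)

open scoped Classical in
/-- The body of the loop of `Split(X)`, for the class `C` of the partition. -/
noncomputable def splitClass (X : Finset S) (st : RState S) (C : Finset S) : RState S :=
  let C₁ := C ∩ X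
  let C₂ := C \ X
  if C₁ ≠ ∅ ∧ C₂ ≠ ∅ then
    { parts := st.parts.erase C ∪ {C₁, C₂}
      work :=
        if C ∈ st.work then st.work.erase C ∪ {C₁, C₂}
        else if C₁.card ≤ C₂.card then st.work ∪ {C₁} else st.work ∪ {C₂} }
  else st

/-- `l` lists each element that satisfies `p` exactly once, and no other element. -/
def Enumerates {α : Type*} (l : List α) (p : α → Prop) : Prop := l.Nodup ∧ ∀ a, a ∈ l ↔ p a

/-- `Split(X)`: the body is executed for all classes of the current partition, in any order. -/
def Split (X : Finset S) (st st' : RState S) : Prop :=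
  ∃ l : List (Finset S), Enumerates l (fun C => C ∈ st.parts) ∧ st' = l.foldl (splitClass X) st

/-- `SplitSeq l st c st'`: the operations `Split(X)`, for the members `X` of `l` in this order,
lead from `st` to `st'`; `c` is their cost when every `Split(X)` is charged `|X| + 1`. -/
inductive SplitSeq : List (Finset S) → RState S → ℕ → RState S → Prop
  | nil (st : RState S) : SplitSeq [] st 0 st
  | cons {X : Finset S} {l : List (Finset S)} {st st₁ st₂ : RState S} {c : ℕ} :
      Split X st st₁ → SplitSeq l st₁ c st₂ → SplitSeq (X :: l) st (X.card + 1 + c) st₂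

variable [Fintype S] [Semigroup S]

open scoped Classical in
/-- `{t | (s, t) ∈ Q}`. -/
noncomputable def rowSet (Q : Set (S × S)) (s : S) : Finset S :=
  Finset.univ.filter fun t => (s, t) ∈ Q

open scoped Classical in
/-- `{t | (t, s) ∈ Q}`. -/
noncomputable def colSet (Q : Set (S × S)) (s : S) : Finset S :=
  Finset.univ.filter fun t => (t, s) ∈ Q

open scoped Classical in
/-- `C · a⁻¹ = {s | s h(a) ∈ C}`. -/
noncomputable def rightInv (h : FreeSemigroup A →ₙ* S) (C : Finset S) (a : A) : Finset S :=
  Finset.univ.filter fun s => s * h (FreeSemigroup.of a) ∈ C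

open scoped Classical in
/-- `a⁻¹ · C = {s | h(a) s ∈ C}`. -/
noncomputable def leftInv (h : FreeSemigroup A →ₙ* S) (C : Finset S) (a : A) : Finset S :=
  Finset.univ.filter fun s => h (FreeSemigroup.of a) * s ∈ C

/-- The first phase: starting with the single class `S`, execute `Split({t | (s, t) ∈ Q})` and
`Split({t | (t, s) ∈ Q})` for all `s ∈ S`, in any order. The set-up is charged `|S|`. -/
def InitRun (h : FreeSemigroup A →ₙ* S) (P : Set (S × S)) (c : ℕ) (st : RState S) : Prop :=
  ∃ (l : List S) (c' : ℕ), Enumerates l (fun _ => True) ∧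
    SplitSeq (l.flatMap fun s => [rowSet (maxPairs h P) s, colSet (maxPairs h P) s])
      ⟨{Finset.univ}, ∅⟩ c' st ∧
    c = Fintype.card S + c'

open scoped Classical in
/-- `Run h P c st`: the algorithm may reach the state `st`, at the start of an iteration of its
main loop, after steps of total cost `c`. After the first phase, `T` is initialized with all
classes other than `S` itself. An iteration removes any class `C` from `T` and executes
`Split(C · a⁻¹)` and `Split(a⁻¹ · C)` for all letters `a`, in any order; the loop ends when `T`
is empty. -/
inductive Run (h : FreeSemigroup A →ₙ* S) (P : Set (S × S)) : ℕ → RState S → Prop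
  | start {c : ℕ} {st : RState S} : InitRun h P c st →
      Run h P c ⟨st.parts, st.parts.filter fun C => C ≠ Finset.univ⟩
  | step {c c' : ℕ} {st st' : RState S} {C : Finset S} {l : List A} : Run h P c st →
      C ∈ st.work → Enumerates l (fun _ => True) →
      SplitSeq (l.flatMap fun a => [rightInv h C a, leftInv h C a])
        ⟨st.parts, st.work.erase C⟩ c' st' →
      Run h P (c + 1 + c') st'

end Refinement

/-! ### The machine model

Structured programs of a word RAM with finitely many registers and arrays, in which every
elementary operation takes one unit of time. The input semigroup, the images of the letters and
the set `P` are accessed through elementary operations. -/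

section Machine

/-- A semigroup on `{0, …, n - 1}`, the images of the letters `{0, …, m - 1}`, and a set of pairs. -/
structure Input where
  n : ℕ
  m : ℕ
  mul : Fin n → Fin n → Fin n
  gen : Fin m → Fin n
  acc : Fin n → Fin n → Prop

/-- Arithmetic expressions: constants, registers, array cells, arithmetic of natural numbers
(`sub` is truncated subtraction), products in the semigroup, images of letters, and the test
for membership in `P` (with result `1` or `0`). -/
inductive Expr
  | const (k : ℕ)
  | reg (x : ℕ)
  | cell (a : ℕ) (i : Expr)
  | add (e f : Expr)
  | sub (e f : Expr)
  | mul (e f : Expr)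
  | prod (e f : Expr)
  | gen (e : Expr)
  | acc (e f : Expr)

inductive Test
  | lt (e f : Expr)
  | eq (e f : Expr)

inductive Prog
  | skip
  | assign (x : ℕ) (e : Expr)
  | store (a : ℕ) (i e : Expr)
  | seq (p q : Prog)
  | ite (b : Test) (p q : Prog)
  | loop (b : Test) (p : Prog)

/-- The number of operations in the evaluation of an expression. -/
def Expr.cost : Expr → ℕ
  | .const _ => 1
  | .reg _ => 1
  | .cell _ i => i.cost + 1
  | .add e f => e.cost + f.cost + 1
  | .sub e f => e.cost + f.cost + 1
  | .mul e f => e.cost + f.cost + 1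
  | .prod e f => e.cost + f.cost + 1
  | .gen e => e.cost + 1
  | .acc e f => e.cost + f.cost + 1

def Test.cost : Test → ℕ
  | .lt e f => e.cost + f.cost + 1
  | .eq e f => e.cost + f.cost + 1

/-- The contents of the registers and of the arrays. -/
structure Mem where
  reg : ℕ → ℕ
  arr : ℕ → ℕ → ℕ

/-- Words hold the numbers below `W`. -/
def fit (W k : ℕ) : Option ℕ := if k < W then some k else none

open scoped Classical in
/-- The value of an expression; it is `none` if a number exceeds the word size or an argument is
not an element of the semigroup or a letter. -/
noncomputable def Expr.eval (I : Input) (W : ℕ) (σ : Mem) : Expr → Option ℕ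
  | .const k => fit W k
  | .reg x => fit W (σ.reg x)
  | .cell a i => (i.eval I W σ).bind fun k => fit W (σ.arr a k)
  | .add e f => (e.eval I W σ).bind fun k => (f.eval I W σ).bind fun l => fit W (k + l)
  | .sub e f => (e.eval I W σ).bind fun k => (f.eval I W σ).bind fun l => fit W (k - l)
  | .mul e f => (e.eval I W σ).bind fun k => (f.eval I W σ).bind fun l => fit W (k * l)
  | .prod e f => (e.eval I W σ).bind fun k => (f.eval I W σ).bind fun l =>
      if hkl : k < I.n ∧ l < I.n then fit W (I.mul ⟨k, hkl.1⟩ ⟨l, hkl.2⟩ : ℕ) else none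
  | .gen e => (e.eval I W σ).bind fun k =>
      if hk : k < I.m then fit W (I.gen ⟨k, hk⟩ : ℕ) else none
  | .acc e f => (e.eval I W σ).bind fun k => (f.eval I W σ).bind fun l =>
      if hkl : k < I.n ∧ l < I.n then
        fit W (if I.acc ⟨k, hkl.1⟩ ⟨l, hkl.2⟩ then 1 else 0)
      else none

noncomputable def Test.eval (I : Input) (W : ℕ) (σ : Mem) : Test → Option Bool
  | .lt e f => (e.eval I W σ).bind fun k => (f.eval I W σ).bind fun l => some (decide (k < l))
  | .eq e f => (e.eval I W σ).bind fun k => (f.eval I W σ).bind fun l => some (decide (k = l))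

def Mem.setReg (σ : Mem) (x k : ℕ) : Mem :=
  ⟨Function.update σ.reg x k, σ.arr⟩

def Mem.setCell (σ : Mem) (a i k : ℕ) : Mem :=
  ⟨σ.reg, Function.update σ.arr a (Function.update (σ.arr a) i k)⟩

/-- `Exec I W p σ t τ`: started with memory `σ`, the program `p` halts after `t` units of time
with memory `τ`. A program whose evaluation of an expression fails does not halt. -/
inductive Exec (I : Input) (W : ℕ) : Prog → Mem → ℕ → Mem → Prop
  | skip {σ : Mem} : Exec I W .skip σ 1 σ
  | assign {σ : Mem} {x k : ℕ} {e : Expr} : e.eval I W σ = some k →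
      Exec I W (.assign x e) σ (e.cost + 1) (σ.setReg x k)
  | store {σ : Mem} {a k l : ℕ} {i e : Expr} : i.eval I W σ = some k → e.eval I W σ = some l →
      Exec I W (.store a i e) σ (i.cost + e.cost + 1) (σ.setCell a k l)
  | seq {σ σ₁ σ₂ : Mem} {p q : Prog} {t₁ t₂ : ℕ} : Exec I W p σ t₁ σ₁ → Exec I W q σ₁ t₂ σ₂ →
      Exec I W (.seq p q) σ (t₁ + t₂) σ₂
  | ite_true {σ τ : Mem} {b : Test} {p q : Prog} {t : ℕ} : b.eval I W σ = some true →
      Exec I W p σ t τ → Exec I W (.ite b p q) σ (b.cost + t) τ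
  | ite_false {σ τ : Mem} {b : Test} {p q : Prog} {t : ℕ} : b.eval I W σ = some false →
      Exec I W q σ t τ → Exec I W (.ite b p q) σ (b.cost + t) τ
  | loop_false {σ : Mem} {b : Test} {p : Prog} : b.eval I W σ = some false →
      Exec I W (.loop b p) σ b.cost σ
  | loop_true {σ σ₁ σ₂ : Mem} {b : Test} {p : Prog} {t₁ t₂ : ℕ} : b.eval I W σ = some true →
      Exec I W p σ t₁ σ₁ → Exec I W (.loop b p) σ₁ t₂ σ₂ →
      Exec I W (.loop b p) σ (b.cost + t₁ + t₂) σ₂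

/-- The initial memory: registers `0` and `1` hold the numbers of elements and of letters, and
everything else is `0`. -/
def Input.init (I : Input) : Mem where
  reg x := if x = 0 then I.n else if x = 1 then I.m else 0
  arr _ _ := 0

variable {A : Type u} {S : Type v} [Semigroup S]

/-- The input that encodes `h` and `P`, for given numberings of the letters and of the elements
of the semigroup. -/
def encode {n m : ℕ} (h : FreeSemigroup A →ₙ* S) (P : Set (S × S)) (eA : A ≃ Fin m)
    (eS : S ≃ Fin n) : Input where
  n := n
  m := m
  mul i j := eS (eS.symm i * eS.symm j)
  gen a := eS (h (FreeSemigroup.of (eA.symm a)))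
  acc i j := (eS.symm i, eS.symm j) ∈ P

/-- The memory `σ` holds the syntactic semigroup and the syntactic morphism of `L`: for a suitable
numbering of the syntactic semigroup by `{0, …, k - 1}`, register `0` holds `k`, array `0` holds
for every `s ∈ S` the image in the syntactic semigroup of the words in `[s]`, array `1` holds the
images of the letters under the syntactic morphism, and array `2` holds the multiplication table
of the syntactic semigroup, row by row. -/
def HoldsSyntactic {n m : ℕ} (h : FreeSemigroup A →ₙ* S) (L : Set (Stream' A)) (eA : A ≃ Fin m)
    (eS : S ≃ Fin n) (σ : Mem) : Prop :=
  ∃ φ : SyntacticSemigroup L ≃ Fin (σ.reg 0),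
    (∀ w : FreeSemigroup A, σ.arr 0 (eS (h w)) = φ (syntacticHom L w)) ∧
    (∀ a : A, σ.arr 1 (eA a) = φ (syntacticHom L (FreeSemigroup.of a))) ∧
    ∀ x y : SyntacticSemigroup L, σ.arr 2 (φ x * σ.reg 0 + φ y) = φ (x * y)

end Machine

end OmegaSyn

open OmegaSyn

namespace OmegaSyn

/-! ### Factors of infinite words and cutting points -/

section Factors

variable {A : Type u}

/-! Recognition. Suppose an infinite word lies in [s][e]^ω and in [t][f]^ω for two linked pairs. Cut
it in both ways: since S is finite, the factor from a cut of the first kind to a later cut of the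
second kind takes the same value at two places, and this yields a conjugacy
(`conjugate_of_mem_block`). If e is an idempotent power of t, then [s][t]^ω ⊆ [se][e]^ω. As P is
closed under conjugation, each set [s][t]^ω is therefore contained in L or disjoint from L,
according to whether (se, e) ∈ P (`mem_lang_iff_of_isIdemPow`). Hence Q can be read off from P and
the idempotent powers (`mem_maxPairs_iff`), membership of u z^ω in L depends only on Q and the
images under h, and ≡_L is the pullback of ≡ along h (`syntacticCon_iff`).

Refinement. The main loop keeps three facts (`LoopInv`): the partition refines ≅, its classes are
unions of classes of ≡, and Hopcroft's invariant `Pending` holds, by which a failure of stability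
under a letter is always witnessed by a member of T. When T is empty, the partition is stable under
multiplication by letters, hence by all of S because h is surjective; so it refines ≡, and by the
second fact it equals ≡.

Time. Each x ∈ S has a weight that counts the letter actions and the sizes of the preimages of x, so
that the weight of a class C dominates the cost of the iteration for C. A class enters T only as a
part of a waiting class or as the smaller part of a class that is not waiting, and in the latter
case its logarithmic size drops by one. So the potential `pot`, the sum over the classes of weight
times (log size + 1 if waiting), never grows in a split (`pot_splitClass_le`), and it drops by the
weight of C when C is removed (`pot_pop`).

Machine. The program stores a label for each element, and linked lists of the preimages of each
element under each letter action. A preimage of C is then listed in time proportional to |C| plus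
its size, which `pot` pays for. In addition, each genuine split and each iteration may spend O(n)
with n = |S|; as there are fewer than n splits and at most n iterations, this stays within the
quadratic term. Time bounds are carried through the program logic with the number of labels as a
further credit (`splitProg_spec`, `mainProg_spec`). -/

theorem letters_mul (u v : FreeSemigroup A) : letters (u * v) = letters u ++ letters v := rfl

theorem letters_injective : Function.Injective (letters : FreeSemigroup A → List A) := by
  rintro ⟨a, l⟩ ⟨b, k⟩ h
  simpa [letters] using h

theorem letters_length_pos (w : FreeSemigroup A) : 0 < (letters w).length := by
  simp [letters]

/-- The factor `α i, …, α (j - 1)` of an infinite word, for `i < j`. -/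
def fac (α : Stream' A) (i j : ℕ) : FreeSemigroup A :=
  ⟨α.get i, (List.range' (i + 1) (j - i - 1)).map α.get⟩

theorem letters_fac (α : Stream' A) {i j : ℕ} (h : i < j) :
    letters (fac α i j) = (List.range' i (j - i)).map α.get := by
  obtain ⟨k, rfl⟩ := Nat.exists_eq_add_of_lt h
  have h1 : i + k + 1 - i = k + 1 := by omega
  have h2 : i + k + 1 - i - 1 = k := by omega
  simp [letters, fac, h1, List.range'_succ]

theorem fac_mul_fac (α : Stream' A) {i j k : ℕ} (h : i < j) (h' : j < k) :
    fac α i j * fac α j k = fac α i k := by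
  apply letters_injective
  rw [letters_mul, letters_fac α h, letters_fac α h', letters_fac α (h.trans h'), ← List.map_append]
  congr 1
  have h1 : j = i + 1 * (j - i) := by omega
  have h2 : k - i = (j - i) + (k - j) := by omega
  rw [h2]
  conv_lhs => arg 2; rw [h1]
  rw [List.range'_append]
  congr 1; omega

theorem prepend_lt (x : FreeSemigroup A) (β : Stream' A) {n : ℕ} (h : n < (letters x).length) :
    (prepend x β).get n = (letters x)[n] :=
  Stream'.get_append_left n (letters x) β h

theorem prepend_add (x : FreeSemigroup A) (β : Stream' A) (n : ℕ) :
    (prepend x β).get ((letters x).length + n) = β.get n :=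
  Stream'.get_append_right n (letters x) β

theorem fac_prepend (x : FreeSemigroup A) (β : Stream' A) :
    fac (prepend x β) 0 (letters x).length = x := by
  apply letters_injective
  rw [letters_fac _ (letters_length_pos x)]
  apply List.ext_getElem
  · simp
  · intro n h1 h2
    simp [prepend_lt x β h2]

theorem fac_prepend_add (x : FreeSemigroup A) (β : Stream' A) {i j : ℕ} (h : i < j) :
    fac (prepend x β) ((letters x).length + i) ((letters x).length + j) = fac β i j := by
  apply letters_injective
  rw [letters_fac _ (by omega), letters_fac _ h]
  apply List.ext_getElem
  · simp; omega
  · intro n h1 h2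
    simp [Nat.add_assoc, prepend_add]

/-- The letters of `v₀ ⋯ vₖ₋₁`. -/
def wordsUpTo (w : ℕ → FreeSemigroup A) (k : ℕ) : List A :=
  ((List.range k).map fun i => letters (w i)).flatten

theorem wordsUpTo_succ (w : ℕ → FreeSemigroup A) (k : ℕ) :
    wordsUpTo w (k + 1) = wordsUpTo w k ++ letters (w k) := by
  simp [wordsUpTo, List.range_succ]

theorem le_length_wordsUpTo (w : ℕ → FreeSemigroup A) (k : ℕ) : k ≤ (wordsUpTo w k).length := by
  induction k with
  | zero => simp
  | succ k ih =>
    have := letters_length_pos (w k)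
    rw [wordsUpTo_succ, List.length_append]; omega

theorem wordsUpTo_prefix (w : ℕ → FreeSemigroup A) {k l : ℕ} (h : k ≤ l) :
    wordsUpTo w k <+: wordsUpTo w l := by
  induction l, h using Nat.le_induction with
  | base => exact List.prefix_rfl
  | succ l _ ih => exact ih.trans (by rw [wordsUpTo_succ]; exact List.prefix_append _ _)

/-- The definition reads the letter n off v₀ ⋯ vₙ. Any other product v₀ ⋯ vₖ₋₁ that is long enough
gives the same letter, because one of the two words is a prefix of the other. -/
theorem omegaProd_eq (w : ℕ → FreeSemigroup A) {k n : ℕ} (h : n < (wordsUpTo w k).length) :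
    (omegaProd w).get n = (wordsUpTo w k)[n] := by
  have h1 : n < (wordsUpTo w (n + 1)).length := le_length_wordsUpTo w (n + 1)
  have h2 : (omegaProd w).get n = (wordsUpTo w (n + 1))[n] := by
    change (wordsUpTo w (n + 1)).getD n (w 0).head = _
    simp [h1]
  rw [h2]
  rcases le_total k (n + 1) with hk | hk
  · exact ((wordsUpTo_prefix w hk).getElem h).symm
  · exact (wordsUpTo_prefix w hk).getElem h1

theorem fac_omegaProd (w : ℕ → FreeSemigroup A) (k : ℕ) :
    fac (omegaProd w) (wordsUpTo w k).length (wordsUpTo w (k + 1)).length = w k := by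
  have hl : (wordsUpTo w (k + 1)).length = (wordsUpTo w k).length + (letters (w k)).length := by
    rw [wordsUpTo_succ, List.length_append]
  have := letters_length_pos (w k)
  apply letters_injective
  rw [letters_fac _ (by omega)]
  apply List.ext_getElem
  · simp [hl]
  · intro n h1 h2
    have h3 : (wordsUpTo w k).length + n < (wordsUpTo w (k + 1)).length := by omega
    simp only [List.getElem_map, List.getElem_range', Nat.one_mul]
    rw [omegaProd_eq w h3]
    simp [wordsUpTo_succ]

end Factors

/-! ### Cutting sequences, and linked pairs with a common infinite word -/

section Blocks

variable {A : Type u} {S : Type v} [Semigroup S] (h : FreeSemigroup A →ₙ* S)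

/-- Factorizations become sequences of cutting positions, which can be regrouped, and compared for
the same infinite word. The first cut is positive because the prefix is a non-empty word. -/
theorem mem_block_iff (s t : S) (α : Stream' A) :
    α ∈ block h s t ↔ ∃ p : ℕ → ℕ, StrictMono p ∧ 0 < p 0 ∧ h (fac α 0 (p 0)) = s ∧
      ∀ i, h (fac α (p i) (p (i + 1))) = t := by
  constructor
  · rintro ⟨x, w, hx, hw, rfl⟩
    have hl : ∀ i, (wordsUpTo w i).length < (wordsUpTo w (i + 1)).length := fun i => by
      have := letters_length_pos (w i)
      rw [wordsUpTo_succ, List.length_append]; omega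
    refine ⟨fun i => (letters x).length + (wordsUpTo w i).length,
      strictMono_nat_of_lt_succ fun i => by have := hl i; omega, ?_, ?_, fun i => ?_⟩
    · have := letters_length_pos x; simp only; omega
    · simpa [wordsUpTo, fac_prepend] using hx
    · rw [fac_prepend_add x _ (hl i), fac_omegaProd, hw]
  · rintro ⟨p, hp, h0, hs, ht⟩
    refine ⟨fac α 0 (p 0), fun i => fac α (p i) (p (i + 1)), hs, ht, ?_⟩
    -- The factors between consecutive cuts telescope.
    have key : ∀ k, wordsUpTo (fun i => fac α (p i) (p (i + 1))) (k + 1) =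
        letters (fac α (p 0) (p (k + 1))) := by
      intro k
      induction k with
      | zero => simp [wordsUpTo]
      | succ k ih =>
        rw [wordsUpTo_succ, ih, ← letters_mul,
          fac_mul_fac α (hp (Nat.succ_pos k)) (hp (Nat.lt_succ_self _))]
    have hlen : (letters (fac α 0 (p 0))).length = p 0 := by simp [letters_fac α h0]
    refine Stream'.ext fun n => ?_
    rcases lt_or_ge n (p 0) with hn | hn
    · rw [prepend_lt _ _ (by rw [hlen]; exact hn)]
      simp [letters_fac α h0]
    · obtain ⟨n, rfl⟩ := Nat.exists_eq_add_of_le hn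
      have h1 := prepend_add (fac α 0 (p 0)) (omegaProd fun i => fac α (p i) (p (i + 1))) n
      rw [hlen] at h1
      rw [h1]
      have hn := le_length_wordsUpTo (fun i => fac α (p i) (p (i + 1))) (n + 1)
      rw [omegaProd_eq _ (k := n + 1) hn]
      have : p 0 < p (n + 1) := hp (Nat.succ_pos n)
      simp [key, letters_fac α this]

theorem map_fac_mul (α : Stream' A) {i j k : ℕ} (hij : i < j) (hjk : j < k) :
    h (fac α i j) * h (fac α j k) = h (fac α i k) := by
  rw [← map_mul, fac_mul_fac α hij hjk]

theorem map_fac_zero {α : Stream' A} {s e : S} {p : ℕ → ℕ} (hp : StrictMono p) (h0 : 0 < p 0)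
    (hse : s * e = s) (hs : h (fac α 0 (p 0)) = s) (ht : ∀ i, h (fac α (p i) (p (i + 1))) = e)
    (i : ℕ) : h (fac α 0 (p i)) = s := by
  induction i with
  | zero => exact hs
  | succ i ih =>
    rw [← map_fac_mul h α (h0.trans_le (hp.monotone (Nat.zero_le i))) (hp (Nat.lt_succ_self i)),
      ih, ht, hse]

theorem map_fac_idem {α : Stream' A} {e : S} {p : ℕ → ℕ} (hp : StrictMono p)
    (he : e * e = e) (ht : ∀ i, h (fac α (p i) (p (i + 1))) = e) {i j : ℕ} (hij : i < j) :
    h (fac α (p i) (p j)) = e := by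
  induction j, hij using Nat.le_induction with
  | base => exact ht i
  | succ j hj ih => rw [← map_fac_mul h α (hp hj) (hp (Nat.lt_succ_self j)), ih, ht, he]

/-- Two linked pairs with intersecting languages are conjugate. -/
theorem conjugate_of_mem_block [Finite S] {p q : S × S} (hp : IsLinked p) (hq : IsLinked q)
    {α : Stream' A} (h1 : α ∈ block h p.1 p.2) (h2 : α ∈ block h q.1 q.2) : Conjugate p q := by
  obtain ⟨f, hf, hf0, hfs, hft⟩ := (mem_block_iff h _ _ _).1 h1
  obtain ⟨g, hg, hg0, hgs, hgt⟩ := (mem_block_iff h _ _ _).1 h2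
  -- The indices are chosen such that f (i k) < g (f (i k) + 1) < f (i (k + 1)); this works because
  -- a strictly increasing map on ℕ dominates the identity.
  let i : ℕ → ℕ := Nat.rec 0 fun _ k => g (f k + 1) + 1
  have hfi : ∀ k, f (i k) < g (f (i k) + 1) := fun k => hg.le_apply (x := f (i k) + 1)
  have hgf : ∀ k, g (f (i k) + 1) < f (i (k + 1)) := fun k => hf.le_apply (x := g (f (i k) + 1) + 1)
  have hmono : StrictMono fun k => f (i k) :=
    strictMono_nat_of_lt_succ fun k => (hfi k).trans (hgf k)
  -- Pigeonhole on the value of the factor from the cut f (i k) to the cut of g chosen after it.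
  obtain ⟨k, l, hkl, heq⟩ := Finite.exists_ne_map_eq_of_infinite
    (fun k => h (fac α (f (i k)) (g (f (i k) + 1))))
  wlog hlt : k < l generalizing k l
  · exact this l k hkl.symm heq.symm (by omega)
  have hkl' : g (f (i k) + 1) < f (i l) :=
    (hgf k).trans_le (hmono.monotone (Nat.succ_le_of_lt hlt))
  -- The first witness x is the value that k and l share, the second one y belongs to the factor
  -- from the g-cut of k to the f-cut of l. Then x y spans two f-cuts; with x read at l, y x spans
  -- two g-cuts.
  refine ⟨h (fac α (f (i k)) (g (f (i k) + 1))), h (fac α (g (f (i k) + 1)) (f (i l))), ?_, ?_, ?_⟩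
  · rw [← map_fac_zero h hf hf0 hp.2 hfs hft (i k),
      map_fac_mul h α (hf0.trans_le (hf.monotone (Nat.zero_le _))) (hfi k)]
    exact map_fac_zero h hg hg0 hq.2 hgs hgt _
  · rw [map_fac_mul h α (hfi k) hkl']
    exact map_fac_idem h hf hp.1 hft (hf.lt_iff_lt.1 (hmono hlt))
  · rw [heq, map_fac_mul h α hkl' (hfi l)]
    exact map_fac_idem h hg hq.1 hgt (by have := hmono hlt; simp only at this; omega)

end Blocks

/-! ### Idempotent powers in a finite semigroup -/

section IdempotentPowers

variable {S : Type v} [Semigroup S]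

/-- The power `t ^ (k + 1)`. -/
def spow (t : S) : ℕ → S
  | 0 => t
  | k + 1 => spow t k * t

theorem spow_mul_spow (t : S) (k l : ℕ) : spow t k * spow t l = spow t (k + l + 1) := by
  induction l with
  | zero => rfl
  | succ l ih => rw [spow, ← mul_assoc, ih]; rfl

/-- `e` is an idempotent power of `t`. -/
def IsIdemPow (t e : S) : Prop := e * e = e ∧ ∃ k, e = spow t k

/-- Pigeonhole on the first n + 1 powers yields an index and a period; a multiple of the period
beyond the index is an idempotent exponent. The bound on the exponent limits the search of the
machine to O(n) per element. -/
theorem exists_spow_idem [Fintype S] (t : S) :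
    ∃ k < Fintype.card S, spow t k * spow t k = spow t k := by
  obtain ⟨i, j, hij, heq⟩ := Fintype.exists_ne_map_eq_of_card_lt
    (fun i : Fin (Fintype.card S + 1) => spow t i) (by simp)
  wlog hlt : i < j generalizing i j
  · exact this j i hij.symm heq.symm (lt_of_le_of_ne (not_lt.1 hlt) hij.symm)
  have hlt' : (i : ℕ) < j := hlt
  have hj := j.2
  obtain ⟨q, hq⟩ := Nat.exists_eq_add_of_lt hlt'
  have per : ∀ r, (i : ℕ) ≤ r → spow t (r + (q + 1)) = spow t r := by
    intro r hr
    induction r, hr using Nat.le_induction with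
    | base => rw [heq]; congr 1; omega
    | succ r _ ih =>
      have : r + 1 + (q + 1) = (r + (q + 1)) + 1 := by omega
      rw [this, spow, ih, spow]
  have per' : ∀ c r, (i : ℕ) ≤ r → spow t (r + c * (q + 1)) = spow t r := by
    intro c r hr
    induction c with
    | zero => simp
    | succ c ih =>
      rw [show r + (c + 1) * (q + 1) = (r + c * (q + 1)) + (q + 1) by ring,
        per _ (by omega), ih]
  have hd := Nat.div_add_mod i (q + 1)
  have hm : (i : ℕ) % (q + 1) < q + 1 := Nat.mod_lt i (Nat.succ_pos q)
  set c := (i : ℕ) / (q + 1)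
  have hc : (q + 1) * c = c * (q + 1) := mul_comm _ _
  -- As `spow` shifts exponents by one, the true exponent is (c + 1)(q + 1), a multiple of the
  -- period q + 1. The remainder of i modulo q + 1 is at most q, so i ≤ c(q + 1) + q ≤ i + q < j.
  refine ⟨c * (q + 1) + q, by omega, ?_⟩
  rw [spow_mul_spow]
  rw [show c * (q + 1) + q + (c * (q + 1) + q) + 1 = (c * (q + 1) + q) + (c + 1) * (q + 1) by ring]
  exact per' _ _ (by omega)

theorem exists_isIdemPow [Finite S] (t : S) : ∃ e, IsIdemPow t e := by
  have := Fintype.ofFinite S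
  obtain ⟨k, -, hk⟩ := exists_spow_idem t
  exact ⟨_, hk, k, rfl⟩

end IdempotentPowers

/-! ### The maximal set of pairs and the syntactic congruence -/

section Recognition

variable {A : Type u} {S : Type v} [Semigroup S] (h : FreeSemigroup A →ₙ* S)

theorem map_fac_spow {α : Stream' A} {t : S} {p : ℕ → ℕ} (hp : StrictMono p)
    (ht : ∀ i, h (fac α (p i) (p (i + 1))) = t) (i k : ℕ) :
    h (fac α (p i) (p (i + k + 1))) = spow t k := by
  induction k with
  | zero => exact ht i
  | succ k ih =>
    rw [← map_fac_mul h α (hp (by omega : i < i + k + 1)) (hp (by omega)), ih]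
    exact congrArg _ (ht (i + k + 1))

/-- Collect the factors of value t in groups of k + 1. The first group is absorbed by the prefix,
which changes s to s * e and makes the pair linked. -/
theorem block_subset_of_isIdemPow (s : S) {t e : S} (he : IsIdemPow t e) :
    block h s t ⊆ block h (s * e) e := by
  obtain ⟨he, k, rfl⟩ := he
  intro α hα
  obtain ⟨p, hp, h0, hs, ht⟩ := (mem_block_iff h _ _ _).1 hα
  refine (mem_block_iff h _ _ _).2 ⟨fun i => p ((i + 1) * (k + 1)),
    fun i j hij => hp (by gcongr), h0.trans (hp (by simp)), ?_, fun i => ?_⟩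
  · simp only
    rw [← map_fac_mul h α h0 (hp (by simp : 0 < (0 + 1) * (k + 1))), hs]
    have := map_fac_spow h hp ht 0 k
    simp only [zero_add] at this
    simp [this]
  · have := map_fac_spow h hp ht ((i + 1) * (k + 1)) k
    rw [← this, add_assoc, ← Nat.succ_mul]

theorem block_nonempty (hs : Function.Surjective h) (s t : S) : (block h s t).Nonempty := by
  obtain ⟨x, hx⟩ := hs s
  obtain ⟨w, hw⟩ := hs t
  exact ⟨_, x, fun _ => w, hx, fun _ => hw, rfl⟩

variable {P : Set (S × S)}

/-- The right-hand side does not depend on α, so [s][t]^ω is contained in L or disjoint from it. If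
α ∈ L, some pair of P shares α with the linked pair (s * e, e), so the two are conjugate and closure
applies. -/
theorem mem_lang_iff_of_isIdemPow [Finite S] (hP : IsClosedLinked P) {s t e : S} (he : IsIdemPow t e)
    {α : Stream' A} (hα : α ∈ block h s t) : α ∈ lang h P ↔ (s * e, e) ∈ P := by
  have hα' := block_subset_of_isIdemPow h s he hα
  constructor
  · intro hL
    obtain ⟨p, hp, hαp⟩ := Set.mem_iUnion₂.1 hL
    have hl : IsLinked (s * e, e) := ⟨he.1, by simp [mul_assoc, he.1]⟩
    exact hP.2 p hp _ hl (conjugate_of_mem_block h (hP.1 p hp) hl hαp hα')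
  · exact fun hq => Set.mem_iUnion₂.2 ⟨_, hq, hα'⟩

/-- Reduces Q to one membership test in P per pair; this is how the machine computes Q. Surjectivity
enters because an empty block would belong to Q for trivial reasons. -/
theorem mem_maxPairs_iff [Finite S] (hs : Function.Surjective h) (hP : IsClosedLinked P) {s t e : S}
    (he : IsIdemPow t e) : (s, t) ∈ maxPairs h P ↔ (s * e, e) ∈ P := by
  constructor
  · intro hq
    obtain ⟨α, hα⟩ := block_nonempty h hs s t
    exact (mem_lang_iff_of_isIdemPow h hP he hα).1 (hq hα)
  · exact fun hq α hα => (mem_lang_iff_of_isIdemPow h hP he hα).2 hq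

theorem mem_lang_iff [Finite S] (hs : Function.Surjective h) (hP : IsClosedLinked P) {s t : S}
    {α : Stream' A} (hα : α ∈ block h s t) : α ∈ lang h P ↔ (s, t) ∈ maxPairs h P := by
  obtain ⟨e, he⟩ := exists_isIdemPow t
  rw [mem_lang_iff_of_isIdemPow h hP he hα, mem_maxPairs_iff h hs hP he]

theorem prepend_omegaPow_mem_block (u z : FreeSemigroup A) :
    prepend u (omegaPow z) ∈ block h (h u) (h z) := ⟨u, fun _ => z, rfl, fun _ => rfl, rfl⟩

/-- Since z^ω = z z^ω, the empty prefix can be treated as the prefix z; the cuts are the positive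
multiples of the length of z. -/
theorem omegaPow_mem_block (z : FreeSemigroup A) : omegaPow z ∈ block h (h z) (h z) := by
  have h0 : fac (omegaPow z) 0 (letters z).length = z := by
    have := fac_omegaProd (fun _ => z) 0
    simp only [wordsUpTo, List.range_zero, List.map_nil, List.flatten_nil, List.length_nil, zero_add, List.range_one, List.map_cons, List.flatten_cons, List.append_nil] at this
    exact this
  refine (mem_block_iff h _ _ _).2 ⟨fun i => (wordsUpTo (fun _ => z) (i + 1)).length,
    strictMono_nat_of_lt_succ fun i => ?_, ?_, ?_, fun i => ?_⟩
  · have := letters_length_pos z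
    rw [wordsUpTo_succ _ (i + 1), List.length_append]; omega
  · exact le_length_wordsUpTo (fun _ => z) 1
  · simp only [wordsUpTo]
    simp [h0]
  · exact congrArg h (fac_omegaProd (fun _ => z) (i + 1))

theorem wordSetoid_iff_cong [Finite S] (hs : Function.Surjective h) (hP : IsClosedLinked P)
    (u v : FreeSemigroup A) : wordSetoid (lang h P) u v ↔ cong h P (h u) (h v) := by
  have h1 : ∀ u z, prepend u (omegaPow z) ∈ lang h P ↔ (h u, h z) ∈ maxPairs h P := fun u z =>
    mem_lang_iff h hs hP (prepend_omegaPow_mem_block h u z)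
  have h2 : ∀ z, omegaPow z ∈ lang h P ↔ (h z, h z) ∈ maxPairs h P := fun z =>
    mem_lang_iff h hs hP (omegaPow_mem_block h z)
  constructor
  · rintro ⟨hl, hr⟩ s
    obtain ⟨z, rfl⟩ := hs s
    exact ⟨by simpa [prependPow, h1] using hr (some z), by simpa [h1] using hl z⟩
  · intro hc
    refine ⟨fun z => by simpa [h1] using (hc (h z)).2, fun z => ?_⟩
    cases z with
    | none =>
      simp only [prependPow, h2]
      -- The empty prefix adds no condition: pass from (h u, h u) to (h u, h v) and on to (h v, h
      -- v).
      exact (hc (h u)).1.trans (hc (h v)).2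
    | some z => simpa [prependPow, h1] using (hc (h z)).1

theorem map_ctx (x : Option (FreeSemigroup A)) (u : FreeSemigroup A)
    (y : Option (FreeSemigroup A)) : h (ctx x u y) = ctx (x.map h) (h u) (y.map h) := by
  cases x <;> cases y <;> simp [ctx]

/-- Contexts over A* map onto contexts over S¹ because h is surjective, so the pullback of ≅ passes
to the congruences generated by contexts. -/
theorem syntacticCon_iff [Finite S] (hs : Function.Surjective h) (hP : IsClosedLinked P)
    (u v : FreeSemigroup A) : syntacticCon (lang h P) u v ↔ equivCon h P (h u) (h v) := by
  have hs' : Function.Surjective (Option.map h) := fun x => by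
    cases x with
    | none => exact ⟨none, rfl⟩
    | some x => obtain ⟨w, rfl⟩ := hs x; exact ⟨some w, rfl⟩
  constructor
  · intro huv x y
    obtain ⟨x, rfl⟩ := hs' x
    obtain ⟨y, rfl⟩ := hs' y
    rw [← map_ctx, ← map_ctx]
    exact (wordSetoid_iff_cong h hs hP _ _).1 (huv x y)
  · intro huv x y
    rw [wordSetoid_iff_cong h hs hP, map_ctx, map_ctx]
    exact huv _ _

theorem exists_mulEquiv_syntactic [Finite S] (hs : Function.Surjective h) (hP : IsClosedLinked P) :
    ∃ φ : (equivCon h P).Quotient ≃* SyntacticSemigroup (lang h P), ∀ w : FreeSemigroup A,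
      φ (h w : (equivCon h P).Quotient) = syntacticHom (lang h P) w := by
  let g : FreeSemigroup A →ₙ* (equivCon h P).Quotient :=
    { toFun := fun w => (h w : (equivCon h P).Quotient)
      map_mul' := fun u v => by rw [map_mul]; rfl }
  let ψ : SyntacticSemigroup (lang h P) → (equivCon h P).Quotient :=
    Quotient.lift g fun u v huv =>
      Quotient.sound ((syntacticCon_iff h hs hP u v).1 huv)
  have hψ : ∀ w, ψ (syntacticHom (lang h P) w) = (h w : (equivCon h P).Quotient) := fun _ => rfl
  have hsurj : Function.Surjective (syntacticHom (lang h P)) := Quotient.mk_surjective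
  have hbij : Function.Bijective ψ := by
    constructor
    · intro x y
      obtain ⟨u, rfl⟩ := hsurj x
      obtain ⟨v, rfl⟩ := hsurj y
      intro huv
      rw [hψ, hψ] at huv
      exact Quotient.sound ((syntacticCon_iff h hs hP u v).2 (Quotient.exact huv))
    · intro y
      obtain ⟨s, rfl⟩ := Quotient.mk_surjective y
      obtain ⟨w, rfl⟩ := hs s
      exact ⟨syntacticHom (lang h P) w, rfl⟩
  have hmul : ∀ x y, ψ (x * y) = ψ x * ψ y := by
    intro x y
    obtain ⟨u, rfl⟩ := hsurj x
    obtain ⟨v, rfl⟩ := hsurj y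
    rw [← map_mul, hψ, hψ, hψ, map_mul]; rfl
  let e : SyntacticSemigroup (lang h P) ≃* (equivCon h P).Quotient :=
    { Equiv.ofBijective ψ hbij with map_mul' := hmul }
  exact ⟨e.symm, fun w => (MulEquiv.symm_apply_eq e).2 (hψ w).symm⟩

/-- An equivalence relation that refines `≅` and is stable under multiplication with the images
of letters refines `≡`. -/
theorem equivCon_of_stable (hs : Function.Surjective h) {r : S → S → Prop}
    (hr : ∀ s t, r s t → cong h P s t)
    (hright : ∀ a s t, r s t → r (s * h (FreeSemigroup.of a)) (t * h (FreeSemigroup.of a)))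
    (hleft : ∀ a s t, r s t → r (h (FreeSemigroup.of a) * s) (h (FreeSemigroup.of a) * t))
    {s t : S} (hst : r s t) : equivCon h P s t := by
  have h1 : ∀ w s t, r s t → r (s * h w) (t * h w) := by
    intro w
    induction w using FreeSemigroup.recOnMul with
    | ih1 a => exact hright a
    | ih2 a w h1 h2 =>
      intro s t hst
      rw [map_mul, ← mul_assoc, ← mul_assoc]
      exact h2 _ _ (h1 _ _ hst)
  have h2 : ∀ w s t, r s t → r (h w * s) (h w * t) := by
    intro w
    induction w using FreeSemigroup.recOnMul with
    | ih1 a => exact hleft a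
    | ih2 a w h1 h2 =>
      intro s t hst
      rw [map_mul, mul_assoc, mul_assoc]
      exact h1 _ _ (h2 _ _ hst)
  intro x y
  apply hr
  cases x with
  | none =>
    cases y with
    | none => exact hst
    | some y => obtain ⟨w, rfl⟩ := hs y; exact h1 w _ _ hst
  | some x =>
    obtain ⟨w', rfl⟩ := hs x
    cases y with
    | none => exact h2 w' _ _ hst
    | some y => obtain ⟨w, rfl⟩ := hs y; exact h1 w _ _ (h2 w' _ _ hst)

end Recognition

/-! ### Splitting of partitions: invariants and potential -/

section Partition

open scoped Classical

variable {S : Type v} {X C D : Finset S} {st st' : RState S}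

structure RState.Valid (st : RState S) : Prop where
  nonempty : ∀ C ∈ st.parts, C.Nonempty
  eq_of_mem : ∀ C ∈ st.parts, ∀ D ∈ st.parts, ∀ s, s ∈ C → s ∈ D → C = D
  cover : ∀ s, ∃ C ∈ st.parts, s ∈ C
  work_subset : ∀ C ∈ st.work, C ∈ st.parts

/-- `s` and `t` are in the same class. -/
def RState.Rel (st : RState S) (s t : S) : Prop := ∃ C ∈ st.parts, s ∈ C ∧ t ∈ C

/-- `C` is contained in `X` or disjoint from `X`. -/
def Homog (X C : Finset S) : Prop := ∀ s ∈ C, ∀ t ∈ C, s ∈ X → t ∈ X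

theorem homog_of_inter_eq_empty (h : C ∩ X = ∅) : Homog X C := fun s hs _ _ hX =>
  absurd (Finset.mem_inter.2 ⟨hs, hX⟩) (by simp [h])

theorem homog_of_sdiff_eq_empty (h : C \ X = ∅) : Homog X C := fun _ _ _ ht _ =>
  Finset.sdiff_eq_empty_iff_subset.1 h ht

theorem Homog.inter_or_sdiff (h : Homog X C) : C ∩ X = ∅ ∨ C \ X = ∅ := by
  by_contra! hne
  obtain ⟨⟨s, hs⟩, ⟨t, ht⟩⟩ := hne
  rw [Finset.mem_inter] at hs
  rw [Finset.mem_sdiff] at ht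
  exact ht.2 (h s hs.1 t ht.1 hs.2)

theorem splitClass_of_homog (h : Homog X C) : splitClass X st C = st := by
  unfold splitClass
  rw [if_neg]
  rcases h.inter_or_sdiff with h | h <;> simp [h]

/-- The part of `C` that is added to the work set if `C` does not belong to it. -/
noncomputable def smallPart (X C : Finset S) : Finset S :=
  if (C ∩ X).card ≤ (C \ X).card then C ∩ X else C \ X

theorem inter_ne_empty_of_not_homog (h : ¬ Homog X C) : C ∩ X ≠ ∅ := fun he =>
  h (homog_of_inter_eq_empty he)

theorem sdiff_ne_empty_of_not_homog (h : ¬ Homog X C) : C \ X ≠ ∅ := fun he =>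
  h (homog_of_sdiff_eq_empty he)

theorem splitClass_of_not_homog (h : ¬ Homog X C) : splitClass X st C =
    { parts := st.parts.erase C ∪ {C ∩ X, C \ X}
      work := if C ∈ st.work then st.work.erase C ∪ {C ∩ X, C \ X}
        else st.work ∪ {smallPart X C} } := by
  unfold splitClass smallPart
  rw [if_pos ⟨inter_ne_empty_of_not_homog h, sdiff_ne_empty_of_not_homog h⟩]
  split_ifs <;> rfl

theorem mem_parts_splitClass (h : ¬ Homog X C) :
    D ∈ (splitClass X st C).parts ↔ (D ≠ C ∧ D ∈ st.parts) ∨ D = C ∩ X ∨ D = C \ X := by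
  simp only [splitClass_of_not_homog h, Finset.mem_union, Finset.mem_erase, Finset.mem_insert,
    Finset.mem_singleton]

theorem mem_work_splitClass_of_mem (h : ¬ Homog X C) (hC : C ∈ st.work) :
    D ∈ (splitClass X st C).work ↔ (D ≠ C ∧ D ∈ st.work) ∨ D = C ∩ X ∨ D = C \ X := by
  simp only [splitClass_of_not_homog h, if_pos hC, Finset.mem_union, Finset.mem_erase,
    Finset.mem_insert, Finset.mem_singleton]

theorem mem_work_splitClass_of_notMem (h : ¬ Homog X C) (hC : C ∉ st.work) :
    D ∈ (splitClass X st C).work ↔ D ∈ st.work ∨ D = smallPart X C := by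
  simp only [splitClass_of_not_homog h, if_neg hC, Finset.mem_union, Finset.mem_singleton]

theorem smallPart_cases : smallPart X C = C ∩ X ∨ smallPart X C = C \ X := by
  unfold smallPart; split_ifs <;> simp

theorem RState.Valid.splitClass (hv : st.Valid) (hC : C ∈ st.parts) :
    (splitClass X st C).Valid := by
  by_cases h : Homog X C
  · rwa [splitClass_of_homog h]
  have hsub : ∀ D, D ∈ (OmegaSyn.splitClass X st C).parts → D ∈ st.parts ∨ D ⊆ C := fun D hD => by
    rcases (mem_parts_splitClass h).1 hD with hD | rfl | rfl
    · exact Or.inl hD.2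
    · exact Or.inr Finset.inter_subset_left
    · exact Or.inr Finset.sdiff_subset
  refine ⟨fun D hD => ?_, fun D hD E hE s hsD hsE => ?_, fun s => ?_, fun D hD => ?_⟩
  · rcases (mem_parts_splitClass h).1 hD with hD | rfl | rfl
    · exact hv.nonempty D hD.2
    · exact Finset.nonempty_iff_ne_empty.2 (inter_ne_empty_of_not_homog h)
    · exact Finset.nonempty_iff_ne_empty.2 (sdiff_ne_empty_of_not_homog h)
  · rcases (mem_parts_splitClass h).1 hD with hD | rfl | rfl <;>
      rcases (mem_parts_splitClass h).1 hE with hE | rfl | rfl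
    · exact hv.eq_of_mem D hD.2 E hE.2 s hsD hsE
    · exact absurd (hv.eq_of_mem D hD.2 C hC s hsD (Finset.mem_inter.1 hsE).1) hD.1
    · exact absurd (hv.eq_of_mem D hD.2 C hC s hsD (Finset.mem_sdiff.1 hsE).1) hD.1
    · exact absurd (hv.eq_of_mem E hE.2 C hC s hsE (Finset.mem_inter.1 hsD).1) hE.1
    · rfl
    · exact absurd (Finset.mem_inter.1 hsD).2 (Finset.mem_sdiff.1 hsE).2
    · exact absurd (hv.eq_of_mem E hE.2 C hC s hsE (Finset.mem_sdiff.1 hsD).1) hE.1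
    · exact absurd (Finset.mem_inter.1 hsE).2 (Finset.mem_sdiff.1 hsD).2
    · rfl
  · obtain ⟨D, hD, hs⟩ := hv.cover s
    by_cases hDC : D = C
    · subst hDC
      by_cases hX : s ∈ X
      · exact ⟨D ∩ X, (mem_parts_splitClass h).2 (by simp), Finset.mem_inter.2 ⟨hs, hX⟩⟩
      · exact ⟨D \ X, (mem_parts_splitClass h).2 (by simp), Finset.mem_sdiff.2 ⟨hs, hX⟩⟩
    · exact ⟨D, (mem_parts_splitClass h).2 (Or.inl ⟨hDC, hD⟩), hs⟩
  · rw [mem_parts_splitClass h]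
    by_cases hw : C ∈ st.work
    · rcases (mem_work_splitClass_of_mem h hw).1 hD with hD | hD
      · exact Or.inl ⟨hD.1, hv.work_subset D hD.2⟩
      · exact Or.inr hD
    · rcases (mem_work_splitClass_of_notMem h hw).1 hD with hD | rfl
      · exact Or.inl ⟨fun e => hw (e ▸ hD), hv.work_subset D hD⟩
      · exact Or.inr smallPart_cases

/-- A sequence of splittings of single classes with the splitter `X`. -/
def Steps (X : Finset S) : RState S → RState S → Prop :=
  Relation.ReflTransGen fun a b => ∃ C ∈ a.parts, b = splitClass X a C

/-- Induction principle for all later invariants: only a genuine split of one class of a valid state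
has to be examined. -/
theorem Steps.preserves {p : RState S → Prop}
    (hp : ∀ a C, a.Valid → C ∈ a.parts → ¬ Homog X C → p a → p (splitClass X a C))
    (h : Steps X st st') (hv : st.Valid) (h0 : p st) : st'.Valid ∧ p st' := by
  induction h with
  | refl => exact ⟨hv, h0⟩
  | tail _ hs ih =>
    obtain ⟨C, hC, rfl⟩ := hs
    refine ⟨ih.1.splitClass hC, ?_⟩
    by_cases hh : Homog X C
    · rw [splitClass_of_homog hh]; exact ih.2
    · exact hp _ C ih.1 hC hh ih.2

theorem Steps.valid (h : Steps X st st') (hv : st.Valid) : st'.Valid :=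
  (h.preserves (p := fun _ => True) (fun _ _ _ _ _ _ => trivial) hv trivial).1

/-- The effect of a complete operation `Split(X)`. -/
def Refined (X : Finset S) (st st' : RState S) : Prop :=
  Steps X st st' ∧ ∀ C ∈ st'.parts, Homog X C

/-- The list of classes is fixed in advance while the partition changes. A listed class is still
present when its turn comes, since only the class at hand is replaced; the new parts are homogeneous
and need no turn. -/
theorem steps_foldl (hv : st.Valid) {l : List (Finset S)} (hl : l.Nodup)
    (hsub : ∀ C ∈ l, C ∈ st.parts) : Steps X st (l.foldl (splitClass X) st) ∧
      ∀ D ∈ (l.foldl (splitClass X) st).parts, Homog X D ∨ (D ∈ st.parts ∧ D ∉ l) := by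
  induction l generalizing st with
  | nil => exact ⟨Relation.ReflTransGen.refl, fun D hD => Or.inr ⟨hD, by simp⟩⟩
  | cons C l ih =>
    have hC := hsub C (by simp)
    rw [List.nodup_cons] at hl
    have hparts : ∀ D ∈ (splitClass X st C).parts, Homog X D ∨ (D ∈ st.parts ∧ D ≠ C) := by
      intro D hD
      by_cases hh : Homog X C
      · rw [splitClass_of_homog hh] at hD
        by_cases hDC : D = C
        · exact Or.inl (hDC ▸ hh)
        · exact Or.inr ⟨hD, hDC⟩
      · rcases (mem_parts_splitClass hh).1 hD with hD | rfl | rfl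
        · exact Or.inr ⟨hD.2, hD.1⟩
        · exact Or.inl fun _ _ _ ht _ => (Finset.mem_inter.1 ht).2
        · exact Or.inl fun _ hs _ _ hX => absurd hX (Finset.mem_sdiff.1 hs).2
    obtain ⟨h1, h2⟩ := ih (st := splitClass X st C) (hv.splitClass hC) hl.2 fun D hD => by
      have hDC : D ≠ C := fun e => hl.1 (e ▸ hD)
      have hD' := hsub D (List.mem_cons_of_mem _ hD)
      by_cases hh : Homog X C
      · rwa [splitClass_of_homog hh]
      · exact (mem_parts_splitClass hh).2 (Or.inl ⟨hDC, hD'⟩)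
    refine ⟨Relation.ReflTransGen.head ⟨C, hC, rfl⟩ h1, fun D hD => ?_⟩
    rcases h2 D hD with hD | ⟨hD, hDl⟩
    · exact Or.inl hD
    · rcases hparts D hD with hD | ⟨hD, hDC⟩
      · exact Or.inl hD
      · exact Or.inr ⟨hD, by simp [hDC, hDl]⟩

/-- `Refined` forgets the order in which classes are visited. All further arguments use only this,
so they also apply to the machine, which visits the classes in another order and skips those
disjoint from X. -/
theorem Split.refined (h : Split X st st') (hv : st.Valid) : Refined X st st' := by
  obtain ⟨l, ⟨hl, hmem⟩, rfl⟩ := h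
  obtain ⟨h1, h2⟩ := steps_foldl (X := X) hv hl fun C hC => (hmem C).1 hC
  refine ⟨h1, fun D hD => (h2 D hD).resolve_right fun h => h.2 ((hmem D).2 h.1)⟩

theorem exists_split (X : Finset S) (st : RState S) : ∃ st', Split X st st' :=
  ⟨_, st.parts.toList, ⟨st.parts.nodup_toList, by simp⟩, rfl⟩

theorem Steps.homog {Y : Finset S} (h : Steps X st st') (hv : st.Valid)
    (hY : ∀ C ∈ st.parts, Homog Y C) : ∀ C ∈ st'.parts, Homog Y C := by
  refine (h.preserves (p := fun a => ∀ C ∈ a.parts, Homog Y C) ?_ hv hY).2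
  intro a C _ hC hh ih D hD
  rcases (mem_parts_splitClass hh).1 hD with hD | rfl | rfl
  · exact ih D hD.2
  · exact fun s hs t ht => ih C hC s (Finset.mem_inter.1 hs).1 t (Finset.mem_inter.1 ht).1
  · exact fun s hs t ht => ih C hC s (Finset.mem_sdiff.1 hs).1 t (Finset.mem_sdiff.1 ht).1

theorem Steps.rel (h : Steps X st st') (hv : st.Valid) :
    ∀ s t, st'.Rel s t → st.Rel s t := by
  refine (h.preserves (p := fun a => ∀ s t, a.Rel s t → st.Rel s t) ?_ hv fun _ _ h => h).2
  rintro a C _ hC hh ih s t ⟨D, hD, hs, ht⟩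
  apply ih
  rcases (mem_parts_splitClass hh).1 hD with hD | rfl | rfl
  · exact ⟨D, hD.2, hs, ht⟩
  · exact ⟨C, hC, (Finset.mem_inter.1 hs).1, (Finset.mem_inter.1 ht).1⟩
  · exact ⟨C, hC, (Finset.mem_sdiff.1 hs).1, (Finset.mem_sdiff.1 ht).1⟩

/-- All classes are unions of classes of `r`. -/
def Saturated (r : S → S → Prop) (st : RState S) : Prop :=
  ∀ C ∈ st.parts, ∀ s t, r s t → s ∈ C → t ∈ C

theorem Steps.saturated {r : S → S → Prop} (hr : ∀ s t, r s t → r t s)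
    (hX : ∀ s t, r s t → s ∈ X → t ∈ X) (h : Steps X st st') (hv : st.Valid)
    (hst : Saturated r st) : Saturated r st' := by
  refine (h.preserves (p := Saturated r) ?_ hv hst).2
  intro a C _ hC hh ih D hD s t hst hs
  rcases (mem_parts_splitClass hh).1 hD with hD | rfl | rfl
  · exact ih D hD.2 s t hst hs
  · rw [Finset.mem_inter] at hs ⊢
    exact ⟨ih C hC s t hst hs.1, hX s t hst hs.2⟩
  · rw [Finset.mem_sdiff] at hs ⊢
    exact ⟨ih C hC s t hst hs.1, fun ht => hs.2 (hX t s (hr s t hst) ht)⟩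

/-- If `s` and `t` are in the same class, then so are `F b s` and `F b t`, or one of them is in a
class of the work set, or they are separated by the set `C` that is being processed. -/
def Pending {B : Type*} (F : B → S → S) (C : Finset S) (st : RState S) : Prop :=
  ∀ b s t, st.Rel s t → st.Rel (F b s) (F b t) ∨
    (∃ D ∈ st.work, F b s ∈ D ∨ F b t ∈ D) ∨ ¬ (F b s ∈ C ↔ F b t ∈ C)

theorem exists_mem_work_splitClass (hh : ¬ Homog X C) {s t : S} (hs : s ∈ C ∩ X) (ht : t ∈ C \ X) :
    ∃ D ∈ (splitClass X st C).work, s ∈ D ∨ t ∈ D := by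
  by_cases hw : C ∈ st.work
  · exact ⟨_, (mem_work_splitClass_of_mem hh hw).2 (Or.inr (Or.inl rfl)), Or.inl hs⟩
  · refine ⟨_, (mem_work_splitClass_of_notMem hh hw).2 (Or.inr rfl), ?_⟩
    rcases smallPart_cases (X := X) (C := C) with h | h <;> rw [h]
    · exact Or.inl hs
    · exact Or.inr ht

/-- The core of Hopcroft's argument. If a class is cut between two images, at least one part is in
the work set afterwards, and each part contains one of the images; it does not matter which part it
is, so the smaller one may be taken. -/
theorem Steps.pending {B : Type*} {F : B → S → S} {C₀ : Finset S} (h : Steps X st st')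
    (hv : st.Valid) (hst : Pending F C₀ st) : Pending F C₀ st' := by
  refine (h.preserves (p := Pending F C₀) ?_ hv hst).2
  intro a C hva hC hh ih b s t hst
  -- A split never removes an element from the union of the work set.
  have hw : ∀ x, (∃ D ∈ a.work, x ∈ D) → ∃ D ∈ (splitClass X a C).work, x ∈ D := by
    rintro x ⟨D, hD, hx⟩
    by_cases hCw : C ∈ a.work
    · by_cases hDC : D = C
      · subst hDC
        by_cases hxX : x ∈ X
        · exact ⟨D ∩ X, (mem_work_splitClass_of_mem hh hCw).2 (by simp), by simp [hx, hxX]⟩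
        · exact ⟨D \ X, (mem_work_splitClass_of_mem hh hCw).2 (by simp), by simp [hx, hxX]⟩
      · exact ⟨D, (mem_work_splitClass_of_mem hh hCw).2 (Or.inl ⟨hDC, hD⟩), hx⟩
    · exact ⟨D, (mem_work_splitClass_of_notMem hh hCw).2 (Or.inl hD), hx⟩
  rcases ih b s t (Steps.rel (Relation.ReflTransGen.single ⟨C, hC, rfl⟩) hva s t hst) with
    ⟨D, hD, hs, ht⟩ | ⟨D, hD, hs | ht⟩ | hne
  · by_cases hDC : D = C
    · subst hDC
      by_cases hsX : F b s ∈ X <;> by_cases htX : F b t ∈ X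
      · exact Or.inl ⟨D ∩ X, (mem_parts_splitClass hh).2 (by simp), by simp [*], by simp [*]⟩
      · exact Or.inr (Or.inl (exists_mem_work_splitClass hh (by simp [*]) (by simp [*])))
      · obtain ⟨E, hE, h1⟩ := exists_mem_work_splitClass (st := a) hh
          (by simp [*] : F b t ∈ D ∩ X) (by simp [*] : F b s ∈ D \ X)
        exact Or.inr (Or.inl ⟨E, hE, h1.symm⟩)
      · exact Or.inl ⟨D \ X, (mem_parts_splitClass hh).2 (by simp), by simp [*], by simp [*]⟩
    · exact Or.inl ⟨D, (mem_parts_splitClass hh).2 (Or.inl ⟨hDC, hD⟩), hs, ht⟩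
  · obtain ⟨E, hE, h1⟩ := hw _ ⟨D, hD, hs⟩
    exact Or.inr (Or.inl ⟨E, hE, Or.inl h1⟩)
  · obtain ⟨E, hE, h1⟩ := hw _ ⟨D, hD, ht⟩
    exact Or.inr (Or.inl ⟨E, hE, Or.inr h1⟩)
  · exact Or.inr (Or.inr hne)

/-- Remove a class from the work set. -/
noncomputable def RState.pop (st : RState S) (C : Finset S) : RState S :=
  ⟨st.parts, st.work.erase C⟩

theorem RState.Valid.pop (hv : st.Valid) (C : Finset S) : (st.pop C).Valid :=
  ⟨hv.nonempty, hv.eq_of_mem, hv.cover, fun D hD => hv.work_subset D (Finset.mem_of_mem_erase hD)⟩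

/-- If C does not separate the two images and contains one of them, it contains both, and it is
still a class. Separated images move to the last alternative, to be dealt with by the splits of this
iteration. -/
theorem Pending.pop {B : Type*} {F : B → S → S} (hst : Pending F ∅ st)
    (hC : C ∈ st.parts) : Pending F C (st.pop C) := by
  intro b s t hr
  by_cases hne : F b s ∈ C ↔ F b t ∈ C
  · rcases hst b s t hr with h | ⟨D, hD, h⟩ | h
    · exact Or.inl h
    · by_cases hDC : D = C
      · subst hDC
        exact Or.inl ⟨D, hC, h.elim (fun h => ⟨h, hne.1 h⟩) fun h => ⟨hne.2 h, h⟩⟩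
      · exact Or.inr (Or.inl ⟨D, Finset.mem_erase.2 ⟨hDC, hD⟩, h⟩)
    · simp at h
  · exact Or.inr (Or.inr hne)

/-- Once all classes are homogeneous for the preimages of C, elements of one class cannot have
images separated by C. -/
theorem Pending.of_homog {B : Type*} {F : B → S → S} (hst : Pending F C st)
    (hh : ∀ b, ∀ D ∈ st.parts, ∀ s ∈ D, ∀ t ∈ D, F b s ∈ C → F b t ∈ C) : Pending F ∅ st := by
  intro b s t hr
  rcases hst b s t hr with h | h | h
  · exact Or.inl h
  · exact Or.inr (Or.inl h)
  · obtain ⟨D, hD, hs, ht⟩ := hr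
    exact absurd ⟨hh b D hD s hs t ht, hh b D hD t ht s hs⟩ h

theorem Pending.rel {B : Type*} {F : B → S → S} (hst : Pending F ∅ st) (hw : st.work = ∅) (b : B)
    (s t : S) (hr : st.Rel s t) : st.Rel (F b s) (F b t) := by
  rcases hst b s t hr with h | ⟨D, hD, -⟩ | h
  · exact h
  · simp [hw] at hD
  · simp at h

theorem notMem_parts_of_not_homog (hv : st.Valid) (hC : C ∈ st.parts) (hh : ¬ Homog X C) :
    C ∩ X ∉ st.parts ∧ C \ X ∉ st.parts ∧ C ∩ X ≠ C \ X := by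
  obtain ⟨s, hs⟩ := Finset.nonempty_iff_ne_empty.2 (inter_ne_empty_of_not_homog hh)
  obtain ⟨t, ht⟩ := Finset.nonempty_iff_ne_empty.2 (sdiff_ne_empty_of_not_homog hh)
  have hs' := Finset.mem_inter.1 hs
  have ht' := Finset.mem_sdiff.1 ht
  refine ⟨fun h => ?_, fun h => ?_, fun h => ?_⟩
  · rw [← hv.eq_of_mem _ h C hC s hs hs'.1] at ht'
    exact ht'.2 (Finset.mem_inter.1 ht'.1).2
  · rw [← hv.eq_of_mem _ h C hC t ht ht'.1] at hs'
    exact (Finset.mem_sdiff.1 hs'.1).2 hs'.2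
  · rw [h] at hs
    exact (Finset.mem_sdiff.1 hs).2 hs'.2

theorem card_parts_splitClass (hv : st.Valid) (hC : C ∈ st.parts) (hh : ¬ Homog X C) :
    (splitClass X st C).parts.card = st.parts.card + 1 := by
  obtain ⟨h1, h2, h3⟩ := notMem_parts_of_not_homog hv hC hh
  rw [splitClass_of_not_homog hh]
  simp only
  rw [Finset.card_union_of_disjoint, Finset.card_pair h3, Finset.card_erase_of_mem hC]
  · have := Finset.card_pos.2 ⟨C, hC⟩; omega
  · rw [Finset.disjoint_right]; intro D hD
    simp only [Finset.mem_insert, Finset.mem_singleton] at hD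
    rcases hD with rfl | rfl <;> simp [h1, h2]

theorem card_work_splitClass_le : (splitClass X st C).work.card ≤ st.work.card + 1 := by
  by_cases hh : Homog X C
  · rw [splitClass_of_homog hh]; omega
  rw [splitClass_of_not_homog hh]
  simp only
  split_ifs with hw
  · refine (Finset.card_union_le _ _).trans ?_
    have := Finset.card_le_two (a := C ∩ X) (b := C \ X)
    rw [Finset.card_erase_of_mem hw]
    have := Finset.card_pos.2 ⟨C, hw⟩; omega
  · exact (Finset.card_union_le _ _).trans (by simp)

/-- Every genuine split creates one more class and at most one more member of the work set. As each
iteration removes a member, the machine performs at most n iterations. -/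
theorem Steps.card_work (h : Steps X st st') (hv : st.Valid) :
    st'.work.card + st.parts.card ≤ st.work.card + st'.parts.card := by
  refine (h.preserves (p := fun a => a.work.card + st.parts.card ≤ st.work.card + a.parts.card)
    ?_ hv le_rfl).2
  intro a C hva hC hh ih
  rw [card_parts_splitClass hva hC hh]
  have := card_work_splitClass_le (X := X) (st := a) (C := C)
  omega

theorem RState.Valid.card_parts_le [Fintype S] (hv : st.Valid) :
    st.parts.card ≤ Fintype.card S := by
  have : ∀ C : st.parts, ∃ s, s ∈ C.1 := fun C => hv.nonempty C.1 C.2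
  choose f hf using this
  rw [← Fintype.card_coe]
  refine Fintype.card_le_of_injective f fun C D h => Subtype.ext ?_
  exact hv.eq_of_mem C C.2 D D.2 (f C) (hf C) (h ▸ hf D)

/-- The potential of the amortized analysis: the weight of every element is counted once for each
time that its class may still be processed. -/
noncomputable def pot (w : S → ℕ) (st : RState S) : ℕ :=
  ∑ C ∈ st.parts, (∑ s ∈ C, w s) * (Nat.log 2 C.card + if C ∈ st.work then 1 else 0)

/-- The smaller part has at most half the size of the class, hence a logarithm smaller by at least
one. -/
theorem log_card_add_one_le {a b : ℕ} (ha : 0 < a) (h : a ≤ b) :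
    Nat.log 2 a + 1 ≤ Nat.log 2 (a + b) := by
  rw [← Nat.log_mul_base (by norm_num) ha.ne']
  exact Nat.log_mono_right (by omega)

/-- If C is waiting, both parts inherit its flag and their logarithms do not exceed that of C. If
not, only the smaller part is flagged, and the drop of its logarithm pays for the flag. -/
theorem pot_splitClass_le (w : S → ℕ) (hv : st.Valid) (hC : C ∈ st.parts) (hh : ¬ Homog X C) :
    pot w (splitClass X st C) ≤ pot w st := by
  obtain ⟨h1, h2, h3⟩ := notMem_parts_of_not_homog hv hC hh
  have hparts : (splitClass X st C).parts =
      insert (C ∩ X) (insert (C \ X) (st.parts.erase C)) := by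
    ext D; rw [mem_parts_splitClass hh]; simp only [Finset.mem_insert, Finset.mem_erase]; tauto
  have hrest : ∀ D ∈ st.parts.erase C, (D ∈ (splitClass X st C).work ↔ D ∈ st.work) := by
    intro D hD
    rw [Finset.mem_erase] at hD
    have hD1 : D ≠ C ∩ X := fun e => h1 (e ▸ hD.2)
    have hD2 : D ≠ C \ X := fun e => h2 (e ▸ hD.2)
    by_cases hw : C ∈ st.work
    · rw [mem_work_splitClass_of_mem hh hw]; simp [hD.1, hD1, hD2]
    · rw [mem_work_splitClass_of_notMem hh hw]
      rcases smallPart_cases (X := X) (C := C) with h | h <;> simp [h, hD1, hD2]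
  have hsum : ∑ s ∈ C, w s = ∑ s ∈ C ∩ X, w s + ∑ s ∈ C \ X, w s :=
    (Finset.sum_inter_add_sum_sdiff C X w).symm
  have hcard : C.card = (C ∩ X).card + (C \ X).card :=
    (Finset.card_inter_add_card_sdiff C X).symm
  have hp1 := Finset.card_pos.2 (Finset.nonempty_iff_ne_empty.2 (inter_ne_empty_of_not_homog hh))
  have hp2 := Finset.card_pos.2 (Finset.nonempty_iff_ne_empty.2 (sdiff_ne_empty_of_not_homog hh))
  have hl1 : Nat.log 2 (C ∩ X).card ≤ Nat.log 2 C.card := Nat.log_mono_right (by omega)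
  have hl2 : Nat.log 2 (C \ X).card ≤ Nat.log 2 C.card := Nat.log_mono_right (by omega)
  have key1 : Nat.log 2 (C ∩ X).card + (if C ∩ X ∈ (splitClass X st C).work then 1 else 0) ≤
      Nat.log 2 C.card + if C ∈ st.work then 1 else 0 := by
    by_cases hw : C ∈ st.work
    · rw [if_pos hw]; split_ifs <;> omega
    · rw [if_neg hw]
      split_ifs with h
      · rcases (mem_work_splitClass_of_notMem hh hw).1 h with h | h
        · exact absurd (hv.work_subset _ h) h1
        · unfold smallPart at h
          split_ifs at h with hle
          · rw [hcard]; exact log_card_add_one_le hp1 hle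
          · exact absurd h h3
      · omega
  have key2 : Nat.log 2 (C \ X).card + (if C \ X ∈ (splitClass X st C).work then 1 else 0) ≤
      Nat.log 2 C.card + if C ∈ st.work then 1 else 0 := by
    by_cases hw : C ∈ st.work
    · rw [if_pos hw]; split_ifs <;> omega
    · rw [if_neg hw]
      split_ifs with h
      · rcases (mem_work_splitClass_of_notMem hh hw).1 h with h | h
        · exact absurd (hv.work_subset _ h) h2
        · unfold smallPart at h
          split_ifs at h with hle
          · exact absurd h.symm h3
          · rw [hcard, add_comm (C ∩ X).card]; exact log_card_add_one_le hp2 (by omega)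
      · omega
  unfold pot
  rw [hparts, Finset.sum_insert, Finset.sum_insert, ← Finset.add_sum_erase _ _ hC, hsum, add_mul,
    ← add_assoc]
  · refine add_le_add (add_le_add (Nat.mul_le_mul_left _ key1) (Nat.mul_le_mul_left _ key2)) ?_
    exact le_of_eq (Finset.sum_congr rfl fun D hD => by simp only [hrest D hD])
  · simp [h2]
  · simp [h1, h3]

theorem Steps.pot_le (w : S → ℕ) (h : Steps X st st') (hv : st.Valid) :
    pot w st' ≤ pot w st :=
  (h.preserves (p := fun a => pot w a ≤ pot w st)
    (fun _ _ hva hC hh ih => (pot_splitClass_le w hva hC hh).trans ih) hv le_rfl).2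

/-- Removing C from the work set releases exactly the weight of C, the budget of the iteration. -/
theorem pot_pop (w : S → ℕ) (hv : st.Valid) (hC : C ∈ st.work) :
    pot w (st.pop C) + ∑ s ∈ C, w s = pot w st := by
  have hC' := hv.work_subset C hC
  unfold pot RState.pop
  simp only
  rw [← Finset.add_sum_erase _ _ hC', ← Finset.add_sum_erase st.parts _ hC']
  have : ∀ D ∈ st.parts.erase C, (D ∈ st.work.erase C ↔ D ∈ st.work) := fun D hD => by
    simp [(Finset.mem_erase.1 hD).1]
  have hrest : ∑ D ∈ st.parts.erase C, (∑ s ∈ D, w s) *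
        (Nat.log 2 D.card + if D ∈ st.work.erase C then 1 else 0) =
      ∑ D ∈ st.parts.erase C, (∑ s ∈ D, w s) * (Nat.log 2 D.card + if D ∈ st.work then 1 else 0) :=
    Finset.sum_congr rfl fun D hD => by simp only [this D hD]
  rw [hrest, if_neg (by simp), if_pos hC]
  ring

theorem pot_le [Fintype S] (w : S → ℕ) (hv : st.Valid) :
    pot w st ≤ (∑ s, w s) * (Nat.log 2 (Fintype.card S) + 1) := by
  have h1 : ∑ s, w s = ∑ C ∈ st.parts, ∑ s ∈ C, w s := by
    rw [← Finset.sum_biUnion]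
    · refine Finset.sum_congr ?_ fun _ _ => rfl
      ext s
      obtain ⟨C, hC, hs⟩ := hv.cover s
      simpa using ⟨C, hC, hs⟩
    · intro C hC D hD hne
      rw [Function.onFun, Finset.disjoint_left]
      exact fun s hs hs' => hne (hv.eq_of_mem C hC D hD s hs hs')
  rw [h1, Finset.sum_mul]
  refine Finset.sum_le_sum fun C _ => Nat.mul_le_mul_left _ (add_le_add ?_ ?_)
  · exact Nat.log_mono_right (Finset.card_le_univ C)
  · split_ifs <;> simp

theorem RState.Valid.univ [Fintype S] [Nonempty S] : (⟨{Finset.univ}, ∅⟩ : RState S).Valid :=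
  ⟨by simp, by simp, by simp, by simp⟩

/-- A sequence of complete splittings. -/
inductive RefinedSeq : List (Finset S) → RState S → RState S → Prop
  | nil (st : RState S) : RefinedSeq [] st st
  | cons {X : Finset S} {l : List (Finset S)} {st st₁ st₂ : RState S} :
      Refined X st st₁ → RefinedSeq l st₁ st₂ → RefinedSeq (X :: l) st st₂

theorem RefinedSeq.snoc {l : List (Finset S)} {st st₁ st₂ : RState S} (h : RefinedSeq l st st₁)
    (h' : Refined X st₁ st₂) : RefinedSeq (l ++ [X]) st st₂ := by
  induction h with
  | nil => exact .cons h' (.nil _)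
  | cons h _ ih => exact .cons h (ih h')

theorem RefinedSeq.preserves {p : RState S → Prop} {l : List (Finset S)}
    (hp : ∀ X ∈ l, ∀ a b, a.Valid → Steps X a b → p a → p b) (h : RefinedSeq l st st')
    (hv : st.Valid) (h0 : p st) : st'.Valid ∧ p st' := by
  induction h with
  | nil => exact ⟨hv, h0⟩
  | cons h _ ih =>
    exact ih (fun X hX => hp X (List.mem_cons_of_mem _ hX)) (h.1.valid hv)
      (hp _ List.mem_cons_self _ _ hv h.1 h0)

theorem RefinedSeq.valid {l : List (Finset S)} (h : RefinedSeq l st st') (hv : st.Valid) :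
    st'.Valid :=
  (h.preserves (p := fun _ => True) (fun _ _ _ _ _ _ _ => trivial) hv trivial).1

theorem RefinedSeq.homog {l : List (Finset S)} (h : RefinedSeq l st st') (hv : st.Valid) :
    ∀ X ∈ l, ∀ C ∈ st'.parts, Homog X C := by
  induction h with
  | nil => simp
  | cons h hs ih =>
    have hv' := h.1.valid hv
    intro Y hY
    rcases List.mem_cons.1 hY with rfl | hY
    · exact (hs.preserves (p := fun a => ∀ C ∈ a.parts, Homog Y C)
        (fun X _ a b hva hab ih => hab.homog hva ih) hv' h.2).2
    · exact ih hv' Y hY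

theorem SplitSeq.refinedSeq {l : List (Finset S)} {c : ℕ} (h : SplitSeq l st c st')
    (hv : st.Valid) : RefinedSeq l st st' := by
  induction h with
  | nil => exact .nil _
  | cons h _ ih =>
    have h' := h.refined hv
    exact .cons h' (ih (h'.1.valid hv))

theorem SplitSeq.cost {l : List (Finset S)} {c : ℕ} (h : SplitSeq l st c st') :
    c = (l.map fun X => X.card + 1).sum := by
  induction h with
  | nil => simp
  | cons h _ ih => simp [ih]

theorem exists_splitSeq (l : List (Finset S)) (st : RState S) :
    ∃ c st', SplitSeq l st c st' := by
  induction l generalizing st with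
  | nil => exact ⟨0, st, .nil st⟩
  | cons X l ih =>
    obtain ⟨st₁, h₁⟩ := exists_split X st
    obtain ⟨c, st₂, h₂⟩ := ih st₁
    exact ⟨_, st₂, .cons h₁ h₂⟩

/-- The invariants of the main loop. -/
structure LoopInv {B : Type*} (F : B → S → S) (r₀ r : S → S → Prop) (st : RState S) : Prop where
  valid : st.Valid
  fine : ∀ s t, st.Rel s t → r₀ s t
  saturated : Saturated r st
  pending : Pending F ∅ st

/-- All splitters are preimages of one fixed set C, even if C itself is cut meanwhile. They are
unions of classes of r, because C was such a union at the start of the iteration and F respects r.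
-/
theorem LoopInv.iterate {B : Type*} {F : B → S → S} {r₀ r : S → S → Prop}
    (hr : ∀ s t, r s t → r t s) (hF : ∀ b s t, r s t → r (F b s) (F b t))
    (h : LoopInv F r₀ r st) (hC : C ∈ st.work) {l : List (Finset S)}
    (hl : ∀ X ∈ l, ∃ b, ∀ s, s ∈ X ↔ F b s ∈ C)
    (hl' : ∀ b, ∃ X ∈ l, ∀ s, s ∈ X ↔ F b s ∈ C)
    (hs : RefinedSeq l (st.pop C) st') : LoopInv F r₀ r st' := by
  have hC' := h.valid.work_subset C hC
  have hv := h.valid.pop C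
  refine ⟨hs.valid hv, ?_, ?_, ?_⟩
  · exact (hs.preserves (p := fun a => ∀ s t, a.Rel s t → r₀ s t)
      (fun X _ a b hva hab ih s t hst => ih s t (hab.rel hva s t hst)) hv h.fine).2
  · refine (hs.preserves (p := Saturated r) (fun X hX a b hva hab ih => ?_) hv h.saturated).2
    obtain ⟨b, hb⟩ := hl X hX
    refine hab.saturated hr (fun s t hst hs => ?_) hva ih
    rw [hb] at hs ⊢
    exact h.saturated C hC' _ _ (hF b s t hst) hs
  · refine Pending.of_homog (C := C) (hs.preserves (p := Pending F C)
      (fun X _ a b hva hab ih => hab.pending hva ih) hv (h.pending.pop hC')).2 ?_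
    intro b D hD s hs' t ht hsC
    obtain ⟨X, hX, hb⟩ := hl' b
    rw [← hb] at hsC ⊢
    exact hs.homog hv X hX D hD s hs' t ht hsC

end Partition

/-! ### Start of the main loop, weights, and numerical estimates -/

section Loop

open scoped Classical

variable {S : Type v} {C : Finset S} {st st' : RState S}

theorem RState.Valid.isClasses (hv : st.Valid) {r : S → S → Prop} (h : ∀ s t, st.Rel s t → r s t)
    (hsat : Saturated r st) : IsClasses r st.parts := by
  have key : ∀ C ∈ st.parts, ∀ s ∈ C, ∀ t, t ∈ C ↔ r s t := fun C hC s hs t =>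
    ⟨fun ht => h s t ⟨C, hC, hs, ht⟩, fun hr => hsat C hC s t hr hs⟩
  intro C
  constructor
  · intro hC
    obtain ⟨s, hs⟩ := hv.nonempty C hC
    exact ⟨s, key C hC s hs⟩
  · rintro ⟨s, hs⟩
    obtain ⟨D, hD, hsD⟩ := hv.cover s
    have : C = D := Finset.ext fun t => (hs t).trans (key D hD s hsD t).symm
    exact this ▸ hD

/-- Homogeneity for a splitter persists under later splits, and no split by a member of l separates
elements related by r. -/
theorem refinedSeq_univ [Fintype S] [Nonempty S] {l : List (Finset S)} {r : S → S → Prop}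
    (hr : ∀ s t, r s t ↔ ∀ X ∈ l, (s ∈ X ↔ t ∈ X)) (h : RefinedSeq l ⟨{Finset.univ}, ∅⟩ st) :
    st.Valid ∧ (∀ s t, st.Rel s t → r s t) ∧ Saturated r st := by
  have hv := RState.Valid.univ (S := S)
  refine ⟨h.valid hv, ?_, ?_⟩
  · rintro s t ⟨D, hD, hs, ht⟩
    rw [hr]
    intro X hX
    have := h.homog hv X hX D hD
    exact ⟨this s hs t ht, this t ht s hs⟩
  · refine (h.preserves (p := Saturated r) (fun X hX a b hva hab ih => ?_) hv ?_).2
    · exact hab.saturated (fun s t hst => (hr t s).2 fun X hX => ((hr s t).1 hst X hX).symm)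
        (fun s t hst => ((hr s t).1 hst X hX).1) hva ih
    · intro C hC s t _ _
      simp only [Finset.mem_singleton] at hC
      simp [hC]

/-- Leaving S out of the work set is harmless: if S is a class, any two images are in the same
class. The range allowed for `work` covers both the algorithm and the machine, which puts all
classes into it. -/
theorem LoopInv.start [Fintype S] {B : Type*} (F : B → S → S) {r₀ r : S → S → Prop}
    (hr : ∀ s t, r s t → r₀ s t) (hv : st.Valid) (h0 : ∀ s t, st.Rel s t → r₀ s t)
    (hsat : Saturated r₀ st) {work : Finset (Finset S)} (hw : ∀ D ∈ work, D ∈ st.parts)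
    (hw' : ∀ D ∈ st.parts, D ≠ Finset.univ → D ∈ work) : LoopInv F r₀ r ⟨st.parts, work⟩ := by
  refine ⟨⟨hv.nonempty, hv.eq_of_mem, hv.cover, hw⟩, h0,
    fun D hD s t hst => hsat D hD s t (hr s t hst), fun b s t _ => ?_⟩
  obtain ⟨D, hD, hs⟩ := hv.cover (F b s)
  by_cases hu : D = Finset.univ
  · exact Or.inl ⟨D, hD, hs, by simp [hu]⟩
  · exact Or.inr (Or.inl ⟨D, hw' D hD hu, Or.inl hs⟩)

/-- The weights of the elements in the analysis of the main loop. -/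
noncomputable def wt [Fintype S] {B : Type*} [Fintype B] (F : B → S → S) (x : S) : ℕ :=
  1 + ∑ b, (2 + (Finset.univ.filter fun s => F b s = x).card)

/-- Fibers of distinct points are disjoint, so the fiber sizes add up to the size of the preimage of
C. This makes the weight of C an upper bound for the cost of processing C. -/
theorem sum_wt [Fintype S] {B : Type*} [Fintype B] (F : B → S → S) (C : Finset S) :
    ∑ x ∈ C, wt F x =
      C.card + ∑ b, (2 * C.card + (Finset.univ.filter fun s => F b s ∈ C).card) := by
  unfold wt
  rw [Finset.sum_add_distrib, Finset.sum_comm]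
  congr 1
  · simp
  · refine Finset.sum_congr rfl fun b _ => ?_
    rw [Finset.sum_add_distrib]
    congr 1
    · simp [mul_comm]
    · rw [Finset.card_eq_sum_card_fiberwise (f := F b) (t := C) (fun s hs => by simpa using hs)]
      refine Finset.sum_congr rfl fun x hx => ?_
      congr 1
      ext s
      simp only [Finset.mem_filter, Finset.mem_univ, true_and]
      exact ⟨fun h => ⟨h ▸ hx, h⟩, fun h => h.2⟩

theorem sum_wt_univ [Fintype S] {B : Type*} [Fintype B] (F : B → S → S) :
    ∑ x, wt F x = Fintype.card S * (1 + 3 * Fintype.card B) := by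
  rw [sum_wt]
  simp
  ring

theorem sum_map_of_enumerates {α : Type*} [Fintype α] {l : List α}
    (hl : Enumerates l fun _ => True) (f : α → ℕ) : (l.map f).sum = ∑ a, f a := by
  rw [← List.sum_toFinset f hl.1]
  congr 1
  ext a
  simpa using (hl.2 a).2 trivial

theorem sum_flatMap_eq {α : Type*} (l : List α) (f : α → List ℕ) :
    (l.flatMap f).sum = (l.map fun a => (f a).sum).sum := by
  induction l with
  | nil => rfl
  | cons a l ih => simp [ih]

theorem exists_enumerates (α : Type*) [Fintype α] : ∃ l : List α, Enumerates l fun _ => True :=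
  ⟨Finset.univ.toList, Finset.nodup_toList _, by simp⟩

end Loop

/-- For n ≥ 2 the rounded binary logarithm is at least 1, so adding 1 at most doubles it, and 2 /
log 2 < 3. -/
theorem log_two_add_one_le {n : ℕ} (hn : 2 ≤ n) : ((Nat.log 2 n + 1 : ℕ) : ℝ) ≤ 3 * Real.log n := by
  have h2 := Real.log_two_gt_d9
  have h1 : (Nat.log 2 n : ℝ) * Real.log 2 ≤ Real.log n := by
    rw [← Real.log_pow]
    refine Real.log_le_log (by positivity) ?_
    exact_mod_cast Nat.pow_log_le_self 2 (by omega)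
  have h3 : 1 ≤ Nat.log 2 n := Nat.log_pos (by norm_num) hn
  have h4 : (1 : ℝ) ≤ Nat.log 2 n := by exact_mod_cast h3
  push_cast
  nlinarith

theorem real_bound {c k n m : ℕ} (hn : 2 ≤ n)
    (h : c ≤ k * (n ^ 2 + m * n * (Nat.log 2 n + 1))) :
    (c : ℝ) ≤ (3 * k : ℝ) * ((n : ℝ) ^ 2 + (m : ℝ) * n * Real.log n) := by
  have h1 : (c : ℝ) ≤ k * ((n : ℝ) ^ 2 + m * n * ((Nat.log 2 n + 1 : ℕ) : ℝ)) := by exact_mod_cast h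
  have h2 : (m : ℝ) * n * ((Nat.log 2 n + 1 : ℕ) : ℝ) ≤ m * n * (3 * Real.log n) :=
    mul_le_mul_of_nonneg_left (log_two_add_one_le hn) (by positivity)
  calc (c : ℝ) ≤ k * ((n : ℝ) ^ 2 + m * n * ((Nat.log 2 n + 1 : ℕ) : ℝ)) := h1
    _ ≤ k * (3 * (n : ℝ) ^ 2 + m * n * (3 * Real.log n)) := by
      refine mul_le_mul_of_nonneg_left (add_le_add ?_ h2) (by positivity)
      nlinarith [sq_nonneg (n : ℝ)]
    _ = _ := by ring

/-! ### Correctness and running time of the algorithm -/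

section Algorithm

open scoped Classical

variable {A : Type u} {S : Type v} [Semigroup S] {h : FreeSemigroup A →ₙ* S} {P : Set (S × S)}

/-- Multiplication with the image of a letter, on the right or on the left. -/
def letterAct (h : FreeSemigroup A →ₙ* S) : A ⊕ A → S → S
  | .inl a, s => s * h (FreeSemigroup.of a)
  | .inr a, s => h (FreeSemigroup.of a) * s

theorem equivCon_le_cong {s t : S} (hst : equivCon h P s t) : cong h P s t := hst none none

theorem equivCon_letterAct (b : A ⊕ A) (s t : S) (hst : equivCon h P s t) :
    equivCon h P (letterAct h b s) (letterAct h b t) := by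
  cases b with
  | inl a => exact (equivCon h P).mul hst ((equivCon h P).refl _)
  | inr a => exact (equivCon h P).mul ((equivCon h P).refl _) hst

theorem cong_iff [Fintype S] (l : List S) (hl : ∀ s, s ∈ l) (s t : S) : cong h P s t ↔
    ∀ X ∈ l.flatMap fun s => [rowSet (maxPairs h P) s, colSet (maxPairs h P) s],
      (s ∈ X ↔ t ∈ X) := by
  constructor
  · intro hst X hX
    simp only [List.mem_flatMap, List.mem_cons, List.not_mem_nil, or_false] at hX
    obtain ⟨z, -, rfl | rfl⟩ := hX
    · simpa [rowSet] using (hst z).1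
    · simpa [colSet] using (hst z).2
  · intro hX z
    have h1 := hX (rowSet (maxPairs h P) z)
      (List.mem_flatMap.2 ⟨z, hl z, by simp⟩)
    have h2 := hX (colSet (maxPairs h P) z)
      (List.mem_flatMap.2 ⟨z, hl z, by simp⟩)
    simpa [rowSet, colSet] using And.intro h1 h2

variable [Fintype S] [Nonempty S]

theorem InitRun.spec {c : ℕ} {st : RState S} (hi : InitRun h P c st) :
    st.Valid ∧ (∀ s t, st.Rel s t → cong h P s t) ∧ Saturated (cong h P) st ∧
      c ≤ 5 * Fintype.card S ^ 2 := by
  obtain ⟨l, c', hl, hs, rfl⟩ := hi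
  obtain ⟨h1, h2, h3⟩ := refinedSeq_univ (cong_iff l fun s => (hl.2 s).2 trivial)
    (hs.refinedSeq RState.Valid.univ)
  refine ⟨h1, h2, h3, ?_⟩
  -- Two operations for each s, each of them charged at most |S| + 1.
  have hc : c' ≤ Fintype.card S * (2 * (Fintype.card S + 1)) := by
    rw [hs.cost, List.map_flatMap, sum_flatMap_eq, sum_map_of_enumerates hl]
    refine (Finset.sum_le_card_nsmul _ _ (2 * (Fintype.card S + 1)) fun s _ => ?_).trans (by simp)
    have e1 := Finset.card_le_univ (rowSet (maxPairs h P) s)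
    have e2 := Finset.card_le_univ (colSet (maxPairs h P) s)
    simp only [List.map_cons, List.map_nil, List.sum_cons, List.sum_nil]
    omega
  have hpos : 1 ≤ Fintype.card S := Fintype.card_pos
  nlinarith

variable [Fintype A]

/-- Cost plus potential does not grow in the main loop. The case |S| = 1 is separate because log 1 =
0 leaves no room for a term with |A|: there the only class is S, T is empty and the potential
vanishes. -/
theorem Run.spec {c : ℕ} {st : RState S} (hr : Run h P c st) :
    LoopInv (letterAct h) (cong h P) (equivCon h P) st ∧
      c + pot (wt (letterAct h)) st ≤ 5 * Fintype.card S ^ 2 +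
        if Fintype.card S = 1 then 0 else
          (∑ x, wt (letterAct h) x) * (Nat.log 2 (Fintype.card S) + 1) := by
  induction hr with
  | @start c st hi =>
    obtain ⟨h1, h2, h3, h4⟩ := hi.spec
    have hL : LoopInv (letterAct h) (cong h P) (equivCon h P)
        ⟨st.parts, st.parts.filter fun C => C ≠ Finset.univ⟩ :=
      LoopInv.start _ (fun _ _ => equivCon_le_cong) h1 h2 h3
        (fun D hD => (Finset.mem_filter.1 hD).1) fun D hD hne => Finset.mem_filter.2 ⟨hD, hne⟩
    refine ⟨hL, add_le_add h4 ?_⟩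
    split_ifs with h1'
    · refine le_of_eq (Finset.sum_eq_zero fun C hC => ?_)
      have hne := h1.nonempty C hC
      have hsub : Subsingleton S := Fintype.card_le_one_iff_subsingleton.1 h1'.le
      have hCu : C = Finset.univ := Finset.eq_univ_of_forall fun s => by
        obtain ⟨t, ht⟩ := hne
        rwa [Subsingleton.elim s t]
      simp [hCu, h1']
    · exact pot_le _ hL.valid
  | @step c c' st st' C l _ hC hl hs ih =>
    obtain ⟨hL, hc⟩ := ih
    have hR := hs.refinedSeq (hL.valid.pop C)
    have hL' : LoopInv (letterAct h) (cong h P) (equivCon h P) st' := by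
      refine hL.iterate (fun s t => (equivCon h P).symm) equivCon_letterAct hC ?_ ?_ hR
      · intro X hX
        simp only [List.mem_flatMap, List.mem_cons, List.not_mem_nil, or_false] at hX
        obtain ⟨a, -, rfl | rfl⟩ := hX
        · exact ⟨.inl a, by simp [rightInv, letterAct]⟩
        · exact ⟨.inr a, by simp [leftInv, letterAct]⟩
      · rintro (a | a)
        · exact ⟨rightInv h C a, List.mem_flatMap.2 ⟨a, (hl.2 a).2 trivial, by simp⟩,
            by simp [rightInv, letterAct]⟩
        · exact ⟨leftInv h C a, List.mem_flatMap.2 ⟨a, (hl.2 a).2 trivial, by simp⟩,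
            by simp [leftInv, letterAct]⟩
    refine ⟨hL', ?_⟩
    have hpot : pot (wt (letterAct h)) st' ≤ pot (wt (letterAct h)) (st.pop C) :=
      (hR.preserves (p := fun a => pot (wt (letterAct h)) a ≤ pot (wt (letterAct h)) (st.pop C))
        (fun X _ a b hva hab ih => (hab.pot_le _ hva).trans ih) (hL.valid.pop C) le_rfl).2
    have hpop := pot_pop (wt (letterAct h)) hL.valid hC
    have hne := Finset.card_pos.2 (hL.valid.nonempty C (hL.valid.work_subset C hC))
    have hcost : c' = ∑ a, ((rightInv h C a).card + 1 + ((leftInv h C a).card + 1)) := by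
      rw [hs.cost, List.map_flatMap, sum_flatMap_eq, ← sum_map_of_enumerates hl]
      simp
    -- As C is non-empty, the summand |C| covers the unit for the iteration, and 2|C| for each
    -- letter action covers the unit for its splitter.
    have hsum : 1 + c' ≤ ∑ x ∈ C, wt (letterAct h) x := by
      rw [sum_wt, hcost]
      refine add_le_add hne ?_
      rw [Fintype.sum_sum_type, ← Finset.sum_add_distrib]
      refine Finset.sum_le_sum fun a _ => add_le_add ?_ ?_
      · refine le_trans (by omega : _ ≤ 2 * C.card + (rightInv h C a).card) (le_of_eq ?_)
        unfold letterAct rightInv; congr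
      · refine le_trans (by omega : _ ≤ 2 * C.card + (leftInv h C a).card) (le_of_eq ?_)
        unfold letterAct leftInv; congr
    omega

theorem Run.bound {c : ℕ} {st : RState S} (hr : Run h P c st) (hA : 0 < Fintype.card A) :
    (c : ℝ) ≤ 21 * ((Fintype.card S : ℝ) ^ 2 +
      (Fintype.card A : ℝ) * (Fintype.card S : ℝ) * Real.log (Fintype.card S : ℝ)) := by
  have hc := hr.spec.2
  have hpos : 1 ≤ Fintype.card S := Fintype.card_pos
  by_cases h1 : Fintype.card S = 1
  · rw [if_pos h1] at hc
    rw [h1] at hc ⊢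
    have : (c : ℝ) ≤ 5 := by exact_mod_cast (by omega : c ≤ 5)
    norm_num; linarith
  · rw [if_neg h1, sum_wt_univ, Fintype.card_sum] at hc
    refine (real_bound (k := 7) (m := Fintype.card A) (by omega : 2 ≤ Fintype.card S) ?_).trans
      (by norm_num)
    -- This is where a letter is needed: |A| ≥ 1 absorbs the summand 1.
    have h2 : Fintype.card S * (1 + 3 * (Fintype.card A + Fintype.card A)) ≤
        7 * (Fintype.card A * Fintype.card S) := by nlinarith
    have h3 := Nat.mul_le_mul_right (Nat.log 2 (Fintype.card S) + 1) h2
    nlinarith [sq_nonneg (Fintype.card S)]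

variable (h P) in
-- No run gets stuck while T is non-empty, each iteration costs at least one unit, and all costs are
-- bounded by a number b that is the same for all runs.
theorem exists_terminating_run : ∃ c st, Run h P c st ∧ st.work = ∅ := by
  obtain ⟨l, hl⟩ := exists_enumerates S
  obtain ⟨lA, hlA⟩ := exists_enumerates A
  obtain ⟨c₀, st₀, h₀⟩ := exists_splitSeq
    (l.flatMap fun s => [rowSet (maxPairs h P) s, colSet (maxPairs h P) s]) ⟨{Finset.univ}, ∅⟩
  obtain ⟨b, hb⟩ : ∃ b, ∀ c st, Run h P c st → c ≤ b :=
    ⟨_, fun c st hr => (Nat.le_add_right _ _).trans hr.spec.2⟩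
  have key : ∀ d c st, Run h P c st → b ≤ c + d → ∃ c st, Run h P c st ∧ st.work = ∅ := by
    intro d
    induction d with
    | zero =>
      intro c st hr hd
      refine ⟨c, st, hr, Finset.eq_empty_of_forall_notMem fun C hC => ?_⟩
      obtain ⟨c', st', h'⟩ := exists_splitSeq
        (lA.flatMap fun a => [rightInv h C a, leftInv h C a]) ⟨st.parts, st.work.erase C⟩
      have := hb _ _ (Run.step hr hC hlA h')
      omega
    | succ d ih =>
      intro c st hr hd
      by_cases hw : st.work = ∅
      · exact ⟨c, st, hr, hw⟩
      · obtain ⟨C, hC⟩ := Finset.nonempty_iff_ne_empty.2 hw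
        obtain ⟨c', st', h'⟩ := exists_splitSeq
          (lA.flatMap fun a => [rightInv h C a, leftInv h C a]) ⟨st.parts, st.work.erase C⟩
        exact ih _ _ (Run.step hr hC hlA h') (by omega)
  exact key b _ _ (Run.start ⟨l, c₀, hl, h₀, rfl⟩) (by omega)

/-- With T empty, `Pending` says that the partition is stable under letters, so it refines ≡;
saturation is the other inclusion. -/
theorem Run.isClasses (hs : Function.Surjective h) {c : ℕ} {st : RState S} (hr : Run h P c st)
    (hw : st.work = ∅) : IsClasses (equivCon h P) st.parts := by
  have hL := hr.spec.1
  refine hL.valid.isClasses (fun s t hst => ?_) hL.saturated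
  exact equivCon_of_stable h hs (r := st.Rel) hL.fine
    (fun a s t => hL.pending.rel hw (.inl a) s t) (fun a s t => hL.pending.rel hw (.inr a) s t) hst

end Algorithm

/-! ### Weakest preconditions with a clock -/

section ProgramLogic

/-- The product, the images of the letters and the accepting pairs on natural numbers. -/
def Input.mulN (I : Input) (k l : ℕ) : ℕ :=
  if h : k < I.n ∧ l < I.n then I.mul ⟨k, h.1⟩ ⟨l, h.2⟩ else 0

def Input.genN (I : Input) (k : ℕ) : ℕ := if h : k < I.m then I.gen ⟨k, h⟩ else 0

def Input.accN (I : Input) (k l : ℕ) : Prop :=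
  ∃ h : k < I.n ∧ l < I.n, I.acc ⟨k, h.1⟩ ⟨l, h.2⟩

variable (I : Input) (W : ℕ)

/-- The evaluation of `e` succeeds with a value that satisfies `Q`. -/
def EWp (σ : Mem) (e : Expr) (Q : ℕ → Prop) : Prop := ∃ v, e.eval I W σ = some v ∧ Q v

def TWp (σ : Mem) (b : Test) (Q : Bool → Prop) : Prop := ∃ v, b.eval I W σ = some v ∧ Q v

/-- Started at time `t`, the program halts, and its final time and memory satisfy `Q`. -/
def Wp (p : Prog) (σ : Mem) (t : ℕ) (Q : ℕ → Mem → Prop) : Prop :=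
  ∃ t' τ, Exec I W p σ t' τ ∧ Q (t + t') τ

variable {I W} {σ τ : Mem} {Q : ℕ → Prop}

theorem exists_fit {k : ℕ} {Q : ℕ → Prop} : (∃ v, fit W k = some v ∧ Q v) ↔ k < W ∧ Q k := by
  unfold fit; split_ifs with h <;> simp [h]

theorem exists_bind {o : Option ℕ} {α : Type*} {f : ℕ → Option α} {Q : α → Prop} :
    (∃ v, o.bind f = some v ∧ Q v) ↔ ∃ k, o = some k ∧ ∃ v, f k = some v ∧ Q v := by
  cases o <;> simp

-- These rules are equivalences for `simp`: a claim about straight-line code unfolds to range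
-- conditions, mostly left to `omega`, and the postcondition.
@[simp] theorem EWp_const {k : ℕ} : EWp I W σ (.const k) Q ↔ k < W ∧ Q k := exists_fit

@[simp] theorem EWp_reg {x : ℕ} : EWp I W σ (.reg x) Q ↔ σ.reg x < W ∧ Q (σ.reg x) := exists_fit

@[simp] theorem EWp_cell {a : ℕ} {i : Expr} : EWp I W σ (.cell a i) Q ↔
    EWp I W σ i fun k => σ.arr a k < W ∧ Q (σ.arr a k) := by
  simp only [EWp, Expr.eval, exists_bind, exists_fit]

@[simp] theorem EWp_add {e f : Expr} : EWp I W σ (.add e f) Q ↔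
    EWp I W σ e fun k => EWp I W σ f fun l => k + l < W ∧ Q (k + l) := by
  simp only [EWp, Expr.eval, exists_bind, exists_fit]

@[simp] theorem EWp_sub {e f : Expr} : EWp I W σ (.sub e f) Q ↔
    EWp I W σ e fun k => EWp I W σ f fun l => k - l < W ∧ Q (k - l) := by
  simp only [EWp, Expr.eval, exists_bind, exists_fit]

@[simp] theorem EWp_mul {e f : Expr} : EWp I W σ (.mul e f) Q ↔
    EWp I W σ e fun k => EWp I W σ f fun l => k * l < W ∧ Q (k * l) := by
  simp only [EWp, Expr.eval, exists_bind, exists_fit]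

@[simp] theorem EWp_prod {e f : Expr} : EWp I W σ (.prod e f) Q ↔
    EWp I W σ e fun k => EWp I W σ f fun l =>
      (k < I.n ∧ l < I.n) ∧ I.mulN k l < W ∧ Q (I.mulN k l) := by
  simp only [EWp, Expr.eval, exists_bind]
  refine exists_congr fun k => and_congr_right fun _ => exists_congr fun l =>
    and_congr_right fun _ => ?_
  by_cases h : k < I.n ∧ l < I.n
  · simp only [h, and_self, dif_pos, exists_fit, true_and, Input.mulN]
  · simp [h]

@[simp] theorem EWp_gen {e : Expr} : EWp I W σ (.gen e) Q ↔
    EWp I W σ e fun k => k < I.m ∧ I.genN k < W ∧ Q (I.genN k) := by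
  simp only [EWp, Expr.eval, exists_bind]
  refine exists_congr fun k => and_congr_right fun _ => ?_
  by_cases h : k < I.m
  · simp only [h, dif_pos, exists_fit, true_and, Input.genN]
  · simp [h]

open scoped Classical in
@[simp] theorem EWp_acc {e f : Expr} : EWp I W σ (.acc e f) Q ↔
    EWp I W σ e fun k => EWp I W σ f fun l =>
      (k < I.n ∧ l < I.n) ∧ (if I.accN k l then 1 else 0) < W ∧
        Q (if I.accN k l then 1 else 0) := by
  simp only [EWp, Expr.eval, exists_bind]
  refine exists_congr fun k => and_congr_right fun _ => exists_congr fun l =>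
    and_congr_right fun _ => ?_
  by_cases h : k < I.n ∧ l < I.n
  · have : I.accN k l ↔ I.acc ⟨k, h.1⟩ ⟨l, h.2⟩ := ⟨fun h' => h'.2, fun h' => ⟨h, h'⟩⟩
    simp only [h, and_self, dif_pos, exists_fit, true_and, this]
  · simp [h]

@[simp] theorem TWp_lt {e f : Expr} {Q : Bool → Prop} : TWp I W σ (.lt e f) Q ↔
    EWp I W σ e fun k => EWp I W σ f fun l => Q (decide (k < l)) := by
  simp [TWp, EWp, Test.eval, exists_bind]

@[simp] theorem TWp_eq {e f : Expr} {Q : Bool → Prop} : TWp I W σ (.eq e f) Q ↔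
    EWp I W σ e fun k => EWp I W σ f fun l => Q (decide (k = l)) := by
  simp [TWp, EWp, Test.eval, exists_bind]

theorem TWp.mono {b : Test} {Q R : Bool → Prop} (h : TWp I W σ b Q) (hQ : ∀ v, Q v → R v) :
    TWp I W σ b R := let ⟨v, h1, h2⟩ := h; ⟨v, h1, hQ v h2⟩

section Memory

variable {x y a b i k : ℕ}

@[simp] theorem Mem.setReg_reg : (σ.setReg x k).reg y = if y = x then k else σ.reg y := by
  simp [Mem.setReg, Function.update_apply]

@[simp] theorem Mem.setReg_arr : (σ.setReg x k).arr = σ.arr := rfl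

@[simp] theorem Mem.setCell_reg : (σ.setCell a i k).reg = σ.reg := rfl

@[simp] theorem Mem.setCell_arr : (σ.setCell a i k).arr b =
    if b = a then Function.update (σ.arr a) i k else σ.arr b := by
  simp only [Mem.setCell, Function.update_apply]

end Memory

variable {t : ℕ} {Q : ℕ → Mem → Prop} {p q : Prog}

@[simp] theorem Wp_skip : Wp I W .skip σ t Q ↔ Q (t + 1) σ := by
  constructor
  · rintro ⟨t', τ, h, hQ⟩; cases h; exact hQ
  · exact fun hQ => ⟨_, _, .skip, hQ⟩

@[simp] theorem Wp_assign {x : ℕ} {e : Expr} : Wp I W (.assign x e) σ t Q ↔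
    EWp I W σ e fun k => Q (t + (e.cost + 1)) (σ.setReg x k) := by
  constructor
  · rintro ⟨t', τ, h, hQ⟩
    cases h with
    | assign h => exact ⟨_, h, hQ⟩
  · rintro ⟨k, h, hQ⟩; exact ⟨_, _, .assign h, hQ⟩

@[simp] theorem Wp_store {a : ℕ} {i e : Expr} : Wp I W (.store a i e) σ t Q ↔
    EWp I W σ i fun k => EWp I W σ e fun l =>
      Q (t + (i.cost + e.cost + 1)) (σ.setCell a k l) := by
  constructor
  · rintro ⟨t', τ, h, hQ⟩
    cases h with
    | store h h' => exact ⟨_, h, _, h', hQ⟩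
  · rintro ⟨k, h, l, h', hQ⟩; exact ⟨_, _, .store h h', hQ⟩

-- The clock is threaded through the composition, so that a postcondition can state a bound on the
-- absolute time.
@[simp] theorem Wp_seq : Wp I W (.seq p q) σ t Q ↔
    Wp I W p σ t fun t' τ => Wp I W q τ t' Q := by
  constructor
  · rintro ⟨t', τ, h, hQ⟩
    cases h with
    | seq h h' => exact ⟨_, _, h, _, _, h', by rwa [Nat.add_assoc]⟩
  · rintro ⟨_, _, h, _, _, h', hQ⟩; exact ⟨_, _, .seq h h', by rwa [← Nat.add_assoc]⟩

@[simp] theorem Wp_ite {b : Test} : Wp I W (.ite b p q) σ t Q ↔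
    TWp I W σ b fun v => (v = true → Wp I W p σ (t + b.cost) Q) ∧
      (v = false → Wp I W q σ (t + b.cost) Q) := by
  constructor
  · rintro ⟨t', τ, h, hQ⟩
    cases h with
    | ite_true h h' => exact ⟨_, h, fun _ => ⟨_, _, h', by rwa [Nat.add_assoc]⟩, by simp⟩
    | ite_false h h' => exact ⟨_, h, by simp, fun _ => ⟨_, _, h', by rwa [Nat.add_assoc]⟩⟩
  · rintro ⟨v, h, h1, h2⟩
    cases v with
    | true =>
      obtain ⟨_, _, h', hQ⟩ := h1 rfl
      exact ⟨_, _, .ite_true h h', by rwa [← Nat.add_assoc]⟩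
    | false =>
      obtain ⟨_, _, h', hQ⟩ := h2 rfl
      exact ⟨_, _, .ite_false h h', by rwa [← Nat.add_assoc]⟩

theorem Wp.mono {R : ℕ → Mem → Prop} (h : Wp I W p σ t Q) (hQ : ∀ t τ, Q t τ → R t τ) :
    Wp I W p σ t R := let ⟨t', τ, h1, h2⟩ := h; ⟨t', τ, h1, hQ _ _ h2⟩

/-- The registers that a program may change. -/
def Prog.modR : Prog → List ℕ
  | .skip => []
  | .assign x _ => [x]
  | .store _ _ _ => []
  | .seq p q => p.modR ++ q.modR
  | .ite _ p q => p.modR ++ q.modR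
  | .loop _ p => p.modR

/-- The arrays that a program may change. -/
def Prog.modA : Prog → List ℕ
  | .skip => []
  | .assign _ _ => []
  | .store a _ _ => [a]
  | .seq p q => p.modA ++ q.modA
  | .ite _ p q => p.modA ++ q.modA
  | .loop _ p => p.modA

/-- The memories agree on all registers and arrays that the program does not change. -/
structure Frame (p : Prog) (σ τ : Mem) : Prop where
  reg : ∀ x, x ∉ p.modR → τ.reg x = σ.reg x
  arr : ∀ a, a ∉ p.modA → τ.arr a = σ.arr a

theorem Frame.refl (p : Prog) (σ : Mem) : Frame p σ σ := ⟨fun _ _ => rfl, fun _ _ => rfl⟩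

theorem Frame.trans {ρ : Mem} (h : Frame p σ τ) (h' : Frame p τ ρ) : Frame p σ ρ :=
  ⟨fun x hx => (h'.reg x hx).trans (h.reg x hx), fun a ha => (h'.arr a ha).trans (h.arr a ha)⟩

theorem Frame.of_subset (h : Frame p σ τ) (hr : ∀ x ∈ p.modR, x ∈ q.modR)
    (ha : ∀ x ∈ p.modA, x ∈ q.modA) : Frame q σ τ :=
  ⟨fun x hx => h.reg x fun h => hx (hr x h), fun a h' => h.arr a fun h => h' (ha a h)⟩

theorem Exec.frame {t : ℕ} (h : Exec I W p σ t τ) : Frame p σ τ := by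
  induction h with
  | skip => exact Frame.refl _ _
  | assign h => exact ⟨fun y hy => by simp_all [Prog.modR], fun _ _ => rfl⟩
  | store h h' => exact ⟨fun _ _ => rfl, fun b hb => by simp_all [Prog.modA]⟩
  | seq _ _ ih ih' =>
    exact (ih.of_subset (by simp +contextual [Prog.modR]) (by simp +contextual [Prog.modA])).trans
      (ih'.of_subset (by simp +contextual [Prog.modR]) (by simp +contextual [Prog.modA]))
  | ite_true _ _ ih =>
    exact ih.of_subset (by simp +contextual [Prog.modR]) (by simp +contextual [Prog.modA])
  | ite_false _ _ ih =>
    exact ih.of_subset (by simp +contextual [Prog.modR]) (by simp +contextual [Prog.modA])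
  | loop_false => exact Frame.refl _ _
  | loop_true _ _ _ ih ih' => exact Frame.trans ⟨ih.reg, ih.arr⟩ ih'

theorem Wp.frame (h : Wp I W p σ t Q) : Wp I W p σ t fun t' τ => Frame p σ τ ∧ Q t' τ :=
  let ⟨t', τ, h1, h2⟩ := h; ⟨t', τ, h1, h1.frame, h2⟩

theorem Test.cost_pos (b : Test) : 0 < b.cost := by cases b <;> simp [Test.cost]

/-- The rule for loops, with an invariant that bounds the time. -/
theorem Wp_loop {b : Test} (J : ℕ → Mem → Prop) (T : ℕ) (h0 : J t σ)
    (hT : ∀ t τ, J t τ → t ≤ T)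
    (hstep : ∀ t τ, Frame p σ τ → J t τ → TWp I W τ b fun v =>
      (v = true → Wp I W p τ (t + b.cost) J) ∧ (v = false → Q (t + b.cost) τ)) :
    Wp I W (.loop b p) σ t Q := by
  -- Each test costs at least one unit while the invariant keeps the clock below T, so T + 1 rounds
  -- are enough fuel.
  have key : ∀ d t τ, Frame p σ τ → J t τ → T < t + d → Wp I W (.loop b p) τ t Q := by
    intro d
    induction d with
    | zero => intro t τ _ hJ hd; have := hT t τ hJ; omega
    | succ d ih =>
      intro t τ hF hJ hd
      obtain ⟨v, hv, h1, h2⟩ := hstep t τ hF hJ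
      cases v with
      | false => exact ⟨_, _, .loop_false hv, h2 rfl⟩
      | true =>
        obtain ⟨t₁, τ₁, he, hJ'⟩ := h1 rfl
        have := b.cost_pos
        obtain ⟨t₂, τ₂, he', hQ⟩ := ih _ τ₁ (hF.trans he.frame) hJ' (by omega)
        exact ⟨_, _, .loop_true hv he he', by simpa only [Nat.add_assoc] using hQ⟩
  exact key (T + 1) t σ (Frame.refl _ _) h0 (by omega)

/-- `for x := 0 to y - 1 do p` for registers `x` and `y`. -/
def forProg (x y : ℕ) (p : Prog) : Prog :=
  .seq (.assign x (.const 0))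
    (.loop (.lt (.reg x) (.reg y)) (.seq p (.assign x (.add (.reg x) (.const 1)))))

/-- The constants are the costs of the control code: 2 for the initial assignment, 3 for a test, 4
for the increment. The final test accounts for the 3 in `hQ`. -/
theorem Wp_for {x y N : ℕ} (J : ℕ → ℕ → Mem → Prop) (hy : σ.reg y = N) (hN : N + 1 < W)
    (hxy : x ≠ y) (hxp : x ∉ p.modR) (hyp : y ∉ p.modR) (h0 : J 0 (t + 2) (σ.setReg x 0))
    (hstep : ∀ i t τ, i < N → Frame (forProg x y p) σ τ → τ.reg x = i → J i t τ →
      Wp I W p τ (t + 3) fun t' ρ => J (i + 1) (t' + 4) (ρ.setReg x (i + 1)))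
    (hQ : ∀ t τ, Frame (forProg x y p) σ τ → τ.reg x = N → J N t τ → Q (t + 3) τ) :
    Wp I W (forProg x y p) σ t Q := by
  have hym : y ∉ (forProg x y p).modR := by
    simp only [forProg, Prog.modR, List.mem_append, List.mem_singleton]; tauto
  have key : ∀ d i t τ, i + d = N → Frame (forProg x y p) σ τ → τ.reg x = i → J i t τ →
      Wp I W (.loop (.lt (.reg x) (.reg y)) (.seq p (.assign x (.add (.reg x) (.const 1))))) τ t
        Q := by
    intro d
    induction d with
    | zero =>
      intro i t τ hi hF hx hJ
      have hy' : τ.reg y = N := by rw [hF.reg y hym, hy]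
      obtain rfl : i = N := hi
      refine ⟨_, _, .loop_false ?_, hQ t τ hF hx hJ⟩
      have h1 : i < W := by omega
      simp [Test.eval, Expr.eval, hx, hy', fit, h1]
    | succ d ih =>
      intro i t τ hi hF hx hJ
      have hy' : τ.reg y = N := by rw [hF.reg y hym, hy]
      obtain ⟨t₁, ρ, he, hJ'⟩ := hstep i t τ (by omega) hF hx hJ
      have hFp := he.frame
      have hx' : ρ.reg x = i := by rw [hFp.reg x hxp, hx]
      have h1 : i < W := by omega
      have h2 : N < W := by omega
      have h3 : 1 < W := by omega
      have h4 : i + 1 < W := by omega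
      have he2 : Exec I W (.assign x (.add (.reg x) (.const 1))) ρ 4 (ρ.setReg x (i + 1)) := by
        have h := Exec.assign (I := I) (W := W) (σ := ρ) (x := x) (k := i + 1)
          (e := .add (.reg x) (.const 1)) (by simp [Expr.eval, hx', fit, h1, h3, h4])
        exact h
      have hF' : Frame (forProg x y p) σ (ρ.setReg x (i + 1)) :=
        hF.trans (Exec.frame (he.seq he2) |>.of_subset
          (by simp +contextual [forProg, Prog.modR]) (by simp +contextual [forProg, Prog.modA]))
      obtain ⟨t₂, ρ', he3, hQ'⟩ := ih (i + 1) (t + 3 + t₁ + 4) (ρ.setReg x (i + 1)) (by omega) hF'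
        (by simp) hJ'
      refine ⟨_, _, .loop_true ?_ (he.seq he2) he3, ?_⟩
      · have : i < N := by omega
        simp [Test.eval, Expr.eval, hx, hy', fit, h1, h2, this]
      · convert hQ' using 1; simp only [Test.cost, Expr.cost]; omega
  rw [forProg, Wp_seq, Wp_assign, EWp_const]
  refine ⟨by omega, key N 0 _ _ (by omega) ?_ (by simp) h0⟩
  exact ⟨fun z hz => by simp_all [forProg, Prog.modR], fun _ _ => rfl⟩

end ProgramLogic

/-! ### Partitions given by arrays of labels -/

section Labels

section DecidableEq

variable {S : Type v} [inst : DecidableEq S] {X C D : Finset S} {st : RState S}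

/-- The abstract algorithm uses classical decidability of equality, whereas `Fin n` has its own
instance; this lemma and the next three reconcile the two. -/
theorem Homog.inter_or_sdiff_eq_empty (h : Homog X C) : C ∩ X = ∅ ∨ C \ X = ∅ := by
  obtain rfl : inst = fun a b => Classical.propDecidable (a = b) := Subsingleton.elim _ _
  exact h.inter_or_sdiff

theorem mem_parts_splitClass_iff (h : ¬ Homog X C) :
    D ∈ (splitClass X st C).parts ↔ (D ≠ C ∧ D ∈ st.parts) ∨ D = C ∩ X ∨ D = C \ X := by
  obtain rfl : inst = fun a b => Classical.propDecidable (a = b) := Subsingleton.elim _ _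
  exact mem_parts_splitClass h

theorem mem_work_splitClass_iff_of_mem (h : ¬ Homog X C) (hC : C ∈ st.work) :
    D ∈ (splitClass X st C).work ↔ (D ≠ C ∧ D ∈ st.work) ∨ D = C ∩ X ∨ D = C \ X := by
  obtain rfl : inst = fun a b => Classical.propDecidable (a = b) := Subsingleton.elim _ _
  exact mem_work_splitClass_of_mem h hC

theorem mem_work_splitClass_iff_of_notMem (h : ¬ Homog X C) (hC : C ∉ st.work) :
    D ∈ (splitClass X st C).work ↔
      D ∈ st.work ∨ D = if (C ∩ X).card ≤ (C \ X).card then C ∩ X else C \ X := by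
  obtain rfl : inst = fun a b => Classical.propDecidable (a = b) := Subsingleton.elim _ _
  exact mem_work_splitClass_of_notMem h hC

end DecidableEq

/-- The class with the label `c`. -/
def fiber (n : ℕ) (cls : ℕ → ℕ) (c : ℕ) : Finset (Fin n) :=
  Finset.univ.filter fun s => cls s = c

@[simp] theorem mem_fiber {n : ℕ} {cls : ℕ → ℕ} {c : ℕ} {s : Fin n} :
    s ∈ fiber n cls c ↔ cls s = c := by simp [fiber]

/-- The partition and the work set of `st` are given by labels below `k`. -/
structure Repr (n k : ℕ) (cls size inT : ℕ → ℕ) (st : RState (Fin n)) : Prop where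
  cls_lt : ∀ s : Fin n, cls s < k
  nonempty : ∀ c < k, (fiber n cls c).Nonempty
  size_eq : ∀ c < k, size c = (fiber n cls c).card
  parts : ∀ C, C ∈ st.parts ↔ ∃ c < k, C = fiber n cls c
  work : ∀ C, C ∈ st.work ↔ ∃ c < k, inT c ≠ 0 ∧ C = fiber n cls c
  inT_eq : ∀ c, k ≤ c → inT c = 0
  inT_le : ∀ c, inT c ≤ 1

variable {n k : ℕ} {cls size inT : ℕ → ℕ} {st : RState (Fin n)}

theorem Repr.fiber_injective (h : Repr n k cls size inT st) {c d : ℕ} (hc : c < k)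
    (he : fiber n cls c = fiber n cls d) : c = d := by
  obtain ⟨s, hs⟩ := h.nonempty c hc
  have hs' := he ▸ hs
  rw [mem_fiber] at hs hs'
  exact hs.symm.trans hs'

theorem Repr.valid (h : Repr n k cls size inT st) : st.Valid := by
  refine ⟨fun C hC => ?_, fun C hC D hD s hsC hsD => ?_, fun s => ?_, fun C hC => ?_⟩
  · obtain ⟨c, hc, rfl⟩ := (h.parts C).1 hC
    exact h.nonempty c hc
  · obtain ⟨c, hc, rfl⟩ := (h.parts C).1 hC
    obtain ⟨d, hd, rfl⟩ := (h.parts D).1 hD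
    rw [mem_fiber] at hsC hsD
    rw [← hsC, ← hsD]
  · exact ⟨fiber n cls (cls s), (h.parts _).2 ⟨_, h.cls_lt s, rfl⟩, by simp⟩
  · obtain ⟨c, hc, -, rfl⟩ := (h.work C).1 hC
    exact (h.parts _).2 ⟨c, hc, rfl⟩

theorem Repr.card_parts (h : Repr n k cls size inT st) : st.parts.card = k := by
  have : st.parts = (Finset.range k).image (fiber n cls) := by
    ext C; simp [h.parts, eq_comm]
  rw [this, Finset.card_image_of_injOn, Finset.card_range]
  intro c hc d _ he
  exact h.fiber_injective (by simpa using hc) he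

theorem Repr.le (h : Repr n k cls size inT st) : k ≤ n := by
  rw [← h.card_parts]; simpa using h.valid.card_parts_le

theorem Repr.size_le (h : Repr n k cls size inT st) {c : ℕ} (hc : c < k) : size c ≤ n := by
  rw [h.size_eq c hc]; simpa using Finset.card_le_univ (fiber n cls c)

theorem Repr.rel_iff (h : Repr n k cls size inT st) (s t : Fin n) :
    st.Rel s t ↔ cls s = cls t := by
  constructor
  · rintro ⟨C, hC, hs, ht⟩
    obtain ⟨c, hc, rfl⟩ := (h.parts C).1 hC
    rw [mem_fiber] at hs ht
    rw [hs, ht]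
  · intro he
    exact ⟨_, (h.parts _).2 ⟨_, h.cls_lt s, rfl⟩, by simp, by simp [he]⟩

/-- The part inside X gets the fresh label k and the rest keeps c, so no other label changes. A flag
of c stays and k gets one as well; otherwise the smaller part is flagged, and k in case of a tie. -/
theorem Repr.split (h : Repr n k cls size inT st) {c cnt : ℕ} (hc : c < k) {X : Finset (Fin n)}
    (hcnt : cnt = (fiber n cls c ∩ X).card) (h0 : 0 < cnt) (h1 : cnt < size c)
    {cls' : ℕ → ℕ} (hcls : ∀ s : Fin n, cls' s = if cls s = c ∧ s ∈ X then k else cls s) :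
    ¬ Homog X (fiber n cls c) ∧ Repr n (k + 1) cls'
      (Function.update (Function.update size k cnt) c (size c - cnt))
      (Function.update inT (if 0 < inT c then k else if size c - cnt < cnt then c else k) 1)
      (splitClass X st (fiber n cls c)) := by
  have hcardI : (fiber n cls c ∩ X).card = cnt := hcnt.symm
  have hcardD : (fiber n cls c \ X).card = size c - cnt := by
    have := Finset.card_inter_add_card_sdiff (fiber n cls c) X
    rw [h.size_eq c hc]; omega
  have hh : ¬ Homog X (fiber n cls c) := fun hh => by
    rcases hh.inter_or_sdiff_eq_empty with e | e
    · rw [e, Finset.card_empty] at hcardI; omega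
    · rw [e, Finset.card_empty] at hcardD; omega
  have hne : c ≠ k := hc.ne
  have fk : fiber n cls' k = fiber n cls c ∩ X := by
    ext s
    have := h.cls_lt s
    simp only [mem_fiber, hcls, Finset.mem_inter]
    split_ifs with hs
    · simp [hs]
    · exact ⟨fun e => absurd e this.ne, fun e => absurd e hs⟩
  have fc : fiber n cls' c = fiber n cls c \ X := by
    ext s
    simp only [mem_fiber, hcls, Finset.mem_sdiff]
    split_ifs with hs
    · simp [hs, hne.symm]
    · tauto
  have fd : ∀ d, d ≠ c → d ≠ k → fiber n cls' d = fiber n cls d := by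
    intro d hdc hdk
    ext s
    simp only [mem_fiber, hcls]
    split_ifs with hs
    · simp [hs, hdk.symm, hdc.symm]
    · rfl
  have hparts : ∀ D, D ∈ (splitClass X st (fiber n cls c)).parts ↔
      ∃ d < k + 1, D = fiber n cls' d := by
    intro D
    rw [mem_parts_splitClass_iff hh, h.parts]
    constructor
    · rintro (⟨hne', d, hd, rfl⟩ | hD | hD)
      · exact ⟨d, by omega, (fd d (fun e => hne' (by rw [e])) hd.ne).symm⟩
      · exact ⟨k, by omega, by rw [hD, fk]⟩
      · exact ⟨c, by omega, by rw [hD, fc]⟩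
    · rintro ⟨d, hd, rfl⟩
      by_cases hdc : d = c
      · subst hdc; right; right; rw [fc]
      · by_cases hdk : d = k
        · subst hdk; right; left; rw [fk]
        · refine Or.inl ⟨?_, d, by omega, fd d hdc hdk⟩
          rw [fd d hdc hdk]
          exact fun e => hdc (h.fiber_injective (by omega) e)
  refine ⟨hh, ⟨fun s => ?_, fun d hd => ?_, fun d hd => ?_, hparts, fun D => ?_, fun d hd => ?_,
    fun d => ?_⟩⟩
  · rw [hcls]; have := h.cls_lt s; split_ifs <;> omega
  · by_cases hdc : d = c
    · rw [hdc, fc, ← Finset.card_pos]; omega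
    · by_cases hdk : d = k
      · rw [hdk, fk, ← Finset.card_pos]; omega
      · rw [fd d hdc hdk]; exact h.nonempty d (by omega)
  · by_cases hdc : d = c
    · subst hdc; rw [fc, hcardD]; simp
    · by_cases hdk : d = k
      · subst hdk; rw [fk, hcardI]; simp [hdc]
      · rw [fd d hdc hdk]; simp [hdc, hdk, h.size_eq d (by omega)]
  · have hk0 := h.inT_eq k le_rfl
    have hwc : fiber n cls c ∈ st.work ↔ inT c ≠ 0 := by
      rw [h.work]
      constructor
      · rintro ⟨d, hd, h1, he⟩
        rwa [h.fiber_injective hc he]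
      · exact fun h1 => ⟨c, hc, h1, rfl⟩
    by_cases hw : inT c = 0
    · rw [mem_work_splitClass_iff_of_notMem hh (by rw [hwc]; simpa using hw), h.work, hcardI,
        hcardD, if_neg (by omega : ¬ 0 < inT c)]
      -- x is the label of the part that enters the work set.
      have hx : ∃ x, (if size c - cnt < cnt then c else k) = x ∧ x < k + 1 ∧ (x = c ∨ x = k) ∧
          (if cnt ≤ size c - cnt then fiber n cls c ∩ X else fiber n cls c \ X) =
            fiber n cls' x := by
        by_cases hlt : size c - cnt < cnt
        · exact ⟨c, by simp [hlt], by omega, Or.inl rfl, by rw [if_neg (by omega), fc]⟩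
        · exact ⟨k, by simp [hlt], by omega, Or.inr rfl, by rw [if_pos (by omega), fk]⟩
      obtain ⟨x, hx, hxk, hxck, hxf⟩ := hx
      rw [hx, hxf]
      constructor
      · rintro (⟨d, hd, hd0, rfl⟩ | rfl)
        · have hdc : d ≠ c := fun e => hd0 (e ▸ hw)
          refine ⟨d, by omega, ?_, (fd d hdc hd.ne).symm⟩
          rwa [Function.update_of_ne (by omega)]
        · exact ⟨x, hxk, by simp, rfl⟩
      · rintro ⟨d, hd, hd0, rfl⟩
        by_cases hdx : d = x
        · exact Or.inr (by rw [hdx])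
        · rw [Function.update_of_ne hdx] at hd0
          have hdc : d ≠ c := fun e => hd0 (e ▸ hw)
          have hdk : d ≠ k := fun e => hd0 (e ▸ hk0)
          exact Or.inl ⟨d, by omega, hd0, fd d hdc hdk⟩
    · rw [mem_work_splitClass_iff_of_mem hh (hwc.2 hw), h.work, if_pos (by omega : 0 < inT c)]
      constructor
      · rintro (⟨hne', d, hd, hd0, rfl⟩ | rfl | rfl)
        · refine ⟨d, by omega, ?_, (fd d (fun e => hne' (by rw [e])) hd.ne).symm⟩
          rwa [Function.update_of_ne hd.ne]
        · exact ⟨k, by omega, by simp, fk.symm⟩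
        · exact ⟨c, by omega, by rwa [Function.update_of_ne hne], fc.symm⟩
      · rintro ⟨d, hd, hd0, rfl⟩
        by_cases hdc : d = c
        · exact Or.inr (Or.inr (by rw [hdc, fc]))
        · by_cases hdk : d = k
          · exact Or.inr (Or.inl (by rw [hdk, fk]))
          · rw [Function.update_of_ne hdk] at hd0
            refine Or.inl ⟨?_, d, by omega, hd0, fd d hdc hdk⟩
            rw [fd d hdc hdk]
            exact fun e => hdc (h.fiber_injective (by omega) e)
  · have := h.inT_eq d (by omega)
    rw [Function.update_of_ne]
    · exact this
    · split_ifs <;> omega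
  · have := h.inT_le d
    by_cases hd : d = if 0 < inT c then k else if size c - cnt < cnt then c else k
    · rw [hd]; simp
    · rw [Function.update_of_ne hd]; exact this

end Labels

/-! ### Word size, and lists stored in arrays -/

section Bounds

variable {I : Input} {W : ℕ}

theorem mulN_lt {s t : ℕ} (hn : 0 < I.n) : I.mulN s t < I.n := by
  unfold Input.mulN; split_ifs
  · exact Fin.isLt _
  · exact hn

theorem genN_lt {a : ℕ} (hn : 0 < I.n) : I.genN a < I.n := by
  unfold Input.genN; split_ifs
  · exact Fin.isLt _
  · exact hn

/-- The numbers that occur in the computation fit into words. -/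
structure Fits (I : Input) (W : ℕ) : Prop where
  pos : 0 < I.n
  lt : 4 * (I.m * I.n) + I.n * I.n + 2 * I.n + 2 * I.m + 100 < W

theorem add_mul_lt {b s k n : ℕ} (hb : b < k) (hs : s < n) : b * n + s < k * n := by
  have := Nat.mul_le_mul_right n (Nat.succ_le_of_lt hb)
  rw [Nat.succ_mul] at this
  omega

end Bounds

section Lists

/-- The first `len` values of `f` are the members of `l`. -/
structure ListAt (f : ℕ → ℕ) (len : ℕ) (l : List ℕ) : Prop where
  len_eq : len = l.length
  get : ∀ j (h : j < l.length), f j = l[j]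

theorem ListAt.nil (f : ℕ → ℕ) : ListAt f 0 [] := ⟨rfl, by simp⟩

theorem ListAt.snoc {f : ℕ → ℕ} {len : ℕ} {l : List ℕ} (h : ListAt f len l) (x : ℕ) :
    ListAt (Function.update f len x) (len + 1) (l ++ [x]) := by
  refine ⟨by simp [h.len_eq], fun j hj => ?_⟩
  rw [List.getElem_append]
  have := h.len_eq
  split_ifs with hjl
  · rw [Function.update_of_ne (by omega), h.get j hjl]
  · have : j = len := by simp at hj; omega
    subst this
    simp

theorem length_le_of_nodup {l : List ℕ} {n : ℕ} (hl : l.Nodup) (hn : ∀ s ∈ l, s < n) :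
    l.length ≤ n := by
  rw [← List.toFinset_card_of_nodup hl]
  simpa using Finset.card_le_card (fun s hs => by simpa using hn s (by simpa using hs) :
    l.toFinset ⊆ Finset.range n)

end Lists

section Build

variable {I : Input} {W : ℕ} {σ : Mem} {t : ℕ}

/-- Write the elements of the semigroup that satisfy a test into an array. -/
def buildProg (cond : Test) (a l : ℕ) : Prog :=
  .seq (.assign l (.const 0)) (forProg 4 0 (.ite cond
    (.seq (.store a (.reg l) (.reg 4)) (.assign l (.add (.reg l) (.const 1)))) .skip))

theorem buildProg_spec (hF : Fits I W) {cond : Test} {a l : ℕ} {p : ℕ → Prop} [DecidablePred p]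
    (h0 : σ.reg 0 = I.n) (hl0 : l ≠ 0) (hl4 : l ≠ 4)
    (hcond : ∀ τ, Frame (buildProg cond a l) σ τ → τ.reg 4 < I.n →
      TWp I W τ cond fun v => v = decide (p (τ.reg 4))) :
    Wp I W (buildProg cond a l) σ t fun t' τ => t' ≤ t + (cond.cost + 20) * I.n + 10 ∧
      ListAt (τ.arr a) (τ.reg l) ((List.range I.n).filter p) := by
  have hW := hF.lt
  rw [buildProg, Wp_seq, Wp_assign, EWp_const]
  refine ⟨by omega, ?_⟩
  refine Wp_for (fun i t' τ => t' ≤ t + 4 + (cond.cost + 20) * i ∧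
    ListAt (τ.arr a) (τ.reg l) ((List.range i).filter p)) (N := I.n) (by simp [h0, hl0.symm])
    (by omega) (by decide) ?_ ?_ ?_ ?_ ?_
  · simp [Prog.modR, hl4.symm]
  · simp [Prog.modR, hl0.symm]
  · simp [hl4, ListAt.nil, Expr.cost]
  · rintro i t' τ hi hFr hx ⟨ht, hL⟩
    have hFr' : Frame (buildProg cond a l) σ τ := by
      have h1 : Frame (.assign l (.const 0)) σ (σ.setReg l 0) :=
        ⟨fun x hx => by simp_all [Prog.modR], fun _ _ => rfl⟩
      exact (h1.of_subset (by simp [buildProg, Prog.modR]) (by simp [buildProg, Prog.modA])).trans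
        (hFr.of_subset (by simp +contextual [buildProg, Prog.modR])
          (by simp +contextual [buildProg, Prog.modA]))
    have hlen : τ.reg l ≤ i := by
      rw [hL.len_eq]
      exact (List.length_filter_le _ _).trans (by simp)
    rw [Wp_ite]
    refine (hcond τ hFr' (by omega)).mono fun v hv => ?_
    rw [hx] at hv
    subst hv
    simp only [decide_eq_true_eq, decide_eq_false_iff_not]
    constructor
    · intro hp
      simp only [Wp_seq, Wp_store, Wp_assign, EWp_reg, EWp_add, EWp_const, Mem.setCell_reg, hx,
        Expr.cost]
      repeat refine ⟨by omega, ?_⟩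
      refine ⟨by rw [Nat.mul_succ]; omega, ?_⟩
      rw [List.range_succ, List.filter_append]
      simpa [hl4, hp] using hL.snoc i
    · intro hp
      rw [Wp_skip]
      refine ⟨by rw [Nat.mul_succ]; omega, ?_⟩
      rw [List.range_succ, List.filter_append]
      simpa [hl4, hp] using hL
  · rintro t' τ _ _ ⟨ht, hL⟩
    exact ⟨by omega, hL⟩

end Build

/-! ### The subroutines of the splitting operation -/

section SplitProg

variable {I : Input} {W : ℕ} {σ : Mem} {t : ℕ}

/-- Count the members of the splitter in all classes, and mark them. -/
def countProg : Prog := forProg 6 5 (.seq (.assign 7 (.cell 0 (.cell 7 (.reg 6))))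
  (.seq (.store 4 (.reg 7) (.add (.cell 4 (.reg 7)) (.const 1)))
    (.store 6 (.cell 7 (.reg 6)) (.const 1))))

/-- Move the marked elements of the class in register `7` to a new class. -/
def relabelProg : Prog :=
  .seq (forProg 9 0 (.ite (.eq (.cell 0 (.reg 9)) (.reg 7))
    (.ite (.eq (.cell 6 (.reg 9)) (.const 1)) (.store 0 (.reg 9) (.reg 2)) .skip) .skip))
  (.assign 2 (.add (.reg 2) (.const 1)))

/-- Split the class in register `7`. -/
def splitClassProg : Prog :=
  .seq (.store 3 (.reg 2) (.cell 4 (.reg 7)))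
  (.seq (.store 3 (.reg 7) (.sub (.cell 3 (.reg 7)) (.cell 4 (.reg 7))))
  (.seq (.ite (.lt (.const 0) (.cell 5 (.reg 7))) (.store 5 (.reg 2) (.const 1))
    (.ite (.lt (.cell 3 (.reg 7)) (.cell 3 (.reg 2))) (.store 5 (.reg 7) (.const 1))
      (.store 5 (.reg 2) (.const 1))))
  relabelProg))

/-- Split all classes with a positive counter, and reset the counters. -/
def splitAllProg : Prog := forProg 6 5 (.seq (.assign 7 (.cell 0 (.cell 7 (.reg 6))))
  (.ite (.lt (.const 0) (.cell 4 (.reg 7)))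
    (.seq (.ite (.lt (.cell 4 (.reg 7)) (.cell 3 (.reg 7))) splitClassProg .skip)
      (.store 4 (.reg 7) (.const 0))) .skip))

/-- Remove the marks. -/
def clearProg : Prog := forProg 6 5 (.store 6 (.cell 7 (.reg 6)) (.const 0))

/-- The operation `Split` for the splitter in array `7`, whose length is in register `5`. -/
def splitProg : Prog := .seq countProg (.seq splitAllProg clearProg)

theorem countProg_spec (hF : Fits I W) {L : List ℕ} (hL : ListAt (σ.arr 7) (σ.reg 5) L)
    (hnd : L.Nodup) (hLn : ∀ s ∈ L, s < I.n) (hcls : ∀ s < I.n, σ.arr 0 s < I.n)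
    (h4 : ∀ c, σ.arr 4 c = 0) (h6 : ∀ s, σ.arr 6 s = 0) :
    Wp I W countProg σ t fun t' τ => t' ≤ t + 40 * L.length + 10 ∧
      (∀ c, τ.arr 4 c = L.countP fun s => σ.arr 0 s = c) ∧
      ∀ s, τ.arr 6 s = if s ∈ L then 1 else 0 := by
  have hW := hF.lt
  have hlen := length_le_of_nodup hnd hLn
  refine Wp_for (fun i t' τ => t' ≤ t + 4 + 40 * i ∧
      (∀ c, τ.arr 4 c = (L.take i).countP fun s => σ.arr 0 s = c) ∧
      ∀ s, τ.arr 6 s = if s ∈ L.take i then 1 else 0) hL.len_eq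
    (by omega) (by decide) (by decide) (by decide) (by simp [h4, h6]) ?_ ?_
  · rintro i t' τ hi hFr hx ⟨ht, hc, hm⟩
    have e0 : τ.arr 0 = σ.arr 0 := hFr.arr 0 (by decide)
    have e7 : τ.arr 7 i = L[i] := by rw [hFr.arr 7 (by decide), hL.get i hi]
    have hLi := hLn L[i] (List.getElem_mem _)
    have hci := hcls _ hLi
    have hle : (List.take i L).countP (fun s => σ.arr 0 s = σ.arr 0 L[i]) ≤ I.n :=
      List.countP_le_length.trans (by simp; omega)
    have htake : L.take (i + 1) = L.take i ++ [L[i]] := (List.take_append_getElem hi).symm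
    simp [e0, e7, hx, hc, Expr.cost]
    repeat refine ⟨by omega, ?_⟩
    refine ⟨fun c => ?_, fun s => ?_⟩
    · simp only [Function.update_apply, hc, htake, List.countP_append, List.countP_singleton]
      by_cases h : c = σ.arr 0 L[i]
      · simp [h]
      · simp [h, Ne.symm h]
    · simp only [Function.update_apply, hm, htake, List.mem_append, List.mem_singleton]
      by_cases h : s = L[i] <;> simp [h]
  · rintro t' τ _ _ ⟨ht, hc, hm⟩
    refine ⟨by omega, by simpa using hc, by simpa using hm⟩

theorem clearProg_spec (hF : Fits I W) {L : List ℕ} (hL : ListAt (σ.arr 7) (σ.reg 5) L)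
    (hlen : L.length ≤ I.n) (hLn : ∀ s ∈ L, s < I.n) (h6 : ∀ s, s ∉ L → σ.arr 6 s = 0) :
    Wp I W clearProg σ t fun t' τ => t' ≤ t + 40 * L.length + 10 ∧ ∀ s, τ.arr 6 s = 0 := by
  have hW := hF.lt
  refine Wp_for (fun i t' τ => t' ≤ t + 4 + 40 * i ∧ ∀ s, s ∉ L.drop i → τ.arr 6 s = 0) hL.len_eq
    (by omega) (by decide) (by decide) (by decide) (by simpa using h6) ?_ ?_
  · rintro i t' τ hi hFr hx ⟨ht, hm⟩
    have e7 : τ.arr 7 i = L[i] := by rw [hFr.arr 7 (by decide), hL.get i hi]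
    have hLi := hLn L[i] (List.getElem_mem _)
    simp [e7, hx, Expr.cost]
    repeat refine ⟨by omega, ?_⟩
    intro s hs
    by_cases h : s = L[i]
    · simp [h]
    · rw [Function.update_of_ne h]
      refine hm s ?_
      rw [List.drop_eq_getElem_cons hi]
      exact fun h' => (List.mem_cons.1 h').elim h hs
  · rintro t' τ _ _ ⟨ht, hm⟩
    exact ⟨by omega, by simpa using hm⟩

/-- This scans all n elements. It is affordable because it only runs for genuine splits, of which
there are fewer than n. -/
theorem relabelProg_spec (hF : Fits I W) (h0 : σ.reg 0 = I.n) {k c : ℕ} (hk : σ.reg 2 = k)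
    (hc : σ.reg 7 = c) (hkn : k < I.n) (hcls : ∀ s < I.n, σ.arr 0 s < k) (hcn : c < k)
    (hm : ∀ s < I.n, σ.arr 6 s ≤ 1) :
    Wp I W relabelProg σ t fun t' τ => t' ≤ t + 40 * I.n + 20 ∧ τ.reg 2 = k + 1 ∧
      ∀ s < I.n, τ.arr 0 s = if σ.arr 0 s = c ∧ σ.arr 6 s = 1 then k else σ.arr 0 s := by
  have hW := hF.lt
  rw [relabelProg, Wp_seq]
  refine Wp_for (fun i t' τ => t' ≤ t + 4 + 40 * i ∧ (∀ s < i, τ.arr 0 s =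
    if σ.arr 0 s = c ∧ σ.arr 6 s = 1 then k else σ.arr 0 s) ∧
    ∀ s, i ≤ s → τ.arr 0 s = σ.arr 0 s) h0
    (by omega) (by decide) (by decide) (by decide) (by simp) ?_ ?_
  · rintro i t' τ hi hFr hx ⟨ht, hlt, hge⟩
    have e6 : τ.arr 6 = σ.arr 6 := by rw [hFr.arr 6 (by decide)]
    have r2 : τ.reg 2 = k := by rw [hFr.reg 2 (by decide), hk]
    have r7 : τ.reg 7 = c := by rw [hFr.reg 7 (by decide), hc]
    have hci := hcls i hi
    have hmi := hm i hi
    have e0 := hge i le_rfl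
    simp [e0, e6, hx, r2, r7, Expr.cost, Test.cost]
    repeat refine ⟨by omega, ?_⟩
    have hge' : ∀ s, i < s → τ.arr 0 s = σ.arr 0 s := fun s hs => hge s (by omega)
    constructor
    · intro h1
      repeat refine ⟨by omega, ?_⟩
      constructor
      · intro h2
        repeat refine ⟨by omega, ?_⟩
        refine ⟨fun s hs => ?_, fun s hs => ?_⟩
        · by_cases h : s = i
          · simp [h, h1, h2]
          · simpa [h] using hlt s (by omega)
        · rw [Function.update_of_ne (by omega)]
          exact hge' s hs
      · intro h2
        refine ⟨by omega, fun s hs => ?_, hge'⟩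
        by_cases h : s = i
        · simp [h, h2, e0]
        · exact hlt s (by omega)
    · intro h1
      refine ⟨by omega, fun s hs => ?_, hge'⟩
      by_cases h : s = i
      · simp [h, h1, e0]
      · exact hlt s (by omega)
  · rintro t' τ hFr hx ⟨ht, hlt, hge⟩
    have r2 : τ.reg 2 = k := by rw [hFr.reg 2 (by decide), hk]
    simp [r2, Expr.cost]
    repeat refine ⟨by omega, ?_⟩
    exact hlt

theorem splitClassProg_spec (hF : Fits I W) (h0 : σ.reg 0 = I.n) {k c : ℕ} (hk : σ.reg 2 = k)
    (hc : σ.reg 7 = c) (hck : c < k) (hkn : k < I.n) (hcls : ∀ s < I.n, σ.arr 0 s < k)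
    (hcnt : σ.arr 4 c ≤ I.n) (hsize : σ.arr 3 c ≤ I.n) (hT : σ.arr 5 c ≤ 1)
    (hm : ∀ s < I.n, σ.arr 6 s ≤ 1) :
    Wp I W splitClassProg σ t fun t' τ => t' ≤ t + 40 * I.n + 100 ∧ τ.reg 2 = k + 1 ∧
      τ.arr 3 = Function.update (Function.update (σ.arr 3) k (σ.arr 4 c)) c
        (σ.arr 3 c - σ.arr 4 c) ∧
      τ.arr 5 = Function.update (σ.arr 5) (if 0 < σ.arr 5 c then k else
        if σ.arr 3 c - σ.arr 4 c < σ.arr 4 c then c else k) 1 ∧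
      ∀ s < I.n, τ.arr 0 s = if σ.arr 0 s = c ∧ σ.arr 6 s = 1 then k else σ.arr 0 s := by
  have hW := hF.lt
  have hne : c ≠ k := by omega
  have hne' : k ≠ c := by omega
  -- The common tail of the three branches that set a flag.
  have hmain : ∀ t₁ τ₁, t₁ ≤ t + 60 → τ₁.reg = σ.reg → τ₁.arr 0 = σ.arr 0 → τ₁.arr 6 = σ.arr 6 →
      τ₁.arr 3 = Function.update (Function.update (σ.arr 3) k (σ.arr 4 c)) c
        (σ.arr 3 c - σ.arr 4 c) →
      τ₁.arr 5 = Function.update (σ.arr 5) (if 0 < σ.arr 5 c then k else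
        if σ.arr 3 c - σ.arr 4 c < σ.arr 4 c then c else k) 1 →
      Wp I W relabelProg τ₁ t₁ fun t' τ => t' ≤ t + 40 * I.n + 100 ∧ τ.reg 2 = k + 1 ∧
      τ.arr 3 = Function.update (Function.update (σ.arr 3) k (σ.arr 4 c)) c
        (σ.arr 3 c - σ.arr 4 c) ∧
      τ.arr 5 = Function.update (σ.arr 5) (if 0 < σ.arr 5 c then k else
        if σ.arr 3 c - σ.arr 4 c < σ.arr 4 c then c else k) 1 ∧
      ∀ s < I.n, τ.arr 0 s = if σ.arr 0 s = c ∧ σ.arr 6 s = 1 then k else σ.arr 0 s := by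
    intro t₁ τ₁ ht₁ hr ha0 ha6 ha3 ha5
    refine (relabelProg_spec hF (hr ▸ h0) (hr ▸ hk) (hr ▸ hc) hkn (ha0 ▸ hcls) hck
      (ha6 ▸ hm)).frame.mono ?_
    rintro t' τ ⟨hFr, ht, h2, hcl⟩
    exact ⟨by omega, h2, by rw [hFr.arr 3 (by decide), ha3], by rw [hFr.arr 5 (by decide), ha5],
      by rw [← ha0, ← ha6]; exact hcl⟩
  unfold splitClassProg
  simp [hk, hc, hne, hne', Expr.cost, Test.cost]
  repeat refine ⟨by omega, ?_⟩
  constructor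
  · intro h1
    refine ⟨by omega, by omega, hmain _ _ (by omega) (by simp) (by simp) (by simp) (by simp) ?_⟩
    simp [h1]
  · intro h1
    repeat refine ⟨by omega, ?_⟩
    constructor
    · intro h2
      refine ⟨by omega, by omega, hmain _ _ (by omega) (by simp) (by simp) (by simp) (by simp) ?_⟩
      simp [h1, h2]
    · intro h2
      refine ⟨by omega, by omega, hmain _ _ (by omega) (by simp) (by simp) (by simp) (by simp) ?_⟩
      simp [h1, not_lt.2 h2]

end SplitProg

/-! ### The complete splitting operation -/

section SplitProg

variable {I : Input} {W : ℕ} {σ : Mem} {t : ℕ}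

/-- The memory represents the state `st` of the algorithm, between two splittings. -/
structure Holds (I : Input) (σ : Mem) (st : RState (Fin I.n)) : Prop where
  reg0 : σ.reg 0 = I.n
  repr : Repr I.n (σ.reg 2) (σ.arr 0) (σ.arr 3) (σ.arr 5) st
  count : ∀ c, σ.arr 4 c = 0
  mark : ∀ s, σ.arr 6 s = 0

theorem countP_eq_card {n : ℕ} {L : List ℕ} (hnd : L.Nodup) (hLn : ∀ s ∈ L, s < n)
    {X : Finset (Fin n)} (hX : ∀ s : Fin n, s ∈ X ↔ (s : ℕ) ∈ L) (cls : ℕ → ℕ) (c : ℕ) :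
    L.countP (fun s => cls s = c) = (fiber n cls c ∩ X).card := by
  rw [List.countP_eq_length_filter, ← List.toFinset_card_of_nodup (hnd.filter _),
    ← Finset.card_map Fin.valEmbedding]
  congr 1
  ext s
  simp only [List.mem_toFinset, List.mem_filter, Finset.mem_map, Finset.mem_inter, mem_fiber, hX,
    Fin.valEmbedding_apply, decide_eq_true_eq]
  constructor
  · rintro ⟨h1, h2⟩
    exact ⟨⟨s, hLn s h1⟩, ⟨h2, h1⟩, rfl⟩
  · rintro ⟨s, ⟨h1, h2⟩, rfl⟩
    exact ⟨h2, h1⟩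

/-- The counters during the splitting of all classes. -/
structure Counts (n k : ℕ) (cls cnt : ℕ → ℕ) (X : Finset (Fin n)) : Prop where
  lt : ∀ c < k, cnt c = (fiber n cls c ∩ X).card ∨ (cnt c = 0 ∧ Homog X (fiber n cls c))
  ge : ∀ c, k ≤ c → cnt c = 0

theorem Counts.reset {n k : ℕ} {cls cnt : ℕ → ℕ} {X : Finset (Fin n)} (h : Counts n k cls cnt X)
    {c : ℕ} (hc : Homog X (fiber n cls c)) :
    Counts n k cls (Function.update cnt c 0) X := by
  refine ⟨fun d hd => ?_, fun d hd => ?_⟩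
  · by_cases hdc : d = c
    · subst hdc; exact Or.inr ⟨by simp, hc⟩
    · rw [Function.update_of_ne hdc]; exact h.lt d hd
  · by_cases hdc : d = c
    · subst hdc; simp
    · rw [Function.update_of_ne hdc]; exact h.ge d hd

/-- Both parts are homogeneous: the counter of c is reset, and that of the fresh label k has been 0
all along. So the elements that moved to k trigger no further action. -/
theorem Counts.split {n k : ℕ} {cls cnt cls' : ℕ → ℕ} {X : Finset (Fin n)}
    (h : Counts n k cls cnt X) {c : ℕ} (hc : c < k) (hcl : ∀ s : Fin n, cls s < k)
    (hcls : ∀ s : Fin n, cls' s = if cls s = c ∧ s ∈ X then k else cls s) :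
    Counts n (k + 1) cls' (Function.update cnt c 0) X := by
  refine ⟨fun d hd => ?_, fun d hd => ?_⟩
  · by_cases hdc : d = c
    · subst hdc
      refine Or.inr ⟨by simp, fun s hs t ht hsX => ?_⟩
      rw [mem_fiber, hcls] at hs
      have := hcl s
      split_ifs at hs with h1
      · omega
      · exact absurd ⟨hs, hsX⟩ h1
    · rw [Function.update_of_ne hdc]
      by_cases hdk : d = k
      · subst hdk
        refine Or.inr ⟨h.ge d le_rfl, fun s hs t ht hsX => ?_⟩
        rw [mem_fiber, hcls] at ht
        have := hcl t
        split_ifs at ht with h1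
        · exact h1.2
        · omega
      · have : fiber n cls' d = fiber n cls d := by
          ext s
          have := hcl s
          rw [mem_fiber, mem_fiber, hcls]
          split_ifs with h1 <;> omega
        rw [this]
        exact h.lt d (by omega)
  · rw [Function.update_of_ne (by omega)]
    exact h.ge d (by omega)

/-- Only classes that meet X are visited, through the elements of X, which takes O(|X|) time apart
from genuine splits. A split costs O(n) and creates a label; this is paid by the terms with n times
the number of labels on the two sides. -/
theorem splitAllProg_spec (hF : Fits I W) {st : RState (Fin I.n)} {L : List ℕ}
    {X : Finset (Fin I.n)} (hX : ∀ s : Fin I.n, s ∈ X ↔ (s : ℕ) ∈ L)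
    (h0 : σ.reg 0 = I.n) (hR : Repr I.n (σ.reg 2) (σ.arr 0) (σ.arr 3) (σ.arr 5) st)
    (hL : ListAt (σ.arr 7) (σ.reg 5) L) (hlen : L.length ≤ I.n) (hLn : ∀ s ∈ L, s < I.n)
    (hC : Counts I.n (σ.reg 2) (σ.arr 0) (σ.arr 4) X)
    (hm : ∀ s, σ.arr 6 s = if s ∈ L then 1 else 0) :
    Wp I W splitAllProg σ t fun t' τ => t' + 200 * (I.n * σ.reg 2) ≤
        t + 60 * L.length + 10 + 200 * (I.n * τ.reg 2) ∧
      (∀ c, τ.arr 4 c = 0) ∧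
      ∃ st', Refined X st st' ∧ Repr I.n (τ.reg 2) (τ.arr 0) (τ.arr 3) (τ.arr 5) st' := by
  have hW := hF.lt
  have hpos := hF.pos
  refine Wp_for (fun i t' τ => t' + 200 * (I.n * σ.reg 2) ≤
        t + 4 + 60 * i + 200 * (I.n * τ.reg 2) ∧
      (∀ s ∈ L.take i, τ.arr 4 (τ.arr 0 s) = 0) ∧
      Counts I.n (τ.reg 2) (τ.arr 0) (τ.arr 4) X ∧
      ∃ st', Steps X st st' ∧ Repr I.n (τ.reg 2) (τ.arr 0) (τ.arr 3) (τ.arr 5) st') hL.len_eq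
    (by omega) (by decide) (by decide) (by decide) ?_ ?_ ?_
  · simp only [Mem.setReg_reg, Mem.setReg_arr]
    exact ⟨by simp, by simp, by simpa using hC, st, Relation.ReflTransGen.refl, by simpa using hR⟩
  · rintro i t' τ hi hFr hx ⟨ht, hz, hC', st', hst', hR'⟩
    have e7 : τ.arr 7 i = L[i] := by rw [hFr.arr 7 (by decide), hL.get i hi]
    have e6 : τ.arr 6 = σ.arr 6 := hFr.arr 6 (by decide)
    have r0 : τ.reg 0 = I.n := by rw [hFr.reg 0 (by decide), h0]
    have hLi := hLn L[i] (List.getElem_mem _)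
    obtain ⟨c, hc⟩ : ∃ c, τ.arr 0 L[i] = c := ⟨_, rfl⟩
    have hck : c < τ.reg 2 := hc ▸ hR'.cls_lt ⟨L[i], hLi⟩
    have hkn := hR'.le
    have hsize := hR'.size_le hck
    have hcnt : τ.arr 4 c ≤ I.n := by
      rcases hC'.lt c hck with h | h
      · rw [h]; simpa using Finset.card_le_univ (fiber I.n (τ.arr 0) c ∩ X)
      · omega
    have hiX : (⟨L[i], hLi⟩ : Fin I.n) ∈ X := (hX _).2 (List.getElem_mem _)
    have htake : L.take (i + 1) = L.take i ++ [L[i]] := (List.take_append_getElem hi).symm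
    simp [e7, hx, hc, Expr.cost, Test.cost]
    repeat refine ⟨by omega, ?_⟩
    constructor
    · intro h1
      repeat refine ⟨by omega, ?_⟩
      have hcX : τ.arr 4 c = (fiber I.n (τ.arr 0) c ∩ X).card :=
        (hC'.lt c hck).resolve_right fun h => by omega
      constructor
      · intro h2
        -- If n labels were in use, the split would produce n + 1 disjoint non-empty classes.
        have hlt : τ.reg 2 < I.n := by
          by_contra hge
          obtain ⟨hh, hR2⟩ := hR'.split hck hcX h1 h2
            (cls' := fun s => if τ.arr 0 s = c ∧ s ∈ L then τ.reg 2 else τ.arr 0 s) (by simp [hX])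
          have := hR2.le
          omega
        refine (splitClassProg_spec hF (k := τ.reg 2) (c := c) (by simpa using r0) (by simp)
          (by simp) hck hlt (fun s hs => by simpa using hR'.cls_lt ⟨s, hs⟩) (by simpa using hcnt)
          (by simpa using hsize) (by simpa using hR'.inT_le c)
          (fun s hs => by simp only [Mem.setReg_arr, e6, hm]; split_ifs <;> simp)).frame.mono ?_
        rintro t₁ ρ ⟨hFr', ht₁, h2', h3', h5', h0'⟩
        have r7 : ρ.reg 7 = c := by rw [hFr'.reg 7 (by decide)]; simp
        have e4 : ρ.arr 4 = τ.arr 4 := by rw [hFr'.arr 4 (by decide)]; simp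
        simp only [Mem.setReg_arr] at h3' h5' h0'
        have hcls : ∀ s : Fin I.n, ρ.arr 0 s =
            if τ.arr 0 s = c ∧ s ∈ X then τ.reg 2 else τ.arr 0 s := fun s => by
          rw [h0' s s.2]
          by_cases hs : (s : ℕ) ∈ L <;> simp [e6, hm, hX, hs]
        obtain ⟨hh, hR2⟩ := hR'.split hck hcX h1 h2 hcls
        simp only [r7, e4, h2', h3', h5', Nat.mul_succ]
        repeat refine ⟨by omega, ?_⟩
        refine ⟨fun s hs => ?_, hC'.split hck hR'.cls_lt hcls, _,
          hst'.tail ⟨_, (hR'.parts _).2 ⟨c, hck, rfl⟩, rfl⟩, hR2⟩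
        have hsL : s ∈ L := List.take_subset _ _ hs
        have := hcls ⟨s, hLn s hsL⟩
        simp only [(hX ⟨s, hLn s hsL⟩).2 hsL, and_true] at this
        rw [this]
        split_ifs with hsc
        · rw [Function.update_of_ne (by omega)]
          exact hC'.ge _ le_rfl
        · rw [Function.update_of_ne hsc]
          rw [htake, List.mem_append, List.mem_singleton] at hs
          rcases hs with hs | rfl
          · exact hz s hs
          · exact absurd hc hsc
      · intro h2
        have hh : Homog X (fiber I.n (τ.arr 0) c) := by
          rw [hR'.size_eq c hck, hcX] at h2
          have := Finset.eq_of_subset_of_card_le Finset.inter_subset_left h2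
          exact fun _ _ s hs _ => Finset.mem_of_mem_inter_right (this.symm ▸ hs)
        repeat refine ⟨by omega, ?_⟩
        refine ⟨fun s hs => ?_, hC'.reset hh, st', hst', hR'⟩
        by_cases hsc : τ.arr 0 s = c
        · rw [hsc]; simp
        · rw [Function.update_of_ne hsc]
          rw [htake, List.mem_append, List.mem_singleton] at hs
          rcases hs with hs | rfl
          · exact hz s hs
          · exact absurd hc hsc
    · intro h1
      refine ⟨by omega, fun s hs => ?_, hC', st', hst', hR'⟩
      rw [htake, List.mem_append, List.mem_singleton] at hs
      rcases hs with hs | rfl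
      · exact hz s hs
      · rw [hc, h1]
  · rintro t' τ _ _ ⟨ht, hz, hC', st', hst', hR'⟩
    rw [List.take_length] at hz
    -- A class that meets X contains a listed element, and the counter of its class has been reset;
    -- a class with an untouched exact counter is thus disjoint from X.
    have key : ∀ c < τ.reg 2, τ.arr 4 c = 0 ∧ Homog X (fiber I.n (τ.arr 0) c) := by
      intro c hc
      rcases hC'.lt c hc with h | h
      · by_cases he : fiber I.n (τ.arr 0) c ∩ X = ∅
        · refine ⟨by rw [h, he]; rfl, fun s hs t _ hsX => ?_⟩
          exact absurd (Finset.mem_inter.2 ⟨hs, hsX⟩) (by simp [he])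
        · obtain ⟨s, hs⟩ := Finset.nonempty_iff_ne_empty.2 he
          rw [Finset.mem_inter, mem_fiber, hX] at hs
          have h0 := hz s hs.2
          rw [hs.1, h, Finset.card_eq_zero] at h0
          exact absurd h0 he
      · exact h
    refine ⟨by omega, fun c => ?_, st', ⟨hst', fun C hC => ?_⟩, hR'⟩
    · by_cases hc : c < τ.reg 2
      · exact (key c hc).1
      · exact hC'.ge c (by omega)
    · obtain ⟨c, hc, rfl⟩ := (hR'.parts C).1 hC
      exact (key c hc).2

theorem splitProg_spec (hF : Fits I W) {st : RState (Fin I.n)} (hH : Holds I σ st) {L : List ℕ}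
    (hL : ListAt (σ.arr 7) (σ.reg 5) L) (hnd : L.Nodup) (hLn : ∀ s ∈ L, s < I.n)
    {X : Finset (Fin I.n)} (hX : ∀ s : Fin I.n, s ∈ X ↔ (s : ℕ) ∈ L) :
    Wp I W splitProg σ t fun t' τ => t' + 200 * (I.n * σ.reg 2) ≤
        t + 140 * L.length + 30 + 200 * (I.n * τ.reg 2) ∧
      ∃ st', Refined X st st' ∧ Holds I τ st' := by
  have hlen := length_le_of_nodup hnd hLn
  rw [splitProg, Wp_seq]
  have hcn : ∀ s < I.n, σ.arr 0 s < I.n := fun s hs =>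
    (hH.repr.cls_lt ⟨s, hs⟩).trans_le hH.repr.le
  refine (countProg_spec hF hL hnd hLn hcn hH.count hH.mark).frame.mono ?_
  rintro t₁ σ₁ ⟨hF₁, ht₁, h4₁, h6₁⟩
  have r2₁ : σ₁.reg 2 = σ.reg 2 := hF₁.reg 2 (by decide)
  have r5₁ : σ₁.reg 5 = σ.reg 5 := hF₁.reg 5 (by decide)
  have e0₁ : σ₁.arr 0 = σ.arr 0 := hF₁.arr 0 (by decide)
  have e3₁ : σ₁.arr 3 = σ.arr 3 := hF₁.arr 3 (by decide)
  have e5₁ : σ₁.arr 5 = σ.arr 5 := hF₁.arr 5 (by decide)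
  have e7₁ : σ₁.arr 7 = σ.arr 7 := hF₁.arr 7 (by decide)
  rw [Wp_seq]
  refine (splitAllProg_spec hF (st := st) hX ((hF₁.reg 0 (by decide)).trans hH.reg0)
    (by rw [r2₁, e0₁, e3₁, e5₁]; exact hH.repr) (by rw [r5₁, e7₁]; exact hL) hlen hLn
    ⟨fun c _ => Or.inl ?_, fun c hc => ?_⟩ h6₁).frame.mono ?_
  · rw [h4₁, e0₁]; exact countP_eq_card hnd hLn hX _ _
  · rw [h4₁, List.countP_eq_zero]
    intro s hs
    have := hH.repr.cls_lt ⟨s, hLn s hs⟩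
    simp only [decide_eq_true_eq]
    rw [r2₁] at hc
    simp only at this
    omega
  rintro t₂ σ₂ ⟨hF₂, ht₂, h4₂, st', hst', hR₂⟩
  have r5₂ : σ₂.reg 5 = σ.reg 5 := (hF₂.reg 5 (by decide)).trans r5₁
  have e7₂ : σ₂.arr 7 = σ.arr 7 := (hF₂.arr 7 (by decide)).trans e7₁
  refine (clearProg_spec hF (L := L) (by rw [r5₂, e7₂]; exact hL) hlen hLn fun s hs => ?_).frame.mono
    ?_
  · rw [hF₂.arr 6 (by decide), h6₁, if_neg hs]
  rintro t₃ σ₃ ⟨hF₃, ht₃, h6₃⟩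
  have r2₃ : σ₃.reg 2 = σ₂.reg 2 := hF₃.reg 2 (by decide)
  rw [r2₁] at ht₂
  rw [r2₃]
  refine ⟨by omega, st', hst', ⟨?_, ?_, fun c => ?_, h6₃⟩⟩
  · rw [hF₃.reg 0 (by decide), hF₂.reg 0 (by decide), hF₁.reg 0 (by decide), hH.reg0]
  · rw [r2₃, hF₃.arr 0 (by decide), hF₃.arr 3 (by decide), hF₃.arr 5 (by decide)]
    exact hR₂
  · rw [hF₃.arr 4 (by decide), h4₂]

end SplitProg

/-! ### Idempotent powers and the first phase on the machine -/

section FirstPhase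

variable {I : Input} {W : ℕ} {σ : Mem} {t : ℕ}

/-- The power `s ^ (k + 1)`. -/
def Input.powN (I : Input) (s : ℕ) : ℕ → ℕ
  | 0 => s
  | k + 1 => I.mulN (I.powN s k) s

theorem powN_lt {s k : ℕ} (hs : s < I.n) : I.powN s k < I.n := by
  cases k with
  | zero => exact hs
  | succ k => exact mulN_lt (by omega)

/-- Compute the idempotent power of the element in register `3` in register `4`. -/
def idemPowProg : Prog := .seq (.assign 4 (.reg 3))
  (.loop (.lt (.const 0) (.add (.sub (.prod (.reg 4) (.reg 4)) (.reg 4))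
    (.sub (.reg 4) (.prod (.reg 4) (.reg 4))))) (.assign 4 (.prod (.reg 4) (.reg 3))))

/-- Write the idempotent powers of all elements into array `12`. -/
def idemProg : Prog := forProg 3 0 (.seq idemPowProg (.store 12 (.reg 3) (.reg 4)))

/-- `e` is an idempotent power of `s`. -/
def Input.IsIdem (I : Input) (s e : ℕ) : Prop := I.mulN e e = e ∧ ∃ k, e = I.powN s k

theorem Input.IsIdem.lt {s e : ℕ} (h : I.IsIdem s e) (hs : s < I.n) : e < I.n := by
  obtain ⟨-, k, rfl⟩ := h
  exact powN_lt hs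

/-- With truncated subtraction, the sum of the two differences of e² and e is positive iff e² ≠ e,
so the loop tries successive powers up to the first idempotent one. By `hex` there are fewer than n
multiplications before that, hence O(n²) steps for all elements. -/
theorem idemPowProg_spec (hF : Fits I W) {s : ℕ} (hs : s < I.n) (h3 : σ.reg 3 = s)
    (hex : ∃ k < I.n, I.mulN (I.powN s k) (I.powN s k) = I.powN s k) :
    Wp I W idemPowProg σ t fun t' τ => t' ≤ t + 20 * I.n + 20 ∧ I.IsIdem s (τ.reg 4) := by
  have hW := hF.lt
  obtain ⟨k, hk, hidem⟩ := hex
  simp only [idemPowProg, Wp_seq, Wp_assign, EWp_reg, h3, Expr.cost]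
  refine ⟨by omega, ?_⟩
  refine Wp_loop (fun t' τ => ∃ l ≤ k, τ.reg 4 = I.powN s l ∧ t' ≤ t + 2 + 20 * l)
    (t + 2 + 20 * k) ⟨0, by simp, by simp [Input.powN], by simp⟩ ?_ ?_
  · rintro t' τ ⟨l, hl, -, h⟩; omega
  · rintro t' τ hFr ⟨l, hl, h4, ht⟩
    have h3' : τ.reg 3 = s := by rw [hFr.reg 3 (by decide)]; simp [h3]
    have hb := powN_lt (k := l) hs
    have hb' := mulN_lt (I := I) (s := I.powN s l) (t := I.powN s l) hF.pos
    have hb2 := mulN_lt (I := I) (s := I.powN s l) (t := s) hF.pos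
    simp only [TWp_lt, EWp_const, EWp_add, EWp_sub, EWp_prod, EWp_reg, h4, decide_eq_true_eq,
      decide_eq_false_iff_not, Wp_assign, h3', Test.cost, Expr.cost]
    repeat refine ⟨by omega, ?_⟩
    constructor
    · intro hne
      refine ⟨by omega, by omega, by omega, by omega, ?_⟩
      have hlk : l ≠ k := by rintro rfl; omega
      exact ⟨l + 1, by omega, by simp [Input.powN], by omega⟩
    · intro he
      exact ⟨by omega, by omega, l, rfl⟩

theorem idemProg_spec (hF : Fits I W) (h0 : σ.reg 0 = I.n)
    (hex : ∀ s < I.n, ∃ k < I.n, I.mulN (I.powN s k) (I.powN s k) = I.powN s k) :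
    Wp I W idemProg σ t fun t' τ => t' ≤ t + 60 * (I.n * I.n) + 10 ∧
      ∀ s < I.n, I.IsIdem s (τ.arr 12 s) := by
  have hW := hF.lt
  have hpos := hF.pos
  refine Wp_for (fun i t' τ => t' ≤ t + 4 + (20 * I.n + 40) * i ∧
    ∀ s < i, I.IsIdem s (τ.arr 12 s)) h0
    (by omega) (by decide) (by decide) (by decide) (by simp) ?_ ?_
  · rintro i t' τ hi hFr hx ⟨ht, hJ⟩
    rw [Wp_seq]
    refine (idemPowProg_spec hF hi hx (hex i hi)).frame.mono ?_
    rintro t₁ τ₁ ⟨hF₁, ht₁, h4⟩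
    have hx' : τ₁.reg 3 = i := by rw [hF₁.reg 3 (by decide), hx]
    have e12 : τ₁.arr 12 = τ.arr 12 := hF₁.arr 12 (by decide)
    have := h4.lt hi
    simp [hx', Expr.cost, e12]
    repeat refine ⟨by omega, ?_⟩
    refine ⟨by rw [Nat.mul_succ]; omega, fun s hs => ?_⟩
    by_cases h : s = i
    · subst h; simpa using h4
    · rw [Function.update_of_ne h]; exact hJ s (by omega)
  · rintro t' τ _ _ ⟨ht, hJ⟩
    refine ⟨?_, hJ⟩
    nlinarith

/-- Write a set of elements into array `7`, and split by it. -/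
def buildSplitProg (cond : Test) : Prog := .seq (buildProg cond 7 5) splitProg

/-- Building the set by a scan costs O(n) whatever its size, which is good enough for the 2n
splitters of the first phase but not for the main loop. -/
theorem buildSplitProg_spec (hF : Fits I W) {st : RState (Fin I.n)} (hH : Holds I σ st)
    {cond : Test} {p : ℕ → Prop} [DecidablePred p] {X : Finset (Fin I.n)}
    (hX : ∀ s : Fin I.n, s ∈ X ↔ p s)
    (hcond : ∀ τ, Frame (buildProg cond 7 5) σ τ → τ.reg 4 < I.n →
      TWp I W τ cond fun v => v = decide (p (τ.reg 4))) :
    Wp I W (buildSplitProg cond) σ t fun t' τ => t' + 200 * (I.n * σ.reg 2) ≤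
        t + (cond.cost + 160) * I.n + 40 + 200 * (I.n * τ.reg 2) ∧
      ∃ st', Refined X st st' ∧ Holds I τ st' := by
  rw [buildSplitProg, Wp_seq]
  refine (buildProg_spec hF hH.reg0 (by decide) (by decide) hcond).frame.mono ?_
  rintro t₁ τ ⟨hF₁, ht₁, hL⟩
  have hn4 : ∀ x, x ≠ 4 → x ≠ 5 → x ∉ (buildProg cond 7 5).modR := by
    intro x h4 h5
    simp [buildProg, forProg, Prog.modR, h4, h5]
  have hn7 : ∀ x, x ≠ 7 → x ∉ (buildProg cond 7 5).modA := by
    intro x h7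
    simp [buildProg, forProg, Prog.modA, h7]
  have r2 : τ.reg 2 = σ.reg 2 := hF₁.reg 2 (hn4 2 (by decide) (by decide))
  have hH' : Holds I τ st := by
    refine ⟨?_, ?_, fun c => ?_, fun s => ?_⟩
    · rw [hF₁.reg 0 (hn4 0 (by decide) (by decide)), hH.reg0]
    · rw [r2, hF₁.arr 0 (hn7 0 (by decide)), hF₁.arr 3 (hn7 3 (by decide)),
        hF₁.arr 5 (hn7 5 (by decide))]
      exact hH.repr
    · rw [hF₁.arr 4 (hn7 4 (by decide)), hH.count]
    · rw [hF₁.arr 6 (hn7 6 (by decide)), hH.mark]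
  refine (splitProg_spec hF hH' hL (List.nodup_range.filter _) (fun s hs => ?_) (X := X)
    fun s => ?_).mono ?_
  · simpa using (List.mem_filter.1 hs).1
  · rw [hX, List.mem_filter]
    simp
  · rintro t₂ ρ ⟨ht₂, h⟩
    refine ⟨?_, h⟩
    have : ((List.range I.n).filter p).length ≤ I.n :=
      (List.length_filter_le _ _).trans (by simp)
    rw [r2] at ht₂
    simp only [add_mul] at ht₁ ⊢
    omega

/-- Membership in the maximal set of pairs, in terms of the idempotent powers. -/
def Input.pairN (I : Input) (E : ℕ → ℕ) (s t : ℕ) : Prop := I.accN (I.mulN s (E t)) (E t)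

def rowTest : Test := .eq (.acc (.prod (.reg 3) (.cell 12 (.reg 4))) (.cell 12 (.reg 4))) (.const 1)

def colTest : Test := .eq (.acc (.prod (.reg 4) (.cell 12 (.reg 3))) (.cell 12 (.reg 3))) (.const 1)

/-- The first phase of the algorithm. -/
def firstProg : Prog := .seq (.store 3 (.const 0) (.reg 0)) (.seq (.assign 2 (.const 1))
  (forProg 3 0 (.seq (buildSplitProg rowTest) (buildSplitProg colTest))))

open scoped Classical in
/-- The splitters of the first phase. -/
noncomputable def Input.pairSets (I : Input) (E : ℕ → ℕ) (i : ℕ) : List (Finset (Fin I.n)) :=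
  [Finset.univ.filter fun s => I.pairN E i s, Finset.univ.filter fun s => I.pairN E s i]

theorem firstProg_spec (hF : Fits I W) (h0 : σ.reg 0 = I.n) (ha0 : ∀ s, σ.arr 0 s = 0)
    (ha4 : ∀ s, σ.arr 4 s = 0) (ha5 : ∀ s, σ.arr 5 s = 0) (ha6 : ∀ s, σ.arr 6 s = 0)
    {E : ℕ → ℕ} (hE : σ.arr 12 = E) (hEn : ∀ s < I.n, E s < I.n) :
    Wp I W firstProg σ t fun t' τ => t' ≤ t + 900 * (I.n * I.n) ∧
      ∃ st, Holds I τ st ∧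
        RefinedSeq ((List.range I.n).flatMap (I.pairSets E)) ⟨{Finset.univ}, ∅⟩ st := by
  classical
  have hW := hF.lt
  have hpos := hF.pos
  have hf : fiber I.n (σ.arr 0) 0 = Finset.univ := by ext s; simp [ha0]
  simp only [firstProg, Wp_seq, Wp_assign, Wp_store, EWp_const, EWp_reg, h0, Expr.cost]
  refine ⟨by omega, by omega, by omega, ?_⟩
  refine Wp_for (fun i t' τ => t' + 200 * I.n ≤ t + 8 + (400 * I.n + 100) * i +
      200 * (I.n * τ.reg 2) ∧ ∃ st, Holds I τ st ∧
        RefinedSeq ((List.range i).flatMap (I.pairSets E)) ⟨{Finset.univ}, ∅⟩ st) (N := I.n)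
    (by simpa using h0) (by omega) (by decide) (by decide) (by decide) ?_ ?_ ?_
  · refine ⟨by simp, _, ⟨by simpa using h0, ?_, by simpa using ha4, by simpa using ha6⟩,
      .nil _⟩
    simp only [Mem.setReg_reg, Mem.setReg_arr, Mem.setCell_arr]
    refine ⟨fun s => by simp [ha0], fun c hc => ?_, fun c hc => ?_, fun C => ?_, fun C => ?_,
      fun c _ => by simp [ha5], fun c => by simp [ha5]⟩
    · obtain rfl : c = 0 := by simpa using hc
      exact ⟨⟨0, hpos⟩, by simp [ha0]⟩
    · obtain rfl : c = 0 := by simpa using hc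
      simp [hf]
    · simp [hf]
    · simp [ha5]
  · rintro i t' τ hi hFr hx ⟨ht, st, hH, hseq⟩
    have e12 : τ.arr 12 = E := by rw [hFr.arr 12 (by decide)]; simpa using hE
    rw [Wp_seq]
    have hone : ∀ P : Prop, [Decidable P] → (if P then 1 else 0) < W := fun P _ => by
      split_ifs <;> omega
    refine (buildSplitProg_spec hF hH (p := fun s => I.pairN E i s)
      (X := Finset.univ.filter fun s : Fin I.n => I.pairN E i s) (by simp) ?_).frame.mono ?_
    · intro ρ hFρ h4
      have r3 : ρ.reg 3 = i := by rw [hFρ.reg 3 (by decide), hx]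
      have e12' : ρ.arr 12 = E := by rw [hFρ.arr 12 (by decide), e12]
      have hE4 := hEn _ h4
      have hm := mulN_lt (I := I) (s := i) (t := E (ρ.reg 4)) hpos
      simp only [rowTest, TWp_eq, EWp_acc, EWp_prod, EWp_reg, EWp_cell, EWp_const, r3, e12',
        Input.pairN]
      repeat first | exact hone _ | refine ⟨hone _, ?_⟩ | refine ⟨by omega, ?_⟩
      congr 1
      simp
    rintro t₁ τ₁ ⟨hF₁, ht₁, st₁, hst₁, hH₁⟩
    have hx₁ : τ₁.reg 3 = i := by rw [hF₁.reg 3 (by decide), hx]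
    have e12₁ : τ₁.arr 12 = E := by rw [hF₁.arr 12 (by decide), e12]
    refine (buildSplitProg_spec hF hH₁ (p := fun s => I.pairN E s i)
      (X := Finset.univ.filter fun s : Fin I.n => I.pairN E s i) (by simp) ?_).frame.mono ?_
    · intro ρ hFρ h4
      have r3 : ρ.reg 3 = i := by rw [hFρ.reg 3 (by decide), hx₁]
      have e12' : ρ.arr 12 = E := by rw [hFρ.arr 12 (by decide), e12₁]
      have hE4 := hEn _ hi
      have hm := mulN_lt (I := I) (s := ρ.reg 4) (t := E i) hpos
      simp only [colTest, TWp_eq, EWp_acc, EWp_prod, EWp_reg, EWp_cell, EWp_const, r3, e12',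
        Input.pairN]
      repeat first | exact hone _ | refine ⟨hone _, ?_⟩ | refine ⟨by omega, ?_⟩
      congr 1
      simp
    rintro t₂ τ₂ ⟨hF₂, ht₂, st₂, hst₂, hH₂⟩
    have c1 : rowTest.cost = 9 := rfl
    have c2 : colTest.cost = 9 := rfl
    rw [c1] at ht₁
    rw [c2] at ht₂
    refine ⟨?_, st₂, ⟨by simpa using hH₂.reg0, by simpa using hH₂.repr, by simpa using hH₂.count,
      by simpa using hH₂.mark⟩, ?_⟩
    · simp only [Mem.setReg_reg, Nat.mul_succ]
      simp
      omega
    · rw [List.range_succ, List.flatMap_append]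
      have := (hseq.snoc hst₁).snoc hst₂
      simpa [Input.pairSets] using this
  · rintro t' τ _ _ ⟨ht, st, hH, hseq⟩
    refine ⟨?_, st, hH, hseq⟩
    -- At most n labels are in use, so the credit for labels is quadratic.
    have h1 := Nat.mul_le_mul_left I.n hH.repr.le
    nlinarith

end FirstPhase

/-! ### Letter actions and their preimages as linked lists -/

section Preimages

variable {I : Input} {W : ℕ} {σ : Mem} {t : ℕ}

/-- Multiplication with the image of the letter `b` on the right for `b < m`, and with the image of
`b - m` on the left otherwise. -/
def Input.actN (I : Input) (b s : ℕ) : ℕ :=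
  if b < I.m then I.mulN s (I.genN b) else I.mulN (I.genN (b - I.m)) s

theorem actN_lt {b s : ℕ} (hn : 0 < I.n) : I.actN b s < I.n := by
  unfold Input.actN; split_ifs <;> exact mulN_lt hn

theorem mul_add_inj {n a b s t : ℕ} (hs : s < n) (ht : t < n) :
    a * n + s = b * n + t ↔ a = b ∧ s = t := by
  constructor
  · intro h
    have hn : 0 < n := by omega
    have h1 : (a * n + s) / n = a := by
      rw [add_comm, Nat.add_mul_div_right _ _ hn, Nat.div_eq_of_lt hs, zero_add]
    have h2 : (b * n + t) / n = b := by
      rw [add_comm, Nat.add_mul_div_right _ _ hn, Nat.div_eq_of_lt ht, zero_add]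
    have hab : a = b := by rw [← h1, ← h2, h]
    subst hab
    exact ⟨rfl, by omega⟩
  · rintro ⟨rfl, rfl⟩; rfl

/-- Write the table of the actions of the letters into array `9`. -/
def actProg : Prog := forProg 3 1 (forProg 4 0
  (.seq (.store 9 (.add (.mul (.reg 3) (.reg 0)) (.reg 4)) (.prod (.reg 4) (.gen (.reg 3))))
    (.store 9 (.add (.mul (.add (.reg 1) (.reg 3)) (.reg 0)) (.reg 4))
      (.prod (.gen (.reg 3)) (.reg 4)))))

theorem actProg_spec (hF : Fits I W) (h0 : σ.reg 0 = I.n) (h1 : σ.reg 1 = I.m) :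
    Wp I W actProg σ t fun t' τ => t' ≤ t + 80 * (I.m * I.n) + 20 * I.m + 10 ∧
      ∀ b < 2 * I.m, ∀ s < I.n, τ.arr 9 (b * I.n + s) = I.actN b s := by
  have hW := hF.lt
  have hpos := hF.pos
  refine Wp_for (fun i t' τ => t' ≤ t + 4 + (80 * I.n + 20) * i ∧
    ∀ a s, a < i → s < I.n → τ.arr 9 (a * I.n + s) = I.mulN s (I.genN a) ∧
      τ.arr 9 ((I.m + a) * I.n + s) = I.mulN (I.genN a) s) h1
    (by omega) (by decide) (by decide) (by decide) (by simp) ?_ ?_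
  · rintro i t' τ hi hFr hx ⟨ht, hJ⟩
    have r0 : τ.reg 0 = I.n := by rw [hFr.reg 0 (by decide), h0]
    have r1 : τ.reg 1 = I.m := by rw [hFr.reg 1 (by decide), h1]
    have hgi := genN_lt (I := I) (a := i) hpos
    refine Wp_for (fun j t'' τ => t'' ≤ t' + 8 + 80 * j ∧
      ∀ a s, (a < i ∨ a = i ∧ s < j) → s < I.n →
        τ.arr 9 (a * I.n + s) = I.mulN s (I.genN a) ∧
        τ.arr 9 ((I.m + a) * I.n + s) = I.mulN (I.genN a) s) r0
      (by omega) (by decide) (by decide) (by decide) ?_ ?_ ?_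
    · exact ⟨by omega, fun a s ha hs => hJ a s (by omega) hs⟩
    · rintro j t'' ρ hj hFρ hy ⟨ht'', hJ'⟩
      have r3' : ρ.reg 3 = i := by rw [hFρ.reg 3 (by decide), hx]
      have r0' : ρ.reg 0 = I.n := by rw [hFρ.reg 0 (by decide), r0]
      have r1' : ρ.reg 1 = I.m := by rw [hFρ.reg 1 (by decide), r1]
      have b1 := add_mul_lt hi hj
      have b2 : (I.m + i) * I.n + j < (2 * I.m) * I.n := add_mul_lt (by omega) hj
      rw [Nat.mul_assoc] at b2
      have m1 := mulN_lt (I := I) (s := j) (t := I.genN i) hpos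
      have m2 := mulN_lt (I := I) (s := I.genN i) (t := j) hpos
      simp [r3', r0', r1', hy, Expr.cost]
      repeat refine And.intro (by omega) ?_
      intro a s ha hs
      -- Rows of right actions have numbers below m, so the store into row m + i does not touch
      -- them.
      have hne : a * I.n + s ≠ (I.m + i) * I.n + j := fun h => by
        have := ((mul_add_inj hs hj).1 h).1; omega
      have hne' : (I.m + a) * I.n + s = (I.m + i) * I.n + j ↔ a = i ∧ s = j := by
        rw [mul_add_inj hs hj]; omega
      by_cases hij : a = i ∧ s = j
      · obtain ⟨rfl, rfl⟩ := hij
        rw [Function.update_of_ne hne]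
        simp
      · obtain ⟨e1, e2⟩ := hJ' a s (by omega) hs
        rw [Function.update_of_ne hne, Function.update_of_ne (by rwa [Ne, mul_add_inj hs hj]),
          Function.update_of_ne (by rwa [Ne, hne']), Function.update_of_ne ?_]
        · exact ⟨e1, e2⟩
        · intro h
          have := ((mul_add_inj hs hj).1 h).1; omega
    · rintro t'' ρ hFρ hy ⟨ht'', hJ'⟩
      refine ⟨by rw [Nat.mul_succ]; omega, fun a s ha hs => ?_⟩
      exact hJ' a s (by omega) hs
  · rintro t' τ _ _ ⟨ht, hJ⟩
    refine ⟨by nlinarith, fun b hb s hs => ?_⟩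
    unfold Input.actN
    split_ifs with h
    · exact (hJ b s h hs).1
    · obtain ⟨a, rfl⟩ := Nat.exists_eq_add_of_le (not_lt.1 h)
      rw [(hJ a s (by omega) hs).2, Nat.add_sub_cancel_left]

/-- The linked list that starts with the pointer `p` has the members `l`; the pointer to `s` is
`s + 1`. -/
def Chain (nxt : ℕ → ℕ) : ℕ → List ℕ → Prop
  | p, [] => p = 0
  | p, s :: l => p = s + 1 ∧ Chain nxt (nxt s) l

theorem Chain.congr {nxt nxt' : ℕ → ℕ} {l : List ℕ} : ∀ {p : ℕ}, (∀ s ∈ l, nxt' s = nxt s) →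
    Chain nxt p l → Chain nxt' p l := by
  induction l with
  | nil => exact fun _ h => h
  | cons s l ih =>
    intro p hs h
    refine ⟨h.1, ?_⟩
    rw [hs s List.mem_cons_self]
    exact ih (fun s hs' => hs s (List.mem_cons_of_mem _ hs')) h.2

/-- The elements below `j` that are mapped to `x`. -/
def Input.pre (I : Input) (b j x : ℕ) : List ℕ :=
  (List.range j).reverse.filter fun s => I.actN b s = x

theorem mem_pre {b j x s : ℕ} : s ∈ I.pre b j x ↔ s < j ∧ I.actN b s = x := by
  simp [Input.pre]

theorem pre_succ (b j x : ℕ) : I.pre b (j + 1) x =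
    if I.actN b j = x then j :: I.pre b j x else I.pre b j x := by
  simp [Input.pre, List.range_succ, List.filter_cons]

theorem nodup_pre (b j x : ℕ) : (I.pre b j x).Nodup :=
  (List.nodup_reverse.2 List.nodup_range).filter _

/-- Write linked lists of the preimages of all elements into the arrays `10` and `11`. -/
def chainProg : Prog := .seq (.assign 15 (.add (.reg 1) (.reg 1))) (forProg 3 15 (forProg 4 0
  (.seq (.assign 8 (.add (.mul (.reg 3) (.reg 0))
    (.cell 9 (.add (.mul (.reg 3) (.reg 0)) (.reg 4)))))
  (.seq (.store 11 (.add (.mul (.reg 3) (.reg 0)) (.reg 4)) (.cell 10 (.reg 8)))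
    (.store 10 (.reg 8) (.add (.reg 4) (.const 1)))))))

/-- The arrays hold the linked lists of the preimages among the first `f b` elements. -/
def Chains (I : Input) (σ : Mem) (f : ℕ → ℕ) : Prop := ∀ b < 2 * I.m, ∀ x < I.n,
  Chain (fun s => σ.arr 11 (b * I.n + s)) (σ.arr 10 (b * I.n + x)) (I.pre b (f b) x)

theorem Chain.head_le {nxt : ℕ → ℕ} {p n : ℕ} {l : List ℕ} (h : Chain nxt p l)
    (hl : ∀ s ∈ l, s < n) : p ≤ n := by
  cases l with
  | nil => have : p = 0 := h; omega
  | cons s l => have := hl s List.mem_cons_self; have := h.1; omega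

/-- Elements are inserted at the head in increasing order, so the list of x is literally `pre b j
x`, in decreasing order. -/
theorem chainProg_spec (hF : Fits I W) (h0 : σ.reg 0 = I.n) (h1 : σ.reg 1 = I.m)
    (h9 : ∀ b < 2 * I.m, ∀ s < I.n, σ.arr 9 (b * I.n + s) = I.actN b s)
    (h10 : ∀ j, σ.arr 10 j = 0) :
    Wp I W chainProg σ t fun t' τ => t' ≤ t + 160 * (I.m * I.n) + 40 * I.m + 20 ∧
      τ.reg 15 = 2 * I.m ∧ Chains I τ fun _ => I.n := by
  have hW := hF.lt
  have hpos := hF.pos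
  simp only [chainProg, Wp_seq (q := forProg _ _ _), Wp_assign, EWp_add, EWp_reg, h1, Expr.cost]
  refine ⟨by omega, by omega, by omega, ?_⟩
  refine Wp_for (fun i t' τ => t' ≤ t + 10 + (80 * I.n + 20) * i ∧
    Chains I τ fun b => if b < i then I.n else 0) (N := 2 * I.m) (by simp; omega)
    (by omega) (by decide) (by decide) (by decide) ?_ ?_ ?_
  · exact ⟨by omega, fun b _ x _ => h10 _⟩
  · rintro i t' τ hi hFr hx ⟨ht, hJ⟩
    have r0 : τ.reg 0 = I.n := by rw [hFr.reg 0 (by decide)]; simpa using h0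
    have e9 : τ.arr 9 = σ.arr 9 := by rw [hFr.arr 9 (by decide)]; simp
    refine Wp_for (fun j t'' τ => t'' ≤ t' + 8 + 80 * j ∧
      Chains I τ fun b => if b < i then I.n else if b = i then j else 0) r0
      (by omega) (by decide) (by decide) (by decide) ?_ ?_ ?_
    · refine ⟨by omega, fun b hb x hx => ?_⟩
      have := hJ b hb x hx
      by_cases hbi : b < i
      · simpa [hbi] using this
      · simpa [hbi] using this
    · rintro j t'' ρ hj hFρ hy ⟨ht'', hJ'⟩
      have r3' : ρ.reg 3 = i := by rw [hFρ.reg 3 (by decide), hx]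
      have r0' : ρ.reg 0 = I.n := by rw [hFρ.reg 0 (by decide), r0]
      have e9' : ρ.arr 9 (i * I.n + j) = I.actN i j := by
        rw [hFρ.arr 9 (by decide), e9, h9 i hi j hj]
      have ha := actN_lt (I := I) (b := i) (s := j) hpos
      have b1 := add_mul_lt hi hj
      have b2 := add_mul_lt hi ha
      rw [Nat.mul_assoc] at b1 b2
      have hch := hJ' i hi _ ha
      have hb3 := hch.head_le (n := I.n) fun s hs => by
        have := (mem_pre.1 hs).1
        simp only [lt_irrefl, if_true, if_false] at this
        omega
      simp [r3', r0', hy, e9', Expr.cost]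
      repeat refine And.intro (by omega) ?_
      intro b hb x hx'
      have hold := hJ' b hb x hx'
      simp only [Mem.setReg_arr, Mem.setCell_arr, if_true]
      -- The only successor cell that changes is that of j in row i, and j is in no list of that row
      -- yet; so the old lists survive.
      have e11 : ∀ s < I.n, ¬ (b = i ∧ s = j) →
          Function.update (ρ.arr 11) (i * I.n + j) (ρ.arr 10 (i * I.n + I.actN i j))
            (b * I.n + s) = ρ.arr 11 (b * I.n + s) := fun s hs hne => by
        rw [Function.update_of_ne]
        rwa [Ne, mul_add_inj hs hj]
      have hlt : ∀ s ∈ I.pre b (if b < i then I.n else if b = i then j else 0) x,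
          s < I.n ∧ ¬ (b = i ∧ s = j) := by
        intro s hs
        have := (mem_pre.1 hs).1
        split_ifs at this <;> omega
      have hold' := hold.congr (nxt' := fun s => Function.update (ρ.arr 11) (i * I.n + j)
        (ρ.arr 10 (i * I.n + I.actN i j)) (b * I.n + s))
        fun s hs => e11 s (hlt s hs).1 (hlt s hs).2
      by_cases hbx : b = i ∧ x = I.actN i j
      · obtain ⟨rfl, rfl⟩ := hbx
        simp only [lt_irrefl, if_false, if_true, Function.update_self, pre_succ] at hold' ⊢
        refine ⟨rfl, ?_⟩
        simpa using hold'
      · have hne : b * I.n + x ≠ i * I.n + I.actN i j := by rwa [Ne, mul_add_inj hx' ha]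
        by_cases hbi : b = i
        · subst hbi
          have : ¬ I.actN b j = x := fun h => hbx ⟨rfl, h.symm⟩
          have hx2 : ¬ x = I.actN b j := fun h => this h.symm
          simpa [hx2, pre_succ, this] using hold'
        · simpa [hne, hbi] using hold'
    · rintro t'' ρ hFρ hy ⟨ht'', hJ'⟩
      refine ⟨by rw [Nat.mul_succ]; omega, fun b hb x hx' => ?_⟩
      have := hJ' b hb x hx'
      simp only [Mem.setReg_arr]
      have he : (if b < i + 1 then I.n else 0) = if b < i then I.n else if b = i then I.n else 0 := by
        split_ifs <;> omega
      rwa [he]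
  · rintro t' τ hFr hx ⟨ht, hJ⟩
    refine ⟨by nlinarith, by rw [hFr.reg 15 (by decide)]; simp; omega, fun b hb x hx' => ?_⟩
    have := hJ b hb x hx'
    simpa [hb] using this

/-- Append the linked list in register `14` to array `7`. -/
def walkProg : Prog := .loop (.lt (.const 0) (.reg 14))
  (.seq (.store 7 (.reg 5) (.sub (.reg 14) (.const 1)))
  (.seq (.assign 5 (.add (.reg 5) (.const 1)))
  (.assign 14 (.cell 11 (.add (.mul (.reg 12) (.reg 0)) (.sub (.reg 14) (.const 1)))))))

/-- Write the preimage, under the letter in register `12`, of the set in array `8` into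
array `7`. -/
def preimProg : Prog := .seq (.assign 5 (.const 0)) (forProg 13 10
  (.seq (.assign 14 (.cell 10 (.add (.mul (.reg 12) (.reg 0)) (.cell 8 (.reg 13))))) walkProg))

theorem walkProg_spec (hF : Fits I W) (h0 : σ.reg 0 = I.n) {b : ℕ} (hb : b < 2 * I.m)
    (h12 : σ.reg 12 = b) {l L : List ℕ} (hl : ∀ s ∈ l, s < I.n) (hlen : L.length + l.length ≤ I.n)
    (hc : Chain (fun s => σ.arr 11 (b * I.n + s)) (σ.reg 14) l)
    (hL : ListAt (σ.arr 7) (σ.reg 5) L) :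
    Wp I W walkProg σ t fun t' τ => t' ≤ t + 30 * l.length + 10 ∧
      ListAt (τ.arr 7) (τ.reg 5) (L ++ l) := by
  have hW := hF.lt
  have hpos := hF.pos
  -- l₁ has been copied, and the pointer is at the head of l₂.
  refine Wp_loop (fun t' τ => ∃ l₁ l₂, l = l₁ ++ l₂ ∧ t' ≤ t + 30 * l₁.length ∧
    Chain (fun s => σ.arr 11 (b * I.n + s)) (τ.reg 14) l₂ ∧
    ListAt (τ.arr 7) (τ.reg 5) (L ++ l₁)) (t + 30 * l.length)
    ⟨[], l, rfl, by simp, hc, by simpa using hL⟩ ?_ ?_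
  · rintro t' τ ⟨l₁, l₂, rfl, h, -⟩
    rw [List.length_append]; omega
  · rintro t' τ hFr ⟨l₁, l₂, rfl, ht, hc', hL'⟩
    have r12 : τ.reg 12 = b := by rw [hFr.reg 12 (by decide), h12]
    have r0 : τ.reg 0 = I.n := by rw [hFr.reg 0 (by decide), h0]
    have e11 : τ.arr 11 = σ.arr 11 := hFr.arr 11 (by decide)
    have hhead := hc'.head_le (n := I.n) fun s hs => hl s (List.mem_append_right _ hs)
    have hlen' := hL'.len_eq
    simp only [List.length_append] at hlen hlen' ⊢
    simp only [TWp_lt, EWp_const, EWp_reg, decide_eq_true_eq, decide_eq_false_iff_not, Test.cost,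
      Expr.cost]
    refine ⟨by omega, by omega, fun hpos' => ?_, fun hz => ⟨by omega, ?_⟩⟩
    · cases l₂ with
      | nil => have : τ.reg 14 = 0 := hc'; omega
      | cons s l₂ =>
        obtain ⟨hs, hc2⟩ := hc'
        have hsn : s < I.n := hl s (by simp)
        have b1 := add_mul_lt hb hsn
        rw [Nat.mul_assoc] at b1
        have hhead' := hc2.head_le (n := I.n) fun s hs =>
          hl s (List.mem_append_right _ (List.mem_cons_of_mem _ hs))
        simp only at hhead'
        simp only [List.length_cons] at hlen
        simp [hs, r12, r0, e11, Expr.cost]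
        repeat refine And.intro (by omega) ?_
        refine ⟨l₁ ++ [s], l₂, by simp, by simp; omega, hc2, ?_⟩
        rw [← List.append_assoc]
        exact hL'.snoc s
    · cases l₂ with
      | nil => simpa using hL'
      | cons s l₂ => have := hc'.1; omega

/-- Preimages of distinct elements are disjoint; hence the concatenation is a valid splitter list
and has length at most n. -/
theorem nodup_flatMap_pre {M : List ℕ} (hM : M.Nodup) (b : ℕ) :
    (M.flatMap (I.pre b I.n)).Nodup := by
  rw [List.nodup_flatMap]
  refine ⟨fun x _ => nodup_pre b I.n x, hM.imp fun {x y} hxy => ?_⟩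
  intro s hs hs'
  exact hxy ((mem_pre.1 hs).2.symm.trans (mem_pre.1 hs').2)

/-- The linked lists serve this bound: the time is proportional to the size of the set plus that of
its preimage, independent of n. -/
theorem preimProg_spec (hF : Fits I W) (h0 : σ.reg 0 = I.n) {b : ℕ} (hb : b < 2 * I.m)
    (h12 : σ.reg 12 = b) {M : List ℕ} (hM : ListAt (σ.arr 8) (σ.reg 10) M) (hnd : M.Nodup)
    (hMn : ∀ x ∈ M, x < I.n) (hch : Chains I σ fun _ => I.n) :
    Wp I W preimProg σ t fun t' τ =>
      t' ≤ t + 60 * M.length + 30 * (M.flatMap (I.pre b I.n)).length + 20 ∧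
      ListAt (τ.arr 7) (τ.reg 5) (M.flatMap (I.pre b I.n)) := by
  have hW := hF.lt
  have hpos := hF.pos
  have hMl := length_le_of_nodup hnd hMn
  have hpl : (M.flatMap (I.pre b I.n)).length ≤ I.n :=
    length_le_of_nodup (nodup_flatMap_pre hnd b) fun s hs => by
      obtain ⟨x, -, hs⟩ := List.mem_flatMap.1 hs
      exact (mem_pre.1 hs).1
  have hb1 : b < W := by omega
  simp only [preimProg, Wp_seq (q := forProg _ _ _), Wp_assign, EWp_const, Expr.cost]
  refine ⟨by omega, ?_⟩
  refine Wp_for (fun i t' τ => t' ≤ t + 6 + 60 * i +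
      30 * ((M.take i).flatMap (I.pre b I.n)).length ∧
    ListAt (τ.arr 7) (τ.reg 5) ((M.take i).flatMap (I.pre b I.n))) (N := M.length)
    (by simpa using hM.len_eq) (by omega) (by decide) (by decide) (by decide) ?_ ?_ ?_
  · exact ⟨by simp, by simpa using ListAt.nil _⟩
  · rintro i t' τ hi hFr hx ⟨ht, hL⟩
    have r0 : τ.reg 0 = I.n := by rw [hFr.reg 0 (by decide)]; simpa using h0
    have r12 : τ.reg 12 = b := by rw [hFr.reg 12 (by decide)]; simpa using h12
    have e8 : τ.arr 8 i = M[i] := by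
      rw [hFr.arr 8 (by decide)]; exact hM.get i hi
    have e10 : τ.arr 10 = σ.arr 10 := by rw [hFr.arr 10 (by decide)]; simp
    have e11 : τ.arr 11 = σ.arr 11 := by rw [hFr.arr 11 (by decide)]; simp
    have hMi := hMn M[i] (List.getElem_mem _)
    have htake : (M.take (i + 1)).flatMap (I.pre b I.n) =
        (M.take i).flatMap (I.pre b I.n) ++ I.pre b I.n M[i] := by
      rw [← List.take_append_getElem hi, List.flatMap_append]; simp
    have hsub : ((M.take i).flatMap (I.pre b I.n)).length + (I.pre b I.n M[i]).length ≤ I.n := by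
      rw [← List.length_append, ← htake]
      refine le_trans ?_ hpl
      conv_rhs => rw [← List.take_append_drop (i + 1) M]
      rw [List.flatMap_append, List.length_append]
      omega
    have hc := hch b hb _ hMi
    have hhead := hc.head_le (n := I.n) fun s hs => (mem_pre.1 hs).1
    have b1 := add_mul_lt hb hMi
    rw [Nat.mul_assoc] at b1
    simp only [Wp_seq, Wp_assign, EWp_cell, EWp_add, EWp_mul, EWp_reg, r0, r12, hx, e8, e10,
      Expr.cost]
    refine ⟨by omega, by omega, by omega, by omega, by omega, by omega, by omega, ?_⟩
    refine (walkProg_spec hF (by simpa using r0) hb (by simpa using r12)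
      (fun s hs => (mem_pre.1 hs).1) hsub (by simpa [e11] using hc) (by simpa using hL)).mono ?_
    rintro t₁ ρ ⟨ht₁, hL₁⟩
    rw [htake]
    refine ⟨?_, by simpa using hL₁⟩
    rw [List.length_append]
    omega
  · rintro t' τ _ _ ⟨ht, hL⟩
    rw [List.take_length] at ht hL
    exact ⟨by omega, hL⟩

end Preimages

/-! ### One iteration of the main loop on the machine -/

section MainLoop

variable {I : Input} {W : ℕ} {σ : Mem} {t : ℕ}

/-- Add all classes to the work set. -/
def setWorkProg : Prog := forProg 3 2 (.store 5 (.reg 3) (.const 1))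

/-- Unlike in the algorithm, S is not excluded from the work set. This matters only if S is the
single class, and then it causes one iteration without splits. -/
theorem setWorkProg_spec (hF : Fits I W) {st : RState (Fin I.n)} (hH : Holds I σ st) :
    Wp I W setWorkProg σ t fun t' τ => t' ≤ t + 20 * I.n + 10 ∧
      τ.reg 2 = σ.reg 2 ∧ Holds I τ ⟨st.parts, st.parts⟩ := by
  have hW := hF.lt
  have hk := hH.repr.le
  refine Wp_for (fun i t' τ => t' ≤ t + 4 + 20 * i ∧ (∀ c < i, τ.arr 5 c = 1) ∧
    ∀ c, i ≤ c → τ.arr 5 c = σ.arr 5 c) rfl (by omega) (by decide) (by decide) (by decide)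
    (by simp) ?_ ?_
  · rintro i t' τ hi hFr hx ⟨ht, h1, h2⟩
    simp [hx, Expr.cost]
    repeat refine And.intro (by omega) ?_
    refine ⟨fun c hc => ?_, fun c hc => ?_⟩
    · by_cases h : c = i
      · simp [h]
      · rw [Function.update_of_ne h]; exact h1 c (by omega)
    · rw [Function.update_of_ne (by omega)]; exact h2 c (by omega)
  · rintro t' τ hFr hx ⟨ht, h1, h2⟩
    have r2 : τ.reg 2 = σ.reg 2 := hFr.reg 2 (by decide)
    have hR := hH.repr
    refine ⟨by omega, r2, ⟨(hFr.reg 0 (by decide)).trans hH.reg0, ?_, fun c => ?_, fun s => ?_⟩⟩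
    · rw [r2, hFr.arr 0 (by decide), hFr.arr 3 (by decide)]
      refine ⟨hR.cls_lt, hR.nonempty, hR.size_eq, hR.parts, fun C => ?_, fun c hc => ?_,
        fun c => ?_⟩
      · rw [hR.parts]
        refine exists_congr fun c => and_congr_right fun hc => ?_
        simp [h1 c hc]
      · rw [h2 c hc, hR.inT_eq c hc]
      · by_cases hc : c < σ.reg 2
        · rw [h1 c hc]
        · rw [h2 c (by omega)]; exact hR.inT_le c
    · rw [hFr.arr 4 (by decide), hH.count]
    · rw [hFr.arr 6 (by decide), hH.mark]

theorem Repr.mem_work {n k : ℕ} {cls size inT : ℕ → ℕ} {st : RState (Fin n)}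
    (h : Repr n k cls size inT st) {c : ℕ} (hc : c < k) :
    fiber n cls c ∈ st.work ↔ inT c ≠ 0 := by
  rw [h.work]
  constructor
  · rintro ⟨d, _, h1, he⟩
    rwa [h.fiber_injective hc he]
  · exact fun h1 => ⟨c, hc, h1, rfl⟩

theorem Repr.pop {n k : ℕ} {cls size inT : ℕ → ℕ} {st : RState (Fin n)}
    (h : Repr n k cls size inT st) {c : ℕ} (hc : c < k) :
    Repr n k cls size (Function.update inT c 0) (st.pop (fiber n cls c)) := by
  refine ⟨h.cls_lt, h.nonempty, h.size_eq, h.parts, fun D => ?_, fun d hd => ?_, fun d => ?_⟩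
  · simp only [RState.pop, Finset.mem_erase, h.work]
    constructor
    · rintro ⟨hne, d, hd, h0, rfl⟩
      have hdc : d ≠ c := fun e => hne (by rw [e])
      exact ⟨d, hd, by rwa [Function.update_of_ne hdc], rfl⟩
    · rintro ⟨d, hd, h0, rfl⟩
      have hdc : d ≠ c := by rintro rfl; simp at h0
      rw [Function.update_of_ne hdc] at h0
      exact ⟨fun e => hdc (h.fiber_injective hd e), d, hd, h0, rfl⟩
  · rw [Function.update_of_ne (by omega)]; exact h.inT_eq d hd
  · by_cases hdc : d = c
    · simp [hdc]
    · rw [Function.update_of_ne hdc]; exact h.inT_le d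

/-- The action of the letters on the elements of the semigroup. -/
def Input.act (I : Input) (hn : 0 < I.n) (b : Fin (2 * I.m)) (s : Fin I.n) : Fin I.n :=
  ⟨I.actN b s, actN_lt hn⟩

open scoped Classical in
/-- The preimage of `C` under the action of a letter. -/
noncomputable def Input.actPre (I : Input) (C : Finset (Fin I.n)) (b : ℕ) : Finset (Fin I.n) :=
  Finset.univ.filter fun s => ∃ x ∈ C, I.actN b s = x

theorem mem_actPre {C : Finset (Fin I.n)} (hn : 0 < I.n) {b : Fin (2 * I.m)} {s : Fin I.n} :
    s ∈ I.actPre C b ↔ I.act hn b s ∈ C := by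
  simp only [Input.actPre, Finset.mem_filter, Finset.mem_univ, true_and, Input.act]
  constructor
  · rintro ⟨x, hx, he⟩
    have : (⟨I.actN b s, actN_lt hn⟩ : Fin I.n) = x := Fin.ext he
    rwa [this]
  · exact fun h => ⟨_, h, rfl⟩

theorem length_eq_card {n : ℕ} {L : List ℕ} (hnd : L.Nodup) (hLn : ∀ s ∈ L, s < n)
    {X : Finset (Fin n)} (hX : ∀ s : Fin n, s ∈ X ↔ (s : ℕ) ∈ L) : L.length = X.card := by
  simpa [fiber] using countP_eq_card hnd hLn hX (fun _ => 0) 0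

/-- Refine the partition by the preimages of the class in register `11`. -/
def iterProg : Prog := .seq (.store 5 (.reg 11) (.const 0))
  (.seq (buildProg (.eq (.cell 0 (.reg 4)) (.reg 11)) 8 10)
  (.seq (forProg 12 15 (.seq preimProg splitProg)) (.assign 11 (.const 0))))

/-- The members of C are copied before any split, since C may be cut while its preimages are
processed. The scan for the copy gives the 24 n; the rest is covered by the weight of C and by the
new labels. -/
theorem iterProg_spec (hF : Fits I W) {st : RState (Fin I.n)} (hH : Holds I σ st) {c : ℕ}
    (h11 : σ.reg 11 = c) (hc : c < σ.reg 2) (h15 : σ.reg 15 = 2 * I.m)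
    (hch : Chains I σ fun _ => I.n) :
    Wp I W iterProg σ t fun t' τ => t' + 200 * (I.n * σ.reg 2) ≤
        t + 200 * ∑ x ∈ fiber I.n (σ.arr 0) c, wt (I.act hF.pos) x + 24 * I.n + 30 +
          200 * (I.n * τ.reg 2) ∧ τ.reg 11 = 0 ∧
      ∃ st', RefinedSeq ((List.range (2 * I.m)).map (I.actPre (fiber I.n (σ.arr 0) c)))
          (st.pop (fiber I.n (σ.arr 0) c)) st' ∧ Holds I τ st' := by
  have hW := hF.lt
  have hpos := hF.pos
  have hR := hH.repr
  have hk := hR.le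
  set C := fiber I.n (σ.arr 0) c with hC
  simp only [iterProg, Wp_seq (p := .store _ _ _), Wp_store, EWp_reg, EWp_const, h11, Expr.cost]
  repeat refine And.intro (by omega) ?_
  rw [Wp_seq]
  refine (buildProg_spec hF (p := fun s => σ.arr 0 s = c) (by simpa using hH.reg0) (by decide)
    (by decide) ?_).frame.mono ?_
  · intro τ hFr h4
    have e0 : τ.arr 0 = σ.arr 0 := by rw [hFr.arr 0 (by decide)]; simp
    have r11 : τ.reg 11 = c := by rw [hFr.reg 11 (by decide)]; simpa using h11
    have := hR.cls_lt ⟨_, h4⟩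
    simp only at this
    simp [e0, r11]
    omega
  rintro t₁ σ₁ ⟨hF₁, ht₁, hL⟩
  set M := (List.range I.n).filter fun s => σ.arr 0 s = c with hM
  have hMnd : M.Nodup := List.nodup_range.filter _
  have hMmem : ∀ s, s ∈ M ↔ s < I.n ∧ σ.arr 0 s = c := by simp [hM]
  have hMn : ∀ s ∈ M, s < I.n := fun s hs => ((hMmem s).1 hs).1
  have hMC : M.length = C.card :=
    length_eq_card hMnd hMn fun s => by simp [hMmem, hC]
  have hCpos : 0 < C.card := Finset.card_pos.2 (hR.nonempty c hc)
  have hH₁ : Holds I σ₁ (st.pop C) := by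
    refine ⟨?_, ?_, fun d => ?_, fun s => ?_⟩
    · rw [hF₁.reg 0 (by decide)]; exact hH.reg0
    · rw [hF₁.reg 2 (by decide), hF₁.arr 0 (by decide), hF₁.arr 3 (by decide),
        hF₁.arr 5 (by decide)]
      simpa using hR.pop hc
    · rw [hF₁.arr 4 (by decide)]; simpa using hH.count d
    · rw [hF₁.arr 6 (by decide)]; simpa using hH.mark s
  have r2₁ : σ₁.reg 2 = σ.reg 2 := by rw [hF₁.reg 2 (by decide)]; simp
  have r15₁ : σ₁.reg 15 = 2 * I.m := by rw [hF₁.reg 15 (by decide)]; simpa using h15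
  have hch₁ : Chains I σ₁ fun _ => I.n := by
    intro b hb x hx
    rw [hF₁.arr 10 (by decide), hF₁.arr 11 (by decide)]
    simpa using hch b hb x hx
  have hlen : ∀ b, (M.flatMap (I.pre b I.n)).length = (I.actPre C b).card := fun b => by
    refine length_eq_card (nodup_flatMap_pre hMnd b) ?_ fun s => ?_
    · intro s hs
      obtain ⟨x, -, hx⟩ := List.mem_flatMap.1 hs
      exact (mem_pre.1 hx).1
    · simp only [Input.actPre, Finset.mem_filter, Finset.mem_univ, true_and, List.mem_flatMap,
        mem_pre, hMmem, hC, mem_fiber]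
      constructor
      · rintro ⟨x, hx, he⟩
        exact ⟨x, ⟨x.2, hx⟩, s.2, he⟩
      · rintro ⟨x, ⟨hxn, hx⟩, -, he⟩
        exact ⟨⟨x, hxn⟩, hx, he⟩
  have hsum : ∑ x ∈ C, wt (I.act hpos) x =
      C.card + ∑ b ∈ Finset.range (2 * I.m), (2 * C.card + (I.actPre C b).card) := by
    -- The weight is rewritten as a sum over the machine's 2m actions, to be matched with the loop
    -- over them.
    rw [sum_wt, Finset.sum_range]
    congr 1
    refine Finset.sum_congr rfl fun b _ => ?_
    congr 2
    ext s
    simp [mem_actPre hpos]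
  rw [Wp_seq]
  refine Wp_for (fun i t' τ => t' + 200 * (I.n * σ.reg 2) ≤ t₁ + 2 +
      200 * ∑ b ∈ Finset.range i, (2 * C.card + (I.actPre C b).card) + 200 * (I.n * τ.reg 2) ∧
      ∃ st', RefinedSeq ((List.range i).map (I.actPre C)) (st.pop C) st' ∧ Holds I τ st')
    r15₁ (by omega) (by decide) (by decide) (by decide) ?_ ?_ ?_
  · refine ⟨by simp [r2₁], _, .nil _, ?_⟩
    exact ⟨by simpa using hH₁.reg0, by simpa using hH₁.repr, hH₁.count, hH₁.mark⟩
  · rintro i t' τ hi hFr hx ⟨ht, st', hseq, hH'⟩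
    rw [Wp_seq]
    refine (preimProg_spec hF hH'.reg0 hi hx (M := M) ?_ hMnd hMn ?_).frame.mono ?_
    · rw [hFr.arr 8 (by decide), hFr.reg 10 (by decide)]; exact hL
    · intro b hb x hx
      rw [hFr.arr 10 (by decide), hFr.arr 11 (by decide)]
      exact hch₁ b hb x hx
    rintro t₂ σ₂ ⟨hF₂, ht₂, hL₂⟩
    have hH₂ : Holds I σ₂ st' := by
      refine ⟨?_, ?_, fun d => ?_, fun s => ?_⟩
      · rw [hF₂.reg 0 (by decide)]; exact hH'.reg0
      · rw [hF₂.reg 2 (by decide), hF₂.arr 0 (by decide), hF₂.arr 3 (by decide),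
          hF₂.arr 5 (by decide)]
        exact hH'.repr
      · rw [hF₂.arr 4 (by decide)]; exact hH'.count d
      · rw [hF₂.arr 6 (by decide)]; exact hH'.mark s
    refine (splitProg_spec hF hH₂ hL₂ (nodup_flatMap_pre hMnd i) ?_
      (X := I.actPre C i) ?_).mono ?_
    · intro s hs
      obtain ⟨x, -, hx⟩ := List.mem_flatMap.1 hs
      exact (mem_pre.1 hx).1
    · intro s
      simp only [Input.actPre, Finset.mem_filter, Finset.mem_univ, true_and, List.mem_flatMap,
        mem_pre, hMmem, hC, mem_fiber]
      constructor
      · rintro ⟨x, hx, he⟩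
        exact ⟨x, ⟨x.2, hx⟩, s.2, he⟩
      · rintro ⟨x, ⟨hxn, hx⟩, -, he⟩
        exact ⟨⟨x, hxn⟩, hx, he⟩
    · rintro t₃ σ₃ ⟨ht₃, st'', hst'', hH₃⟩
      rw [hlen] at ht₂ ht₃
      rw [hMC] at ht₂
      have r2₂ : σ₂.reg 2 = τ.reg 2 := hF₂.reg 2 (by decide)
      rw [r2₂] at ht₃
      refine ⟨?_, st'', ?_, ⟨by simpa using hH₃.reg0, by simpa using hH₃.repr, hH₃.count,
        hH₃.mark⟩⟩
      · rw [Finset.sum_range_succ]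
        simp
        omega
      · rw [List.range_succ, List.map_append]
        exact hseq.snoc hst''
  · rintro t' τ hFr hx ⟨ht, st', hseq, hH'⟩
    rw [Wp_assign, EWp_const]
    refine ⟨by omega, ?_, by simp, st', hseq, ⟨by simpa using hH'.reg0, by simpa using hH'.repr,
      hH'.count, hH'.mark⟩⟩
    rw [hsum]
    simp [Expr.cost, Test.cost] at ht₁ ⊢
    omega

end MainLoop

/-! ### The complete main loop and the output tables -/

section Output

variable {I : Input} {W : ℕ} {σ : Mem} {t : ℕ}

/-- The main loop. Register `11` scans the classes for a member of the work set. -/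
def mainProg : Prog := .seq (.assign 11 (.const 0)) (.loop (.lt (.reg 11) (.reg 2))
  (.ite (.eq (.cell 5 (.reg 11)) (.const 0)) (.assign 11 (.add (.reg 11) (.const 1))) iterProg))

/-- The invariant combines three credits. The potential pays for the splitters; n times the size of
the work set pays for the O(n) overhead of each iteration, including the new scan from label 0; n
times the number of labels pays both for a split and for the member it may add to the work set,
hence 400 = 200 + 200. -/
theorem mainProg_spec (hF : Fits I W) {r₀ r : Fin I.n → Fin I.n → Prop}
    (hr : ∀ s t, r s t → r t s)
    (hact : ∀ b s t, r s t → r (I.act hF.pos b s) (I.act hF.pos b t))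
    {st : RState (Fin I.n)} (hH : Holds I σ st) (hL : LoopInv (I.act hF.pos) r₀ r st)
    (h15 : σ.reg 15 = 2 * I.m) (hch : Chains I σ fun _ => I.n) :
    Wp I W mainProg σ t fun t' τ =>
      t' ≤ t + 200 * pot (wt (I.act hF.pos)) st + 400 * (I.n * I.n) + 20 * I.n + 10 ∧
      ∃ st', Holds I τ st' ∧ LoopInv (I.act hF.pos) r₀ r st' ∧ st'.work = ∅ := by
  have hW := hF.lt
  have hpos := hF.pos
  have hcw : ∀ st : RState (Fin I.n), st.Valid → st.work.card ≤ st.parts.card := fun st hv =>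
    Finset.card_le_card hv.work_subset
  simp only [mainProg, Wp_seq, Wp_assign, EWp_const, Expr.cost]
  refine ⟨by omega, ?_⟩
  refine Wp_loop (fun t' τ => ∃ st', Holds I τ st' ∧ LoopInv (I.act hF.pos) r₀ r st' ∧
    (∀ c < τ.reg 11, τ.arr 5 c = 0) ∧ τ.reg 11 ≤ τ.reg 2 ∧
    t' + 200 * pot (wt (I.act hF.pos)) st' + 200 * (I.n * st'.work.card) ≤
      t + 2 + 200 * pot (wt (I.act hF.pos)) st + 400 * (I.n * τ.reg 2) + 20 * τ.reg 11)
    (t + 2 + 200 * pot (wt (I.act hF.pos)) st + 400 * (I.n * I.n) + 20 * I.n) ?_ ?_ ?_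
  · refine ⟨st, ⟨by simpa using hH.reg0, by simpa using hH.repr, hH.count, hH.mark⟩, hL, by simp,
      by simp, ?_⟩
    have := Nat.mul_le_mul_left I.n (hcw st hL.valid)
    rw [hH.repr.card_parts] at this
    simp
    omega
  · rintro t' τ ⟨st', hH', -, -, h11, ht⟩
    have hk := hH'.repr.le
    have := Nat.mul_le_mul_left I.n hk
    omega
  · rintro t' τ hFr ⟨st', hH', hL', hz, h11, ht⟩
    have hR := hH'.repr
    have hk := hR.le
    have hk2 := Nat.mul_le_mul_left I.n hk
    have hin := hR.inT_le (τ.reg 11)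
    simp only [TWp_lt, EWp_reg, decide_eq_true_eq, decide_eq_false_iff_not, Wp_ite, TWp_eq,
      EWp_cell, EWp_const, Test.cost, Expr.cost]
    repeat refine And.intro (by omega) ?_
    constructor
    · intro hlt
      repeat refine And.intro (by omega) ?_
      constructor
      · intro h0
        simp only [Wp_assign, EWp_add, EWp_reg, EWp_const, Expr.cost]
        repeat refine And.intro (by omega) ?_
        refine ⟨st', ⟨by simpa using hH'.reg0, by simpa using hH'.repr, hH'.count, hH'.mark⟩, hL',
          fun c hc => ?_, by simpa using hlt, ?_⟩
        · simp only [Mem.setReg_reg, if_true, Mem.setReg_arr] at hc ⊢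
          by_cases h : c = τ.reg 11
          · rw [h, h0]
          · exact hz c (by omega)
        · simp
          omega
      · intro h0
        have hw := (hR.mem_work hlt).2 h0
        refine (iterProg_spec hF hH' rfl hlt ?_ ?_).mono ?_
        · rw [hFr.reg 15 (by decide)]; simpa using h15
        · intro b hb x hx
          rw [hFr.arr 10 (by decide), hFr.arr 11 (by decide)]
          exact hch b hb x hx
        rintro t₁ ρ ⟨ht₁, h11', st'', hseq, hH''⟩
        set C := fiber I.n (τ.arr 0) (τ.reg 11)
        have hvp := hL'.valid.pop C
        refine ⟨st'', hH'', hL'.iterate hr hact hw ?_ ?_ hseq, by simp [h11'], by omega, ?_⟩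
        · intro X hX
          obtain ⟨b, hb, rfl⟩ := List.mem_map.1 hX
          exact ⟨⟨b, by simpa using hb⟩, fun s => mem_actPre (b := ⟨b, by simpa using hb⟩) hpos⟩
        · intro b
          exact ⟨I.actPre C b, List.mem_map.2 ⟨b, by simp, rfl⟩, fun s => mem_actPre hpos⟩
        · have hpot := (hseq.preserves (p := fun a => pot (wt (I.act hF.pos)) a ≤
              pot (wt (I.act hF.pos)) (st'.pop C))
            (fun X _ a b hva hab ih => (hab.pot_le _ hva).trans ih) hvp le_rfl).2
          have hpop := pot_pop (wt (I.act hF.pos)) hL'.valid hw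
          have hcard := (hseq.preserves (p := fun a => a.work.card + (st'.pop C).parts.card ≤
              (st'.pop C).work.card + a.parts.card)
            (fun X _ a b hva hab ih => by have := hab.card_work hva; omega) hvp le_rfl).2
          have hp : (st'.pop C).parts.card = τ.reg 2 := hR.card_parts
          have hp' : (st'.pop C).work.card + 1 = st'.work.card := by
            unfold RState.pop
            convert Finset.card_erase_add_one hw
          rw [hp, hH''.repr.card_parts] at hcard
          -- One member leaves the work set, and each new label brings in at most one.
          have hmul := Nat.mul_le_mul_left I.n
            (by omega : st''.work.card + τ.reg 2 + 1 ≤ st'.work.card + ρ.reg 2)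
          simp only [Nat.mul_add, Nat.mul_one] at hmul
          rw [h11']
          omega
    · intro hge
      have h11e : τ.reg 11 = τ.reg 2 := by omega
      refine ⟨by omega, st', hH', hL', Finset.eq_empty_of_forall_notMem fun C hC => ?_⟩
      obtain ⟨c, hc, h0, -⟩ := (hR.work C).1 hC
      exact h0 (hz c (by omega))

/-- Write the images of the letters and the multiplication table. -/
def outProg : Prog :=
  .seq (forProg 3 1 (.store 1 (.reg 3) (.cell 0 (.gen (.reg 3)))))
  (.seq (forProg 3 0 (forProg 4 0
    (.store 2 (.add (.mul (.cell 0 (.reg 3)) (.reg 2)) (.cell 0 (.reg 4)))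
      (.cell 0 (.prod (.reg 3) (.reg 4))))))
  (.assign 0 (.reg 2)))

/-- No representatives are chosen: every pair of elements of S writes the cell of its pair of
classes. By `hmul` all these values agree, and n² steps are within the budget. -/
theorem outProg_spec (hF : Fits I W) {st : RState (Fin I.n)} (hH : Holds I σ st)
    (h1 : σ.reg 1 = I.m)
    (hmul : ∀ s < I.n, ∀ t < I.n, ∀ s' < I.n, ∀ t' < I.n, σ.arr 0 s = σ.arr 0 s' →
      σ.arr 0 t = σ.arr 0 t' → σ.arr 0 (I.mulN s t) = σ.arr 0 (I.mulN s' t')) :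
    Wp I W outProg σ t fun t' τ => t' ≤ t + 60 * (I.n * I.n) + 20 * I.n + 20 * I.m + 20 ∧
      τ.reg 0 = σ.reg 2 ∧ τ.arr 0 = σ.arr 0 ∧
      (∀ a < I.m, τ.arr 1 a = σ.arr 0 (I.genN a)) ∧
      ∀ s < I.n, ∀ t < I.n,
        τ.arr 2 (σ.arr 0 s * σ.reg 2 + σ.arr 0 t) = σ.arr 0 (I.mulN s t) := by
  have hW := hF.lt
  have hpos := hF.pos
  have hR := hH.repr
  have hk := hR.le
  have hkk : σ.reg 2 * σ.reg 2 ≤ I.n * I.n := Nat.mul_le_mul hk hk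
  have hcl : ∀ s, s < I.n → σ.arr 0 s < σ.reg 2 := fun s hs => hR.cls_lt ⟨s, hs⟩
  rw [outProg, Wp_seq]
  have H1 : Wp I W (forProg 3 1 (.store 1 (.reg 3) (.cell 0 (.gen (.reg 3))))) σ t fun t' τ =>
      t' ≤ t + 20 * I.m + 10 ∧ ∀ a < I.m, τ.arr 1 a = σ.arr 0 (I.genN a) := by
    refine Wp_for (fun i t' τ => t' ≤ t + 4 + 20 * i ∧ ∀ a < i, τ.arr 1 a = σ.arr 0 (I.genN a))
      h1 (by omega) (by decide) (by decide) (by decide) (by simp) ?_ ?_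
    · rintro i t' τ hi hFr hx ⟨ht, hJ⟩
      have e0 : τ.arr 0 = σ.arr 0 := hFr.arr 0 (by decide)
      have hg := genN_lt (I := I) (a := i) hpos
      have hc := hcl _ hg
      simp [hx, Expr.cost, e0]
      repeat refine And.intro (by omega) ?_
      intro a ha
      by_cases h : a = i
      · simp [h]
      · rw [Function.update_of_ne h]; exact hJ a (by omega)
    · rintro t' τ hFr hx ⟨ht, hJ⟩
      exact ⟨by omega, hJ⟩
  refine H1.frame.mono ?_
  rintro t₁ σ₁ ⟨hF₁, ht₁, hg₁⟩
  have r2₁ : σ₁.reg 2 = σ.reg 2 := hF₁.reg 2 (by decide)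
  have r0₁ : σ₁.reg 0 = I.n := (hF₁.reg 0 (by decide)).trans hH.reg0
  have e0₁ : σ₁.arr 0 = σ.arr 0 := hF₁.arr 0 (by decide)
  have H2 : Wp I W (forProg 3 0 (forProg 4 0
      (.store 2 (.add (.mul (.cell 0 (.reg 3)) (.reg 2)) (.cell 0 (.reg 4)))
        (.cell 0 (.prod (.reg 3) (.reg 4)))))) σ₁ t₁ fun t' τ =>
      t' ≤ t₁ + 60 * (I.n * I.n) + 20 * I.n + 5 ∧ ∀ s < I.n, ∀ t < I.n,
        τ.arr 2 (σ.arr 0 s * σ.reg 2 + σ.arr 0 t) = σ.arr 0 (I.mulN s t) := by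
    refine Wp_for (fun i t' τ => t' ≤ t₁ + 2 + (60 * I.n + 20) * i ∧ ∀ s < i, ∀ t < I.n,
      τ.arr 2 (σ.arr 0 s * σ.reg 2 + σ.arr 0 t) = σ.arr 0 (I.mulN s t))
      r0₁ (by omega) (by decide) (by decide) (by decide) (by simp) ?_ ?_
    · rintro i t₂ τ hi hFr hx ⟨ht, hJ⟩
      refine Wp_for (fun j t' τ' => t' ≤ t₂ + 5 + 60 * j ∧
        ∀ s < I.n, ∀ t < I.n, (s < i ∨ s = i ∧ t < j) →
          τ'.arr 2 (σ.arr 0 s * σ.reg 2 + σ.arr 0 t) = σ.arr 0 (I.mulN s t)) (N := I.n)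
        ((hFr.reg 0 (by decide)).trans r0₁) (by omega) (by decide) (by decide) (by decide) ?_ ?_ ?_
      · refine ⟨by omega, fun s hs t ht h => ?_⟩
        exact hJ s (h.resolve_right (by simp)) t ht
      · rintro j t₃ ρ hj hFρ hy ⟨ht', hJ'⟩
        have r3 : ρ.reg 3 = i := (hFρ.reg 3 (by decide)).trans hx
        have r2 : ρ.reg 2 = σ.reg 2 := by
          rw [hFρ.reg 2 (by decide), hFr.reg 2 (by decide), r2₁]
        have e0 : ρ.arr 0 = σ.arr 0 := by
          rw [hFρ.arr 0 (by decide), hFr.arr 0 (by decide), e0₁]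
        have hci := hcl i hi
        have hcj := hcl j hj
        have hm := mulN_lt (I := I) (s := i) (t := j) hpos
        have hcm := hcl _ hm
        have hlt := add_mul_lt hci hcj
        have hlt' := Nat.le_add_right (σ.arr 0 i * σ.reg 2) (σ.arr 0 j)
        simp [r3, hy, r2, e0, Expr.cost]
        repeat refine And.intro (by omega) ?_
        intro s hs t ht h
        -- Either the cell has just been overwritten, with an equal value, or it is a different
        -- cell.
        by_cases he : σ.arr 0 s = σ.arr 0 i ∧ σ.arr 0 t = σ.arr 0 j
        · rw [he.1, he.2, Function.update_self]
          exact hmul i hi j hj s hs t ht he.1.symm he.2.symm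
        · have hne : σ.arr 0 s * σ.reg 2 + σ.arr 0 t ≠ σ.arr 0 i * σ.reg 2 + σ.arr 0 j := by
            rwa [Ne, mul_add_inj (hcl t ht) hcj]
          rw [Function.update_of_ne hne]
          refine hJ' s hs t ht (h.imp_right fun h => ⟨h.1, ?_⟩)
          have : t ≠ j := by rintro rfl; exact he ⟨by rw [h.1], rfl⟩
          omega
      · rintro t₃ ρ hFρ hy ⟨ht', hJ'⟩
        refine ⟨by rw [Nat.mul_succ]; omega, fun s hs t ht => ?_⟩
        exact hJ' s (by omega) t ht (by omega)
    · rintro t' τ hFr hx ⟨ht, hJ⟩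
      exact ⟨by nlinarith, hJ⟩
  rw [Wp_seq]
  refine H2.frame.mono ?_
  rintro t₂ σ₂ ⟨hF₂, ht₂, hm₂⟩
  have r2₂ : σ₂.reg 2 = σ.reg 2 := (hF₂.reg 2 (by decide)).trans r2₁
  rw [Wp_assign, EWp_reg]
  refine ⟨by omega, by simp only [Expr.cost]; omega, by simp [r2₂], ?_, fun a ha => ?_, hm₂⟩
  · rw [Mem.setReg_arr, hF₂.arr 0 (by decide), e0₁]
  · rw [Mem.setReg_arr, hF₂.arr 1 (by decide), hg₁ a ha]

end Output

/-! ### Transport between S and its numbering -/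

section Encoding

theorem exists_eq_of_lt {S : Type v} {n : ℕ} (eS : S ≃ Fin n) {k : ℕ} (hk : k < n) :
    ∃ s, k = eS s := ⟨eS.symm ⟨k, hk⟩, by simp⟩

theorem forall_mem_pairSets {I : Input} {E : ℕ → ℕ} (i j : Fin I.n) :
    (∀ X ∈ (List.range I.n).flatMap (I.pairSets E), (i ∈ X ↔ j ∈ X)) ↔
      ∀ k < I.n, (I.pairN E k i ↔ I.pairN E k j) ∧ (I.pairN E i k ↔ I.pairN E j k) := by
  constructor
  · intro hX k hk
    have h1 := hX _ (List.mem_flatMap.2 ⟨k, List.mem_range.2 hk, List.mem_cons_self⟩)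
    have h2 := hX _ (List.mem_flatMap.2 ⟨k, List.mem_range.2 hk,
      List.mem_cons_of_mem _ List.mem_cons_self⟩)
    simpa using And.intro h1 h2
  · intro hk X hX
    obtain ⟨k, hk', hX⟩ := List.mem_flatMap.1 hX
    have := hk k (List.mem_range.1 hk')
    simp only [Input.pairSets, List.mem_cons, List.not_mem_nil, or_false] at hX
    rcases hX with rfl | rfl
    · simpa using this.1
    · simpa using this.2

variable {A : Type u} {S : Type v} [Semigroup S] {n m : ℕ} (h : FreeSemigroup A →ₙ* S)
  (P : Set (S × S)) (eA : A ≃ Fin m) (eS : S ≃ Fin n)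

theorem encode_mulN (s t : S) : (encode h P eA eS).mulN (eS s) (eS t) = eS (s * t) := by
  have : ((eS s : ℕ) < (encode h P eA eS).n ∧ (eS t : ℕ) < (encode h P eA eS).n) :=
    ⟨(eS s).2, (eS t).2⟩
  rw [Input.mulN, dif_pos this]
  change (eS (eS.symm (eS s) * eS.symm (eS t)) : ℕ) = _
  simp

theorem encode_genN (a : A) : (encode h P eA eS).genN (eA a) = eS (h (FreeSemigroup.of a)) := by
  have : (eA a : ℕ) < (encode h P eA eS).m := (eA a).2
  rw [Input.genN, dif_pos this]
  change (eS (h (FreeSemigroup.of (eA.symm (eA a)))) : ℕ) = _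
  simp

theorem encode_accN (s t : S) : (encode h P eA eS).accN (eS s) (eS t) ↔ (s, t) ∈ P := by
  have : ((eS s : ℕ) < (encode h P eA eS).n ∧ (eS t : ℕ) < (encode h P eA eS).n) :=
    ⟨(eS s).2, (eS t).2⟩
  rw [Input.accN, exists_prop_of_true this]
  change (eS.symm (eS s), eS.symm (eS t)) ∈ P ↔ _
  simp

theorem encode_powN (s : S) (k : ℕ) : (encode h P eA eS).powN (eS s) k = eS (spow s k) := by
  induction k with
  | zero => rfl
  | succ k ih => rw [Input.powN, ih, encode_mulN]; rfl

theorem encode_exists_idem [Fintype S] (hn : Fintype.card S = n) (k : ℕ) (hk : k < n) :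
    ∃ l < n, (encode h P eA eS).mulN ((encode h P eA eS).powN k l)
      ((encode h P eA eS).powN k l) = (encode h P eA eS).powN k l := by
  obtain ⟨s, rfl⟩ := exists_eq_of_lt eS hk
  obtain ⟨l, hl, he⟩ := exists_spow_idem s
  exact ⟨l, by omega, by rw [encode_powN, encode_mulN, he]⟩

theorem encode_actN_right (a : A) (s : S) :
    (encode h P eA eS).actN (eA a) (eS s) = eS (s * h (FreeSemigroup.of a)) := by
  have : (eA a : ℕ) < (encode h P eA eS).m := (eA a).2
  rw [Input.actN, if_pos this, encode_genN, encode_mulN]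

theorem encode_actN_left (a : A) (s : S) :
    (encode h P eA eS).actN (m + eA a) (eS s) = eS (h (FreeSemigroup.of a) * s) := by
  have h1 : ¬ m + (eA a : ℕ) < (encode h P eA eS).m := by
    have : (encode h P eA eS).m = m := rfl
    omega
  have h2 : m + (eA a : ℕ) - (encode h P eA eS).m = eA a := Nat.add_sub_cancel_left _ _
  rw [Input.actN, if_neg h1, h2, encode_genN, encode_mulN]

variable {h P}

/-- The table E may hold any idempotent power of each element, since `mem_maxPairs_iff` holds for
any choice. -/
theorem encode_pairN [Finite S] (hs : Function.Surjective h) (hP : IsClosedLinked P) {E : ℕ → ℕ}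
    (hE : ∀ k < n, (encode h P eA eS).IsIdem k (E k)) (s t : S) :
    (encode h P eA eS).pairN E (eS s) (eS t) ↔ (s, t) ∈ maxPairs h P := by
  obtain ⟨h1, k, h2⟩ := hE (eS t) (eS t).2
  rw [encode_powN] at h2
  rw [h2, encode_mulN] at h1
  have he : IsIdemPow t (spow t k) := ⟨eS.injective (Fin.ext h1), k, rfl⟩
  rw [mem_maxPairs_iff h hs hP he, Input.pairN, h2, encode_mulN, encode_accN]

theorem encode_cong_iff [Finite S] (hs : Function.Surjective h) (hP : IsClosedLinked P) {E : ℕ → ℕ}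
    (hE : ∀ k < n, (encode h P eA eS).IsIdem k (E k)) (i j : Fin n) :
    cong h P (eS.symm i) (eS.symm j) ↔
      ∀ X ∈ (List.range n).flatMap ((encode h P eA eS).pairSets E),
        ((i : Fin (encode h P eA eS).n) ∈ X ↔ j ∈ X) := by
  have key := encode_pairN eA eS hs hP hE
  refine Iff.trans ?_ (forall_mem_pairSets (I := encode h P eA eS) i j).symm
  obtain ⟨s, rfl⟩ := eS.surjective i
  obtain ⟨t, rfl⟩ := eS.surjective j
  rw [Equiv.symm_apply_apply, Equiv.symm_apply_apply]
  constructor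
  · intro hst k hk
    obtain ⟨z, rfl⟩ := exists_eq_of_lt eS hk
    rw [key, key, key, key]
    exact hst z
  · intro hk z
    have := hk (eS z) (eS z).2
    rwa [key, key, key, key] at this

/-- The labels number the classes of ≡. As ≡_L is the pullback of ≡ and h is surjective, the label
of h w depends only on the class of w, and this is a bijection onto the labels. -/
theorem holdsSyntactic_of_labels [Finite S] (hs : Function.Surjective h) (hP : IsClosedLinked P)
    {σ : Mem} (hlt : ∀ s, σ.arr 0 (eS s) < σ.reg 0)
    (hsurj : ∀ c < σ.reg 0, ∃ s, σ.arr 0 (eS s) = c)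
    (hcls : ∀ s t, σ.arr 0 (eS s) = σ.arr 0 (eS t) ↔ equivCon h P s t)
    (hgen : ∀ a, σ.arr 1 (eA a) = σ.arr 0 (eS (h (FreeSemigroup.of a))))
    (hmul : ∀ s t, σ.arr 2 (σ.arr 0 (eS s) * σ.reg 0 + σ.arr 0 (eS t)) = σ.arr 0 (eS (s * t))) :
    HoldsSyntactic h (lang h P) eA eS σ := by
  let ψ : SyntacticSemigroup (lang h P) → Fin (σ.reg 0) :=
    Quotient.lift (fun w => ⟨σ.arr 0 (eS (h w)), hlt _⟩) fun u v huv =>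
      Fin.ext ((hcls _ _).2 ((syntacticCon_iff h hs hP u v).1 huv))
  have hψ : ∀ w, (ψ (syntacticHom (lang h P) w) : ℕ) = σ.arr 0 (eS (h w)) := fun w => rfl
  have hsur : Function.Surjective (syntacticHom (lang h P)) := Quotient.exists_rep
  have hb : Function.Bijective ψ := by
    constructor
    · intro x y hxy
      obtain ⟨u, rfl⟩ := hsur x
      obtain ⟨v, rfl⟩ := hsur y
      have := congrArg Fin.val hxy
      rw [hψ, hψ, hcls, ← syntacticCon_iff h hs hP] at this
      exact Quotient.sound this
    · intro c
      obtain ⟨s, hc⟩ := hsurj c c.2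
      obtain ⟨w, rfl⟩ := hs s
      exact ⟨syntacticHom (lang h P) w, Fin.ext ((hψ w).trans hc)⟩
  refine ⟨Equiv.ofBijective ψ hb, fun w => (hψ w).symm, fun a => ?_, fun x y => ?_⟩
  · rw [hgen]; exact (hψ _).symm
  · obtain ⟨u, rfl⟩ := hsur x
    obtain ⟨v, rfl⟩ := hsur y
    rw [← map_mul, Equiv.ofBijective_apply, Equiv.ofBijective_apply, Equiv.ofBijective_apply, hψ,
      hψ, hψ, map_mul, hmul]

end Encoding

/-! ### The complete program -/

section Correctness

variable {A : Type u} {S : Type v} [Semigroup S] {n m : ℕ} {h : FreeSemigroup A →ₙ* S}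
  {P : Set (S × S)} (eA : A ≃ Fin m) (eS : S ≃ Fin n)

theorem encode_act (hn : 0 < n) (b : Fin (2 * m)) :
    ∃ b' : A ⊕ A, ∀ s, (encode h P eA eS).act hn b (eS s) = eS (letterAct h b' s) := by
  by_cases hb : (b : ℕ) < m
  · refine ⟨.inl (eA.symm ⟨b, hb⟩), fun s => Fin.ext ?_⟩
    have := encode_actN_right h P eA eS (eA.symm ⟨b, hb⟩) s
    rwa [Equiv.apply_symm_apply] at this
  · have hb' : (b : ℕ) - m < m := by omega
    refine ⟨.inr (eA.symm ⟨b - m, hb'⟩), fun s => Fin.ext ?_⟩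
    have := encode_actN_left h P eA eS (eA.symm ⟨b - m, hb'⟩) s
    rw [Equiv.apply_symm_apply] at this
    simp only [show m + ((b : ℕ) - m) = b by omega] at this
    exact this

theorem exists_encode_act (hn : 0 < n) (b' : A ⊕ A) :
    ∃ b : Fin (2 * m), ∀ s, (encode h P eA eS).act hn b (eS s) = eS (letterAct h b' s) := by
  rcases b' with a | a
  · exact ⟨⟨eA a, by omega⟩, fun s => Fin.ext (encode_actN_right h P eA eS a s)⟩
  · exact ⟨⟨m + eA a, by omega⟩, fun s => Fin.ext (encode_actN_left h P eA eS a s)⟩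

theorem encode_act_equivCon (hn : 0 < n) (b : Fin (2 * m)) (i j : Fin n)
    (hij : equivCon h P (eS.symm i) (eS.symm j)) :
    equivCon h P (eS.symm ((encode h P eA eS).act hn b i))
      (eS.symm ((encode h P eA eS).act hn b j)) := by
  obtain ⟨b', hb⟩ := encode_act (h := h) (P := P) eA eS hn b
  obtain ⟨s, rfl⟩ := eS.surjective i
  obtain ⟨t, rfl⟩ := eS.surjective j
  rw [hb, hb]
  simp only [Equiv.symm_apply_apply] at hij ⊢
  exact equivCon_letterAct b' s t hij

/-- The argument of `Run.isClasses`, on the numbered copy of S. -/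
theorem LoopInv.rel_iff_equivCon (hs : Function.Surjective h) (hn : 0 < n)
    {st : RState (Fin n)} (hL : LoopInv ((encode h P eA eS).act hn)
      (fun i j => cong h P (eS.symm i) (eS.symm j))
      (fun i j => equivCon h P (eS.symm i) (eS.symm j)) st) (hw : st.work = ∅) (s t : S) :
    st.Rel (eS s) (eS t) ↔ equivCon h P s t := by
  constructor
  · have key : ∀ b' s t, st.Rel (eS s) (eS t) →
        st.Rel (eS (letterAct h b' s)) (eS (letterAct h b' t)) := by
      intro b' s t hst
      obtain ⟨b, hb⟩ := exists_encode_act (h := h) (P := P) eA eS hn b'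
      have := hL.pending.rel hw b _ _ hst
      rwa [hb, hb] at this
    intro hst
    refine equivCon_of_stable h hs (r := fun s t => st.Rel (eS s) (eS t)) (fun s t hst => ?_)
      (fun a s t => key (.inl a) s t) (fun a s t => key (.inr a) s t) hst
    simpa using hL.fine _ _ hst
  · intro hst
    obtain ⟨C, hC, hsC⟩ := hL.valid.cover (eS s)
    exact ⟨C, hC, hsC, hL.saturated C hC _ _ (by simpa using hst) hsC⟩

/-- The program that computes the syntactic morphism. -/
def syntacticProg : Prog := .ite (.lt (.const 1) (.reg 0))
  (.seq idemProg (.seq firstProg (.seq setWorkProg (.seq actProg (.seq chainProg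
    (.seq mainProg outProg)))))) .skip

theorem syntacticProg_spec [Fintype S] (hs : Function.Surjective h) (hP : IsClosedLinked P)
    (hcard : Fintype.card S = n) {W : ℕ} (hn : 2 ≤ n) (hF : Fits (encode h P eA eS) W) :
    Wp (encode h P eA eS) W syntacticProg (encode h P eA eS).init 0 fun t τ =>
      t ≤ 3 + 1500 * (n * n) + 60 * n + 240 * (m * n) + 80 * m + 80 +
        200 * (n * (1 + 6 * m) * (Nat.log 2 n + 1)) ∧
      HoldsSyntactic h (lang h P) eA eS τ := by
  have hW := hF.lt
  have hpos : 0 < n := by omega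
  set I := encode h P eA eS with hI
  have hIn : I.n = n := rfl
  have hIm : I.m = m := rfl
  have hNe : Nonempty (Fin n) := ⟨⟨0, hpos⟩⟩
  have i0 : I.init.reg 0 = n := rfl
  have i1 : I.init.reg 1 = m := rfl
  rw [syntacticProg, Wp_ite, TWp_lt, EWp_const, EWp_reg, i0]
  refine ⟨by omega, by omega, fun _ => ?_, by simp; omega⟩
  rw [Wp_seq]
  refine (idemProg_spec hF i0 (encode_exists_idem h P eA eS hcard)).frame.mono ?_
  rintro t₁ σ₁ ⟨hF₁, ht₁, hE⟩
  -- Only array 12 has been written, so the zero initialization required by the later phases is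
  -- intact.
  have a₁ : ∀ a, a ≠ 12 → σ₁.arr a = fun _ => 0 := fun a ha =>
    hF₁.arr a (by simpa [idemProg, idemPowProg, forProg, Prog.modA] using ha)
  have r0₁ : σ₁.reg 0 = n := (hF₁.reg 0 (by decide)).trans i0
  rw [Wp_seq]
  refine (firstProg_spec hF r0₁ (by simp [a₁]) (by simp [a₁]) (by simp [a₁]) (by simp [a₁]) rfl
    fun s hs => (hE s hs).lt hs).frame.mono ?_
  rintro t₂ σ₂ ⟨hF₂, ht₂, st, hH, hseq⟩
  obtain ⟨hv, hfine, hsat⟩ := refinedSeq_univ (encode_cong_iff eA eS hs hP hE) hseq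
  rw [Wp_seq]
  refine (setWorkProg_spec hF hH).frame.mono ?_
  rintro t₃ σ₃ ⟨hF₃, ht₃, r2₃, hH₃⟩
  have hL : LoopInv (I.act hF.pos) (fun i j => cong h P (eS.symm i) (eS.symm j))
      (fun i j => equivCon h P (eS.symm i) (eS.symm j)) ⟨st.parts, st.parts⟩ :=
    LoopInv.start _ (fun _ _ => equivCon_le_cong) hv hfine hsat (fun _ h => h) fun _ h _ => h
  rw [Wp_seq]
  have r1₃ : σ₃.reg 1 = m := by
    rw [hF₃.reg 1 (by decide), hF₂.reg 1 (by decide), hF₁.reg 1 (by decide), i1]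
  refine (actProg_spec hF hH₃.reg0 r1₃).frame.mono ?_
  rintro t₄ σ₄ ⟨hF₄, ht₄, h9⟩
  have r0₄ : σ₄.reg 0 = n := (hF₄.reg 0 (by decide)).trans hH₃.reg0
  have r1₄ : σ₄.reg 1 = m := (hF₄.reg 1 (by decide)).trans r1₃
  rw [Wp_seq]
  refine (chainProg_spec hF r0₄ r1₄ h9 fun j => ?_).frame.mono ?_
  · rw [hF₄.arr 10 (by decide), hF₃.arr 10 (by decide), hF₂.arr 10 (by decide),
      a₁ 10 (by decide)]
  rintro t₅ σ₅ ⟨hF₅, ht₅, r15, hch⟩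
  have hH₅ : Holds I σ₅ ⟨st.parts, st.parts⟩ := by
    refine ⟨(hF₅.reg 0 (by decide)).trans r0₄, ?_, fun c => ?_, fun s => ?_⟩
    · rw [hF₅.reg 2 (by decide), hF₅.arr 0 (by decide), hF₅.arr 3 (by decide),
        hF₅.arr 5 (by decide), hF₄.reg 2 (by decide), hF₄.arr 0 (by decide),
        hF₄.arr 3 (by decide), hF₄.arr 5 (by decide)]
      exact hH₃.repr
    · rw [hF₅.arr 4 (by decide), hF₄.arr 4 (by decide), hH₃.count]
    · rw [hF₅.arr 6 (by decide), hF₄.arr 6 (by decide), hH₃.mark]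
  rw [Wp_seq]
  refine (mainProg_spec hF (fun _ _ => (equivCon h P).symm) (encode_act_equivCon eA eS hpos) hH₅ hL
    r15 hch).frame.mono ?_
  rintro t₆ σ₆ ⟨hF₆, ht₆, st₆, hH₆, hL₆, hw⟩
  have hrel : ∀ s t, σ₆.arr 0 (eS s) = σ₆.arr 0 (eS t) ↔ equivCon h P s t := fun s t => by
    rw [← hL₆.rel_iff_equivCon eA eS hs hpos hw]
    exact (hH₆.repr.rel_iff _ _).symm
  have hmulN : ∀ s t, I.mulN (eS s) (eS t) = eS (s * t) := encode_mulN h P eA eS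
  refine (outProg_spec hF hH₆ ?_ ?_).mono ?_
  · rw [hF₆.reg 1 (by decide), hF₅.reg 1 (by decide), r1₄, hIm]
  · intro i hi j hj i' hi' j' hj' h1 h2
    obtain ⟨s, rfl⟩ := exists_eq_of_lt eS hi
    obtain ⟨t, rfl⟩ := exists_eq_of_lt eS hj
    obtain ⟨s', rfl⟩ := exists_eq_of_lt eS hi'
    obtain ⟨t', rfl⟩ := exists_eq_of_lt eS hj'
    rw [hrel] at h1 h2
    rw [hmulN, hmulN, hrel]
    exact (equivCon h P).mul h1 h2
  rintro t₇ σ₇ ⟨ht₇, r0₇, e0₇, h1₇, h2₇⟩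
  constructor
  · have hpot : pot (wt (I.act hF.pos)) ⟨st.parts, st.parts⟩ ≤
        I.n * (1 + 6 * I.m) * (Nat.log 2 I.n + 1) := by
      refine (pot_le _ hL.valid).trans ?_
      rw [sum_wt_univ, Fintype.card_fin, Fintype.card_fin]
      refine le_of_eq ?_
      ring
    simp only [Test.cost, Expr.cost] at ht₁
    change t₇ ≤ 3 + 1500 * (I.n * I.n) + 60 * I.n + 240 * (I.m * I.n) + 80 * I.m + 80 +
      200 * (I.n * (1 + 6 * I.m) * (Nat.log 2 I.n + 1))
    omega
  · refine holdsSyntactic_of_labels eA eS hs hP (fun s => ?_) (fun c hc => ?_) (fun s t => ?_)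
      (fun a => ?_) fun s t => ?_
    · rw [e0₇, r0₇]; exact hH₆.repr.cls_lt _
    · rw [r0₇] at hc
      obtain ⟨i, hi⟩ := hH₆.repr.nonempty c hc
      refine ⟨eS.symm i, ?_⟩
      rw [e0₇]
      exact (congrArg (fun j : Fin n => σ₆.arr 0 j) (eS.apply_symm_apply i)).trans (mem_fiber.1 hi)
    · rw [e0₇, hrel]
    · rw [h1₇ _ (eA a).2, e0₇, hI, encode_genN]
    · rw [e0₇, r0₇, h2₇ _ (eS s).2 _ (eS t).2, hmulN]

/-- For n = 1 the bound is an absolute constant since log 1 = 0, so the program may not even run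
through the letters. It stops at once: the initial memory, with 1 in register 0 and zero arrays,
already describes the trivial semigroup. -/
theorem exists_exec_syntacticProg [Fintype S] [Nonempty S] (hs : Function.Surjective h)
    (hP : IsClosedLinked P) (hcard : Fintype.card S = n) :
    ∃ t σ, Exec (encode h P eA eS) ((m + n + 1) ^ 4) syntacticProg (encode h P eA eS).init t σ ∧
      (t : ℝ) ≤ 12000 * ((n : ℝ) ^ 2 + (m : ℝ) * n * Real.log n) ∧
      HoldsSyntactic h (lang h P) eA eS σ := by
  have hm : 0 < m := by
    obtain ⟨w, -⟩ := hs (Classical.arbitrary S)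
    exact (Nat.zero_le _).trans_lt (eA w.head).2
  have hn : 0 < n := hcard ▸ Fintype.card_pos
  rcases Nat.lt_or_ge 1 n with h2 | h1
  · have hF : Fits (encode h P eA eS) ((m + n + 1) ^ 4) := by
      refine ⟨hn, ?_⟩
      change 4 * (m * n) + n * n + 2 * n + 2 * m + 100 < (m + n + 1) ^ 4
      -- Here m + n + 1 ≥ 4, so the fourth power is at least 16 times the square, which exceeds the
      -- quadratic bound.
      have h4 : 4 * 4 * ((m + n + 1) * (m + n + 1)) ≤ (m + n + 1) ^ 4 := by
        rw [show (m + n + 1) ^ 4 =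
          (m + n + 1) * (m + n + 1) * ((m + n + 1) * (m + n + 1)) by ring]
        exact Nat.mul_le_mul_right _ (Nat.mul_le_mul (by omega) (by omega))
      nlinarith
    obtain ⟨t, σ, he, ht, hσ⟩ := syntacticProg_spec eA eS hs hP hcard h2 hF
    refine ⟨t, σ, he, ?_, hσ⟩
    refine (real_bound (k := 4000) (n := n) (m := m) h2 ?_).trans (le_of_eq (by norm_num))
    rw [Nat.zero_add] at ht
    refine ht.trans ?_
    obtain ⟨l, hl⟩ : ∃ l, Nat.log 2 n + 1 = l + 1 := ⟨_, rfl⟩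
    rw [hl]
    have e1 : 1 ≤ m * n := Nat.mul_pos hm hn
    have e2 : n ≤ m * n := Nat.le_mul_of_pos_left n hm
    have e3 : m ≤ m * n := Nat.le_mul_of_pos_right m hn
    have e4 : n * l ≤ m * n * l := Nat.mul_le_mul_right l e2
    nlinarith
  · obtain rfl : n = 1 := by omega
    have hsub : Subsingleton S := Fintype.card_le_one_iff_subsingleton.1 hcard.le
    -- Three units for the test and one for `skip`.
    refine ⟨4, (encode h P eA eS).init, ?_, ?_, ?_⟩
    · have hW : 1 < (m + 1 + 1) ^ 4 := Nat.one_lt_pow (by norm_num) (by omega)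
      refine Exec.ite_false (t := 1) ?_ .skip
      simp [Test.eval, Expr.eval, fit, hW, Input.init, encode]
    · norm_num
    · have hr : (encode h P eA eS).init.reg 0 = 1 := rfl
      refine holdsSyntactic_of_labels eA eS hs hP (fun s => by rw [hr]; exact Nat.one_pos)
        (fun c hc => ⟨Classical.arbitrary S, ?_⟩) (fun s t => ?_) (fun _ => rfl) fun _ _ => rfl
      · rw [hr] at hc
        change 0 = c
        omega
      · rw [Subsingleton.elim s t]
        exact ⟨fun _ => (equivCon h P).refl _, fun _ => rfl⟩

end Correctness

end OmegaSyn

theorem mainTheorem1 :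
    -- the partition refinement algorithm
    (∃ K : ℝ, ∀ (A : Type u) (S : Type v) [Fintype A] [Fintype S] [Nonempty S] [Semigroup S]
      (h : FreeSemigroup A →ₙ* S) (P : Set (S × S)),
      Function.Surjective h → IsClosedLinked P →
      (∀ c st, InitRun h P c st → IsClasses (cong h P) st.parts) ∧
      (∀ c st, Run h P c st →
        (c : ℝ) ≤ K * ((Fintype.card S : ℝ) ^ 2 +
          (Fintype.card A : ℝ) * (Fintype.card S : ℝ) * Real.log (Fintype.card S : ℝ))) ∧
      (∃ c st, Run h P c st ∧ st.work = ∅) ∧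
      (∀ c st, Run h P c st → st.work = ∅ → IsClasses (equivCon h P) st.parts) ∧
      (∃ φ : (equivCon h P).Quotient ≃* SyntacticSemigroup (lang h P),
        ∀ w : FreeSemigroup A,
          φ (h w : (equivCon h P).Quotient) = syntacticHom (lang h P) w)) ∧
    -- computation of the syntactic morphism on a random access machine
    (∃ (p : Prog) (K : ℝ) (d : ℕ), ∀ (A : Type u) (S : Type v) [Fintype A] [Fintype S] [Nonempty S]
      [Semigroup S] (h : FreeSemigroup A →ₙ* S) (P : Set (S × S))
      (eA : A ≃ Fin (Fintype.card A)) (eS : S ≃ Fin (Fintype.card S)),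
      Function.Surjective h → IsClosedLinked P →
      ∃ (t : ℕ) (σ : Mem),
        Exec (encode h P eA eS) ((Fintype.card A + Fintype.card S + 1) ^ d) p
          (encode h P eA eS).init t σ ∧
        (t : ℝ) ≤ K * ((Fintype.card S : ℝ) ^ 2 +
          (Fintype.card A : ℝ) * (Fintype.card S : ℝ) * Real.log (Fintype.card S : ℝ)) ∧
        HoldsSyntactic h (lang h P) eA eS σ) := by
  refine ⟨⟨21, fun A S _ _ _ _ h P hs hP => ?_⟩, syntacticProg, 12000, 4,
    fun A S _ _ _ _ h P eA eS hs hP => exists_exec_syntacticProg eA eS hs hP rfl⟩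
  -- S is non-empty and h is surjective, so there is a word and hence a letter.
  have hA : 0 < Fintype.card A := by
    obtain ⟨w, -⟩ := hs (Classical.arbitrary S)
    exact Fintype.card_pos_iff.2 ⟨w.head⟩
  refine ⟨fun c st hi => ?_, fun c st hr => hr.bound hA, exists_terminating_run h P,
    fun c st hr hw => hr.isClasses hs hw, exists_mulEquiv_syntactic h hs hP⟩
  obtain ⟨hv, hfine, hsat, -⟩ := hi.spec
  exact hv.isClasses hfine hsat
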